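/- Let $n\ge 1$ and let $(\phi_j)_{j\ge0}$ be a Littlewood–Paley family on $\mathbb R^n$: Schwartz functions whose Fourier transforms $\hat\phi_j(\xi)=\int\phi_j(x)e^{-2\pi i x\cdot\xi}\,dx$ satisfy $\operatorname{supp}\hat\phi_0\subset B(0,2)$, $\hat\phi_0\equiv1$ in a neighbourhood of $\overline{B(0,1)}$, and $\hat\phi_j(\xi)=\hat\phi_0(2^{-j}\xi)-\hat\phi_0(2^{1-j}\xi)$ for $j\ge1$. For $s\in\mathbb R$, $0<p,q\le\infty$ and $f\in\mathscr S'(\mathbb R^n)$ put $$\|f\|_{\mathscr B^s_{pq}}=\big\|(2^{js}\phi_j*f)_{j\ge0}\big\|_{\ell^q(L^p(\mathbb R^n))},\qquad \|f\|_{\mathscr F^s_{pq}}=\big\|(2^{js}\phi_j*f)_{j\ge0}\big\|_{L^p(\mathbb R^n;\ell^q)}\quad(p<\infty),$$ $$\|f\|_{\mathscr F^s_{\infty q}}=\sup_{x\in\mathbb R^n,\,J\in\mathbb Z}2^{Jn/q}\big\|(2^{js}\phi_j*f)_{j\ge\max(J,0)}\big\|_{L^q(B(x,2^{-J});\ell^q)},$$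 and let $\mathscr B^s_{pq}$, $\mathscr F^s_{pq}$ be the sets of $f\in\mathscr S'(\mathbb R^n)$ for which the respective quantity is finite. Let $(y_j)_{j\ge1}\subset\mathbb R^n$ satisfy $\inf_{j\ne k}|y_j-y_k|>0$, and let $$Tf=\sum_{j=1}^\infty(\phi_j*f)(\cdot-y_j),$$ defined for those $f\in\mathscr S'(\mathbb R^n)$ for which the series converges in $\mathscr S'(\mathbb R^n)$ (with the topology of pointwise convergence on Schwartz functions). Then: (i) $T$ is defined on all of $\mathscr S'(\mathbb R^n)$ and is a continuous linear operator $\mathscr S'(\mathbb R^n)\to\mathscr S'(\mathbb R^n)$ if and only if there is $N_0>0$ such that $|y_j|\le2^{N_0j}$ for every $j\ge1$. (ii) For all $s\in\mathbb R$ and $0<p,q\le\infty$ (without any growth condition on $(y_j)$), $T$ is defined on $\mathscr B^s_{pq}$ and is a bounded linear operator $\mathscr B^s_{pq}\to\mathscr B^s_{pq}$: there is a finite constant $C$ with $\|Tf\|_{\mathscr B^s_{pq}}\le C\|f\|_{\mathscr B^s_{pq}}$ for all $f\in\mathscr B^s_{pq}$. (iii) For all $s\in\mathbb R$ and $0<p,q\le\infty$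 with $p\ne q$, $T(\mathscr F^s_{pq})\not\subset\mathscr F^s_{pq}$: there is $f\in\mathscr F^s_{pq}$ for which $Tf$ is defined and $Tf\notin\mathscr F^s_{pq}$. -/

import Mathlib

open MeasureTheory Filter Topology Set
open scoped SchwartzMap FourierTransform ENNReal NNReal

noncomputable section

namespace LittlewoodPaley

/-- A Littlewood–Paley family on `ℝⁿ`: Schwartz functions `φ₀, φ₁, …` whose Fourier transforms
(normalised with `e^{-2πi x·ξ}`) satisfy `supp φ̂₀ ⊂ B(0,2)`, `φ̂₀ = 1` near the closed unit ball,
and `φ̂ⱼ(ξ) = φ̂₀(2^{-j} ξ) - φ̂₀(2^{1-j} ξ)` for `j ≥ 1`. -/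
structure IsLittlewoodPaleyFamily {n : ℕ} (φ : ℕ → 𝓢(EuclideanSpace ℝ (Fin n), ℂ)) : Prop where
  tsupport_subset : tsupport (𝓕 (φ 0) : 𝓢(EuclideanSpace ℝ (Fin n), ℂ)) ⊆ Metric.ball 0 2
  eq_one : ∀ᶠ ξ in 𝓝ˢ (Metric.closedBall (0 : EuclideanSpace ℝ (Fin n)) 1), 𝓕 (φ 0) ξ = 1
  dilation : ∀ j : ℕ, 1 ≤ j → ∀ ξ : EuclideanSpace ℝ (Fin n),
    𝓕 (φ j) ξ = 𝓕 (φ 0) ((2 : ℝ) ^ (-(j : ℤ)) • ξ) - 𝓕 (φ 0) ((2 : ℝ) ^ (1 - (j : ℤ)) • ξ)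

variable {n : ℕ}

/-- The reflection `y ↦ φ (-y)`. -/
def reflect (φ : 𝓢(EuclideanSpace ℝ (Fin n), ℂ)) : 𝓢(EuclideanSpace ℝ (Fin n), ℂ) :=
  SchwartzMap.compCLMOfContinuousLinearEquiv ℂ (ContinuousLinearEquiv.neg ℝ) φ

/-- The values of the smooth function `φ ∗ f`, for `f` a tempered distribution:
`(φ ∗ f)(x) = ⟨f, φ(x - ·)⟩`. -/
def convFun (φ : 𝓢(EuclideanSpace ℝ (Fin n), ℂ)) (f : 𝓢'(EuclideanSpace ℝ (Fin n), ℂ))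
    (x : EuclideanSpace ℝ (Fin n)) : ℂ :=
  f (SchwartzMap.compSubConstCLM ℂ x (reflect φ))

/-- `f ↦ φ ∗ f` as an operator on tempered distributions: `⟨φ ∗ f, g⟩ = ⟨f, φ(-·) ∗ g⟩`. -/
def convDist (φ : 𝓢(EuclideanSpace ℝ (Fin n), ℂ)) :
    𝓢'(EuclideanSpace ℝ (Fin n), ℂ) →L[ℂ] 𝓢'(EuclideanSpace ℝ (Fin n), ℂ) :=
  PointwiseConvergenceCLM.precomp ℂ
    (SchwartzMap.convolution (ContinuousLinearMap.mul ℂ ℂ) (reflect φ))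

/-- The translation `τ_y f = f(· - y)` on tempered distributions: `⟨τ_y f, g⟩ = ⟨f, g(· + y)⟩`. -/
def translateDist (y : EuclideanSpace ℝ (Fin n)) :
    𝓢'(EuclideanSpace ℝ (Fin n), ℂ) →L[ℂ] 𝓢'(EuclideanSpace ℝ (Fin n), ℂ) :=
  PointwiseConvergenceCLM.precomp ℂ (SchwartzMap.compSubConstCLM ℂ (-y))

/-- The partial sum `∑_{j=1}^J τ_{y_j} (φ_j ∗ f)`. -/
def partialSum (φ : ℕ → 𝓢(EuclideanSpace ℝ (Fin n), ℂ)) (y : ℕ → EuclideanSpace ℝ (Fin n))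
    (J : ℕ) : 𝓢'(EuclideanSpace ℝ (Fin n), ℂ) →L[ℂ] 𝓢'(EuclideanSpace ℝ (Fin n), ℂ) :=
  ∑ j ∈ Finset.Icc 1 J, translateDist (y j) ∘L convDist (φ j)

/-- The operator `T f = ∑_{j ≥ 1} τ_{y_j} (φ_j ∗ f)`, as a linear operator whose domain consists of
all tempered distributions `f` for which the series converges in the space of tempered
distributions. -/
def shiftedSum (φ : ℕ → 𝓢(EuclideanSpace ℝ (Fin n), ℂ)) (y : ℕ → EuclideanSpace ℝ (Fin n)) :
    𝓢'(EuclideanSpace ℝ (Fin n), ℂ) →ₗ.[ℂ] 𝓢'(EuclideanSpace ℝ (Fin n), ℂ) where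
  domain :=
    { carrier := {f | ∃ u, Tendsto (fun J => partialSum φ y J f) atTop (𝓝 u)}
      add_mem' := by
        rintro f g ⟨u, hu⟩ ⟨v, hv⟩
        exact ⟨u + v, by simpa only [map_add] using hu.add hv⟩
      zero_mem' := ⟨0, by simp only [map_zero, tendsto_const_nhds]⟩
      smul_mem' := by
        rintro c f ⟨u, hu⟩
        exact ⟨c • u, by simpa only [map_smul] using hu.const_smul c⟩ }
  toFun :=
    { toFun := fun f => Classical.choose f.2
      map_add' := fun f g => by
        refine tendsto_nhds_unique (Classical.choose_spec (f + g).2) ?_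
        simpa only [Submodule.coe_add, map_add] using
          (Classical.choose_spec f.2).add (Classical.choose_spec g.2)
      map_smul' := fun c f => by
        refine tendsto_nhds_unique (Classical.choose_spec (c • f).2) ?_
        simpa only [Submodule.coe_smul, map_smul, RingHom.id_apply] using
          (Classical.choose_spec f.2).const_smul c }

theorem tendsto_shiftedSum (φ : ℕ → 𝓢(EuclideanSpace ℝ (Fin n), ℂ))
    (y : ℕ → EuclideanSpace ℝ (Fin n)) (f : (shiftedSum φ y).domain) :
    Tendsto (fun J => partialSum φ y J f) atTop (𝓝 (shiftedSum φ y f)) :=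
  Classical.choose_spec f.2

/-- The weighted Littlewood–Paley piece `2^{js} (φ_j ∗ f)(x)`. -/
def piece (φ : ℕ → 𝓢(EuclideanSpace ℝ (Fin n), ℂ)) (s : ℝ)
    (f : 𝓢'(EuclideanSpace ℝ (Fin n), ℂ)) (j : ℕ) (x : EuclideanSpace ℝ (Fin n)) : ℂ :=
  ((2 : ℝ) ^ ((j : ℝ) * s) : ℝ) • convFun (φ j) f x

/-- The Besov (quasi-)norm `‖(2^{js} φ_j ∗ f)_j‖_{ℓ^q(L^p)}`, with values in `[0, ∞]`. The
`ℓ^q` norm is the `L^q` norm for the counting measure on `ℕ`. -/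
def besovNorm (φ : ℕ → 𝓢(EuclideanSpace ℝ (Fin n), ℂ)) (s : ℝ) (p q : ℝ≥0∞)
    (f : 𝓢'(EuclideanSpace ℝ (Fin n), ℂ)) : ℝ≥0∞ :=
  eLpNorm (fun j : ℕ => eLpNorm (fun x => piece φ s f j x) p volume) q Measure.count

/-- The Triebel–Lizorkin (quasi-)norm, with values in `[0, ∞]`: for `p < ∞` it is
`‖(2^{js} φ_j ∗ f)_j‖_{L^p(ℓ^q)}`, and for `p = ∞` it is the supremum over `x ∈ ℝⁿ` and `J ∈ ℤ` of
`2^{Jn/q} ‖(2^{js} φ_j ∗ f)_{j ≥ max(J,0)}‖_{L^q(B(x, 2^{-J}); ℓ^q)}`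
(with `n/q = 0` if `q = ∞`, in agreement with division by `(∞ : ℝ≥0∞).toReal = 0`). -/
def triebelLizorkinNorm (φ : ℕ → 𝓢(EuclideanSpace ℝ (Fin n), ℂ)) (s : ℝ) (p q : ℝ≥0∞)
    (f : 𝓢'(EuclideanSpace ℝ (Fin n), ℂ)) : ℝ≥0∞ :=
  if p = ∞ then
    ⨆ (x : EuclideanSpace ℝ (Fin n)) (J : ℤ),
      (2 : ℝ≥0∞) ^ ((J : ℝ) * ((n : ℝ) / q.toReal)) *
        eLpNorm
          (fun z => eLpNorm (fun j : ℕ => if J ≤ (j : ℤ) then piece φ s f j z else 0) q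
            Measure.count)
          q (volume.restrict (Metric.ball x ((2 : ℝ) ^ (-J))))
  else
    eLpNorm (fun x => eLpNorm (fun j : ℕ => piece φ s f j x) q Measure.count) p volume

/-- The Besov space `B^s_{pq}(ℝⁿ)`. -/
def besovSpace (φ : ℕ → 𝓢(EuclideanSpace ℝ (Fin n), ℂ)) (s : ℝ) (p q : ℝ≥0∞) :
    Set 𝓢'(EuclideanSpace ℝ (Fin n), ℂ) :=
  {f | besovNorm φ s p q f < ∞}

/-- The Triebel–Lizorkin space `F^s_{pq}(ℝⁿ)`. -/
def triebelLizorkinSpace (φ : ℕ → 𝓢(EuclideanSpace ℝ (Fin n), ℂ)) (s : ℝ) (p q : ℝ≥0∞) :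
    Set 𝓢'(EuclideanSpace ℝ (Fin n), ℂ) :=
  {f | triebelLizorkinNorm φ s p q f < ∞}

end LittlewoodPaley

end

/-! Moving to test functions, `T f` paired with `g` is the sum over `j ≥ 1` of `f` evaluated at
`dualTest (φ j) (y j) g`, whose Fourier transform is `φ̂ⱼ(-ξ) e^{2πi yⱼ·ξ} ĝ(ξ)`.

(i) Without the translation these functions live at frequencies of size `2ʲ`, where `ĝ` is rapidly
small, so every seminorm is `O(2^{-jM})` for every `M`. Translating costs `(1 + ‖yⱼ‖)^k`, which
exponential growth allows: the series converges in the Schwartz space and `T` is a transpose.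
Conversely, let `f` be the sum of the functionals `g ↦ ∂ₑĝ(-2ʲ e)`. If `T f` exists,
Banach–Steinhaus bounds the terms of its series by one finite sum of seminorms. Testing on a bump
moved to `-2ᴶ e` isolates the derivative of the phase, of modulus `2π |y_J · e|`, while the
seminorms grow only like a power of `2ᴶ`.

(ii) Since `φ̂ₖ φ̂ⱼ = 0` for `|k - j| ≥ 2`, each piece of `T f` is a sum of at most three translates
of `φₖ ∗ φⱼ ∗ f`. The `Lᵖ` norm ignores translations, even different ones at different `j`. What
remains is that convolution with `φₖ` is bounded on band-limited functions uniformly in `k`,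
including `p < 1`. This comes from sampling (`hasSum_sampling`): expanding a multiplier in a Fourier
series on a cube turns it into a discrete sum of translates with rapidly decaying coefficients, to
which the quasi-triangle inequality (`eLpNorm_le_quasiConst_mul`) applies. Sampling also yields
Nikolskii's inequality and the convergence of the series without growth of `y`: the pieces of `f`
are bounded by a power of `2ʲ` in the supremum norm, which is translation invariant too
(`mem_domain_of_growth`).

(iii) The `F` norm takes `ℓ^q` before `Lᵖ`, so it sees where the pieces sit. Lacunary series `∑ bₖ
2^{-ks} e^{2πi 2ᵏ e·x} ψ(x - zₖ)`, up to unimodular factors, have pieces of modulus `bₖ |ψ(x -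
zₖ)|`, and `T` moves `zₖ` to `zₖ + yₖ` (`exists_lacunary`). With one common centre the norm behaves
like `‖b‖_{ℓ^q}`; with separated centres and `p < ∞` it behaves like `‖b‖_{ℓᵖ}`. For `p < q` one
starts from a common centre and lets `T` spread the pieces; for `p > q` one starts from the centres
`-yₖ` and lets `T` collect them. -/

noncomputable section

namespace LittlewoodPaley

/-! ### Schwartz space: translation bounds, summability, completeness, Banach–Steinhaus. -/

section SchwartzGeneral

variable {E : Type*} [NormedAddCommGroup E] [NormedSpace ℝ E]

theorem one_add_pow_le (t : ℝ) (ht : 0 ≤ t) (k : ℕ) : (1 + t) ^ k ≤ 2 ^ k * (1 + t ^ k) := by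
  rcases le_total t 1 with h | h
  · calc (1 + t) ^ k ≤ 2 ^ k := by gcongr; linarith
      _ ≤ 2 ^ k * (1 + t ^ k) := le_mul_of_one_le_right (by positivity) (by
          have : 0 ≤ t ^ k := by positivity
          linarith)
  · calc (1 + t) ^ k ≤ (2 * t) ^ k := by gcongr; linarith
      _ = 2 ^ k * t ^ k := mul_pow _ _ _
      _ ≤ 2 ^ k * (1 + t ^ k) := by gcongr; linarith

theorem one_add_norm_pow_mul_le (u : 𝓢(E, ℂ)) (k l : ℕ) (x : E) :
    (1 + ‖x‖) ^ k * ‖iteratedFDeriv ℝ l u x‖ ≤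
      2 ^ k * (SchwartzMap.seminorm ℂ 0 l u + SchwartzMap.seminorm ℂ k l u) := by
  calc (1 + ‖x‖) ^ k * ‖iteratedFDeriv ℝ l u x‖
      ≤ 2 ^ k * (1 + ‖x‖ ^ k) * ‖iteratedFDeriv ℝ l u x‖ := by
        gcongr; exact one_add_pow_le _ (norm_nonneg _) _
    _ = 2 ^ k * (‖x‖ ^ 0 * ‖iteratedFDeriv ℝ l u x‖ + ‖x‖ ^ k * ‖iteratedFDeriv ℝ l u x‖) := by
        ring
    _ ≤ _ := by
        gcongr
        · exact SchwartzMap.le_seminorm ℂ 0 l u x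
        · exact SchwartzMap.le_seminorm ℂ k l u x

theorem seminorm_translate_le (u : 𝓢(E, ℂ)) (k l : ℕ) (a : E) :
    SchwartzMap.seminorm ℂ k l (SchwartzMap.compSubConstCLM ℂ a u) ≤
      (1 + ‖a‖) ^ k * (2 ^ k * (SchwartzMap.seminorm ℂ 0 l u + SchwartzMap.seminorm ℂ k l u)) := by
  refine SchwartzMap.seminorm_le_bound ℂ k l _ (by positivity) fun x => ?_
  have h1 : iteratedFDeriv ℝ l (SchwartzMap.compSubConstCLM ℂ a u) x =
      iteratedFDeriv ℝ l u (x - a) := iteratedFDeriv_comp_sub l a x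
  rw [h1]
  have h2 : ‖x‖ ≤ (1 + ‖a‖) * (1 + ‖x - a‖) := by
    have := norm_add_le (x - a) a
    rw [sub_add_cancel] at this
    nlinarith [norm_nonneg a, norm_nonneg (x - a)]
  calc ‖x‖ ^ k * ‖iteratedFDeriv ℝ l u (x - a)‖
      ≤ ((1 + ‖a‖) * (1 + ‖x - a‖)) ^ k * ‖iteratedFDeriv ℝ l u (x - a)‖ := by gcongr
    _ = (1 + ‖a‖) ^ k * ((1 + ‖x - a‖) ^ k * ‖iteratedFDeriv ℝ l u (x - a)‖) := by
        rw [mul_pow, mul_assoc]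
    _ ≤ _ := mul_le_mul_of_nonneg_left (one_add_norm_pow_mul_le u k l _) (by positivity)

theorem norm_le_seminorm_div (u : 𝓢(E, ℂ)) (k : ℕ) (x : E) :
    ‖u x‖ ≤ 2 ^ k * (SchwartzMap.seminorm ℂ 0 0 u + SchwartzMap.seminorm ℂ k 0 u) /
      (1 + ‖x‖) ^ k := by
  rw [le_div_iff₀ (by positivity), mul_comm]
  simpa using one_add_norm_pow_mul_le u k 0 x

theorem finset_sup_seminorm_le_sum {V : Type*} [AddCommGroup V] [Module ℂ V] {ι : Type*}
    (p : SeminormFamily ℂ V ι) (s : Finset ι) (x : V) : s.sup p x ≤ ∑ i ∈ s, p i x := by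
  classical
  rcases s.eq_empty_or_nonempty with rfl | hs
  · simp
  · refine Seminorm.finset_sup_apply_le (Finset.sum_nonneg fun i _ => apply_nonneg _ _) fun i hi => ?_
    exact Finset.single_le_sum (f := fun i => p i x) (fun i _ => apply_nonneg _ _) hi

theorem exists_seminorm_bound_sum (A : 𝓢(E, ℂ) →L[ℂ] 𝓢(E, ℂ)) (k l : ℕ) :
    ∃ (s : Finset (ℕ × ℕ)) (C : ℝ≥0), ∀ u, SchwartzMap.seminorm ℂ k l (A u) ≤
      C * ∑ i ∈ s, SchwartzMap.seminorm ℂ i.1 i.2 u := by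
  obtain ⟨s, C, -, h⟩ := Seminorm.bound_of_continuous (schwartz_withSeminorms ℂ E ℂ)
    ((schwartzSeminormFamily ℂ E ℂ (k, l)).comp A.toLinearMap)
    (((schwartz_withSeminorms ℂ E ℂ).continuous_seminorm (k, l)).comp A.continuous)
  refine ⟨s, C, fun u => (h u).trans ?_⟩
  exact mul_le_mul_of_nonneg_left (finset_sup_seminorm_le_sum _ s u) C.2

/-- Continuous linear maps preserve weighted uniform bounds on all Schwartz seminorms. -/
theorem seminorm_family_bound_map {ι : Type*} (A : 𝓢(E, ℂ) →L[ℂ] 𝓢(E, ℂ)) (u : ι → 𝓢(E, ℂ))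
    (w : ι → ℝ)
    (h : ∀ k l, ∃ C, 0 ≤ C ∧ ∀ i, SchwartzMap.seminorm ℂ k l (u i) ≤ C * w i) (k l : ℕ) :
    ∃ C, 0 ≤ C ∧ ∀ i, SchwartzMap.seminorm ℂ k l (A (u i)) ≤ C * w i := by
  obtain ⟨s, C, hC⟩ := exists_seminorm_bound_sum A k l
  choose D hD0 hD using h
  refine ⟨C * ∑ i ∈ s, D i.1 i.2, mul_nonneg C.2 (Finset.sum_nonneg fun i _ => hD0 _ _),
    fun j => (hC _).trans ?_⟩
  rw [mul_assoc, Finset.sum_mul]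
  gcongr
  exact hD _ _ _

/-- A family of Schwartz functions whose seminorms are all summable is summable. -/
theorem exists_hasSum_schwartz {ι : Type*} (u : ι → 𝓢(E, ℂ))
    (h : ∀ k l, Summable fun i => SchwartzMap.seminorm ℂ k l (u i)) :
    ∃ g : 𝓢(E, ℂ), HasSum u g := by
  have hder : ∀ (l : ℕ) (i : ι) (x : E), ‖iteratedFDeriv ℝ l (u i) x‖ ≤
      SchwartzMap.seminorm ℂ 0 l (u i) := fun l i x =>
    SchwartzMap.norm_iteratedFDeriv_le_seminorm ℂ (u i) l x
  have key : ∀ (s : Set ι) (l : ℕ) (x : E),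
      iteratedFDeriv ℝ l (fun y => ∑' i : s, u i y) x = ∑' i : s, iteratedFDeriv ℝ l (u i) x :=
    fun s l x => iteratedFDeriv_tsum_apply (f := fun (i : s) (y : E) => u i y) (N := ⊤)
      (v := fun l i => SchwartzMap.seminorm ℂ 0 l (u i))
      (fun i => (u i).smooth ⊤) (fun l _ => (h 0 l).subtype s) (fun l i x _ => hder l i x)
      (by simp) x
  have smth : ∀ s : Set ι, ContDiff ℝ ((⊤ : ℕ∞) : WithTop ℕ∞) (fun y => ∑' i : s, u i y) :=
    fun s => contDiff_tsum (f := fun (i : s) (y : E) => u i y) (N := ⊤)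
      (v := fun l i => SchwartzMap.seminorm ℂ 0 l (u i))
      (fun i => (u i).smooth ⊤) (fun l _ => (h 0 l).subtype s) (fun l i x _ => hder l i x)
  have bd : ∀ (s : Set ι) (k l : ℕ) (x : E),
      ‖x‖ ^ k * ‖iteratedFDeriv ℝ l (fun y => ∑' i : s, u i y) x‖ ≤
        ∑' i : s, SchwartzMap.seminorm ℂ k l (u i) := by
    intro s k l x
    have hs : Summable fun i : s => ‖iteratedFDeriv ℝ l (u i) x‖ :=
      Summable.of_nonneg_of_le (fun _ => norm_nonneg _) (fun i => hder l i x) ((h 0 l).subtype s)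
    rw [key]
    calc ‖x‖ ^ k * ‖∑' i : s, iteratedFDeriv ℝ l (u i) x‖
        ≤ ‖x‖ ^ k * ∑' i : s, ‖iteratedFDeriv ℝ l (u i) x‖ := by
          gcongr; exact norm_tsum_le_tsum_norm hs
      _ = ∑' i : s, ‖x‖ ^ k * ‖iteratedFDeriv ℝ l (u i) x‖ := tsum_mul_left.symm
      _ ≤ _ := (hs.mul_left _).tsum_le_tsum
          (fun i => SchwartzMap.le_seminorm ℂ k l (u i) x) ((h k l).subtype s)
  -- Summing over every subset at once makes the tail of a finite partial sum a Schwartz function as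
  -- well, with seminorms bounded by the tail of the seminorm series.
  let G : Set ι → 𝓢(E, ℂ) := fun s =>
    { toFun := fun y => ∑' i : s, u i y
      smooth' := smth s
      decay' := fun k l => ⟨_, bd s k l⟩ }
  have hG : ∀ s y, G s y = ∑' i : s, u i y := fun s y => rfl
  have hptw : ∀ y, Summable fun i => u i y := fun y =>
    Summable.of_norm_bounded (h 0 0) fun i => SchwartzMap.norm_le_seminorm ℂ (u i) y
  refine ⟨G univ, ?_⟩
  rw [HasSum, (schwartz_withSeminorms ℂ E ℂ).tendsto_nhds]
  rintro ⟨k, l⟩ ε hε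
  have ht := tendsto_tsum_compl_atTop_zero fun i => SchwartzMap.seminorm ℂ k l (u i)
  filter_upwards [ht (Iio_mem_nhds hε)] with t ht'
  have e : (∑ i ∈ t, u i) - G univ = -G {i | i ∉ t} := by
    ext y
    have h1 := (hptw y).sum_add_tsum_subtype_compl t
    simp only [sub_apply, neg_apply, sum_apply, hG]
    rw [tsum_univ (fun i => u i y), ← h1]
    ring_nf
    rfl
  rw [e, map_neg_eq_map]
  refine lt_of_le_of_lt ?_ ht'
  exact SchwartzMap.seminorm_le_bound ℂ k l _ (tsum_nonneg fun i => apply_nonneg _ _)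
    fun x => bd _ k l x

/-- A sequence whose consecutive differences have their `(k, l)` seminorm below `2^{-m}` once `m ≥
k, l` telescopes into a series summable in all seminorms. Completeness is wanted for barrelledness,
hence for Banach–Steinhaus. -/
instance completeSpace_schwartz : CompleteSpace 𝓢(E, ℂ) := by
  have W := schwartz_withSeminorms ℂ E ℂ
  have : (uniformity 𝓢(E, ℂ)).IsCountablyGenerated :=
    IsUniformAddGroup.uniformity_countably_generated
  let V : ℕ → Set 𝓢(E, ℂ) := fun N =>
    ⋂ i ∈ Finset.range (N + 1) ×ˢ Finset.range (N + 1),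
      {g | SchwartzMap.seminorm ℂ i.1 i.2 g < (1 / 2) ^ N}
  refine UniformSpace.complete_of_convergent_controlled_sequences
    (fun N => {p : 𝓢(E, ℂ) × 𝓢(E, ℂ) | p.2 - p.1 ∈ V N}) (fun N => ?_) fun u hu => ?_
  · rw [uniformity_eq_comap_nhds_zero]
    refine preimage_mem_comap ((Filter.biInter_finset_mem _).2 fun i _ => ?_)
    have hc := W.continuous_seminorm i
    refine (isOpen_lt hc continuous_const).mem_nhds ?_
    simp
  · have hs : ∀ k l, Summable fun m => SchwartzMap.seminorm ℂ k l (u (m + 1) - u m) := by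
      intro k l
      have hev : ∀ᶠ m in atTop, ‖SchwartzMap.seminorm ℂ k l (u (m + 1) - u m)‖ ≤ (1 / 2 : ℝ) ^ m := by
        filter_upwards [eventually_ge_atTop (max k l)] with m hm
        have := hu m m (m + 1) le_rfl (Nat.le_succ m)
        simp only [V, mem_ofPred_eq, mem_iInter, Finset.mem_product, Finset.mem_range] at this
        rw [Real.norm_of_nonneg (apply_nonneg _ _)]
        exact (this (k, l) ⟨by have := le_max_left k l; dsimp; omega,
          by have := le_max_right k l; dsimp; omega⟩).le
      exact Summable.of_norm_bounded_eventually_nat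
        (summable_geometric_of_lt_one (by norm_num) (by norm_num)) hev
    obtain ⟨g, hg⟩ := exists_hasSum_schwartz _ hs
    refine ⟨g + u 0, ?_⟩
    have := (hg.tendsto_sum_nat).add_const (u 0)
    refine this.congr fun m => ?_
    rw [Finset.sum_range_sub, sub_add_cancel]

instance barrelledSpace_schwartz : BarrelledSpace ℂ 𝓢(E, ℂ) := by
  have : (uniformity 𝓢(E, ℂ)).IsCountablyGenerated :=
    IsUniformAddGroup.uniformity_countably_generated
  infer_instance

/-- A pointwise convergent sequence of tempered distributions converges to a tempered
distribution. -/
theorem exists_tempered_limit (f : ℕ → 𝓢'(E, ℂ)) (L : 𝓢(E, ℂ) → ℂ)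
    (h : ∀ g, Tendsto (fun N => f N g) atTop (𝓝 (L g))) :
    ∃ u : 𝓢'(E, ℂ), (∀ g, u g = L g) ∧ Tendsto f atTop (𝓝 u) := by
  let F : ℕ → (𝓢(E, ℂ) →L[ℂ] ℂ) := fun N => ⟨(f N).toLinearMap, map_continuous (f N)⟩
  let U : 𝓢(E, ℂ) →L[ℂ] ℂ := continuousLinearMapOfTendsto F (f := L) (tendsto_pi_nhds.2 h)
  refine ⟨U.toPointwiseConvergenceCLM ℂ (RingHom.id ℂ) _ _, fun g => rfl, ?_⟩
  rw [PointwiseConvergenceCLM.tendsto_iff_forall_tendsto]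
  exact h

/-- Uniform boundedness for tempered distributions. -/
theorem tempered_uniform_bound {ι : Type*} (f : ι → 𝓢'(E, ℂ))
    (h : ∀ g, ∃ C, ∀ i, ‖f i g‖ ≤ C) :
    ∃ (s : Finset (ℕ × ℕ)) (C : ℝ≥0), ∀ i g, ‖f i g‖ ≤
      C * ∑ m ∈ s, SchwartzMap.seminorm ℂ m.1 m.2 g := by
  let F : ι → (𝓢(E, ℂ) →L[ℂ] ℂ) := fun N => ⟨(f N).toLinearMap, map_continuous (f N)⟩
  have hq := norm_withSeminorms ℂ ℂ
  have hequi : UniformEquicontinuous ((↑) ∘ F) := hq.banach_steinhaus (fun _ g => by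
    obtain ⟨C, hC⟩ := h g
    refine ⟨C, ?_⟩
    rintro _ ⟨i, rfl⟩
    exact hC i)
  obtain ⟨p, hp, hle⟩ := (hq.uniformEquicontinuous_iff_exists_continuous_seminorm
    (fun i => (F i).toLinearMap)).1 hequi 0
  obtain ⟨s, C, -, hC⟩ := Seminorm.bound_of_continuous (schwartz_withSeminorms ℂ E ℂ) p hp
  refine ⟨s, C, fun i g => (hle i g).trans ((hC g).trans ?_)⟩
  exact mul_le_mul_of_nonneg_left (finset_sup_seminorm_le_sum _ s g) C.2

theorem iteratedFDeriv_schwartz_sub_le (u : 𝓢(E, ℂ)) (l : ℕ) {M : ℝ} {x a b : E}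
    (hM : ∀ c ∈ segment ℝ a b, ‖iteratedFDeriv ℝ (l + 1) u (x - c)‖ ≤ M) :
    ‖iteratedFDeriv ℝ l u (x - b) - iteratedFDeriv ℝ l u (x - a)‖ ≤ M * ‖b - a‖ := by
  have hd : Differentiable ℝ (iteratedFDeriv ℝ l u) :=
    (u.smooth ⊤).differentiable_iteratedFDeriv (by exact_mod_cast WithTop.coe_lt_top _)
  have := (convex_segment (𝕜 := ℝ) (x - a) (x - b)).norm_image_sub_le_of_norm_fderiv_le
    (f := iteratedFDeriv ℝ l u) (C := M) (fun y _ => hd y) (fun y hy => ?_)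
    (left_mem_segment ℝ _ _) (right_mem_segment ℝ _ _)
  · simpa [norm_sub_rev] using this
  · rw [norm_fderiv_iteratedFDeriv]
    have : x - y ∈ segment ℝ a b := by
      obtain ⟨s, t, hs, ht, hst, rfl⟩ := hy
      refine ⟨s, t, hs, ht, hst, ?_⟩
      rw [show x - (s • (x - a) + t • (x - b)) = (1 - (s + t)) • x + (s • a + t • b) by module,
        hst]
      simp
    simpa using hM _ this

/-- The mean value inequality between two translates, the weight `‖x‖ ^ k` being absorbed by a
seminorm of order `l + 1` of an intermediate translate. This is what makes `φ ∗ f` a continuous,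
hence measurable, function. -/
theorem continuous_translate (u : 𝓢(E, ℂ)) :
    Continuous fun x : E => SchwartzMap.compSubConstCLM ℂ x u := by
  rw [continuous_iff_continuousAt]
  intro a
  rw [ContinuousAt, (schwartz_withSeminorms ℂ E ℂ).tendsto_nhds]
  rintro ⟨k, l⟩ ε hε
  set B : ℝ := (2 + ‖a‖) ^ k * (2 ^ k * (SchwartzMap.seminorm ℂ 0 (l + 1) u +
    SchwartzMap.seminorm ℂ k (l + 1) u)) with hB
  have hB0 : 0 ≤ B := by positivity
  have key : ∀ b, ‖b - a‖ ≤ 1 → SchwartzMap.seminorm ℂ k l (SchwartzMap.compSubConstCLM ℂ b u -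
      SchwartzMap.compSubConstCLM ℂ a u) ≤ B * ‖b - a‖ := by
    intro b hb
    refine SchwartzMap.seminorm_le_bound ℂ k l _ (by positivity) fun x => ?_
    have h1 : iteratedFDeriv ℝ l (SchwartzMap.compSubConstCLM ℂ b u -
        SchwartzMap.compSubConstCLM ℂ a u : 𝓢(E, ℂ)) x =
        iteratedFDeriv ℝ l u (x - b) - iteratedFDeriv ℝ l u (x - a) := by
      have e : ⇑(SchwartzMap.compSubConstCLM ℂ b u - SchwartzMap.compSubConstCLM ℂ a u : 𝓢(E, ℂ))
        = (fun z => u (z - b)) - (fun z => u (z - a)) := rfl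
      have hs : ∀ c : E, ContDiffAt ℝ l (fun z => u (z - c)) x := fun c =>
        ((u.smooth l).comp (contDiff_id.sub contDiff_const)).contDiffAt
      rw [e, iteratedFDeriv_sub_apply (hs b) (hs a), iteratedFDeriv_comp_sub,
        iteratedFDeriv_comp_sub]
    rw [h1]
    rcases eq_or_ne (‖x‖ ^ k) 0 with h0 | h0
    · rw [h0, zero_mul]; positivity
    have hpos : 0 < ‖x‖ ^ k := lt_of_le_of_ne (by positivity) h0.symm
    have := iteratedFDeriv_schwartz_sub_le u l (M := B / ‖x‖ ^ k) (x := x) (a := a) (b := b)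
      fun c hc => ?_
    · calc _ ≤ ‖x‖ ^ k * (B / ‖x‖ ^ k * ‖b - a‖) := by gcongr
        _ = B * ‖b - a‖ := by field_simp
    · rw [le_div_iff₀ hpos, mul_comm]
      have hc' : ‖c‖ ≤ 1 + ‖a‖ := by
        have h2 : c ∈ Metric.closedBall a 1 :=
          (convex_closedBall a 1).segment_subset (by simp) (by simpa [dist_eq_norm] using hb) hc
        have h3 : ‖c - a‖ ≤ 1 := by simpa [dist_eq_norm] using h2
        have := norm_add_le (c - a) a
        rw [sub_add_cancel] at this
        linarith
      have h4 := SchwartzMap.le_seminorm ℂ k (l + 1) (SchwartzMap.compSubConstCLM ℂ c u) x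
      have h5 : iteratedFDeriv ℝ (l + 1) (SchwartzMap.compSubConstCLM ℂ c u) x =
        iteratedFDeriv ℝ (l + 1) u (x - c) := iteratedFDeriv_comp_sub (l + 1) c x
      rw [h5] at h4
      refine h4.trans ((seminorm_translate_le u k (l + 1) c).trans ?_)
      rw [hB]
      gcongr ?_ ^ k * _
      linarith
  have ht : Tendsto (fun b => B * ‖b - a‖) (𝓝 a) (𝓝 0) := by
    have : Continuous fun b => B * ‖b - a‖ := by fun_prop
    simpa using this.tendsto a
  have hn : ∀ᶠ b in 𝓝 a, ‖b - a‖ ≤ 1 := by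
    filter_upwards [Metric.closedBall_mem_nhds a one_pos] with b hb
    simpa [dist_eq_norm] using hb
  filter_upwards [ht (Iio_mem_nhds hε), hn] with b hb hb1
  exact (key b hb1).trans_lt hb

theorem seminorm_comp_smul_le (u v : 𝓢(E, ℂ)) {R : ℝ} (hR : 1 ≤ R) (h : ∀ x, v x = u (R • x))
    (k l : ℕ) : SchwartzMap.seminorm ℂ k l v ≤ R ^ l * SchwartzMap.seminorm ℂ k l u := by
  refine SchwartzMap.seminorm_le_bound ℂ k l _ (by positivity) fun x => ?_
  have e : ⇑v = fun z => u (R • z) := funext h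
  rw [e, iteratedFDeriv_comp_const_smul R (u.smooth l), norm_smul, norm_pow,
    Real.norm_of_nonneg (by linarith)]
  have h1 : ‖x‖ ≤ ‖R • x‖ := by
    rw [norm_smul, Real.norm_of_nonneg (by linarith)]
    exact le_mul_of_one_le_left (norm_nonneg _) hR
  calc ‖x‖ ^ k * (R ^ l * ‖iteratedFDeriv ℝ l u (R • x)‖)
      ≤ ‖R • x‖ ^ k * (R ^ l * ‖iteratedFDeriv ℝ l u (R • x)‖) := by gcongr
    _ = R ^ l * (‖R • x‖ ^ k * ‖iteratedFDeriv ℝ l u (R • x)‖) := by ring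
    _ ≤ _ := by gcongr; exact SchwartzMap.le_seminorm ℂ k l u _

end SchwartzGeneral

/-! ### Quasi-triangle inequalities for weighted sums in `Lᵖ`, `0 < p ≤ ∞`. -/

section QuasiTriangle

/-- Hölder with respect to the weights `w`, passed from finite sums to infinite ones through
suprema. -/
theorem tsum_mul_rpow_le {ι : Type*} {p : ℝ} (hp : 1 ≤ p) (w g : ι → ℝ≥0∞) :
    (∑' i, w i * g i) ^ p ≤ (∑' i, w i) ^ (p - 1) * ∑' i, w i * g i ^ p := by
  have hp0 : 0 < p := by linarith
  have h1 : ∑' i, w i * g i ≤ (∑' i, w i) ^ (1 - p⁻¹) * (∑' i, w i * g i ^ p) ^ p⁻¹ := by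
    rw [ENNReal.tsum_eq_iSup_sum (f := fun i => w i * g i)]
    refine iSup_le fun s => (ENNReal.inner_le_weight_mul_Lp_of_nonneg s hp w g).trans ?_
    gcongr
    · exact sub_nonneg.2 (inv_le_one_of_one_le₀ hp)
    · exact ENNReal.sum_le_tsum s
    · exact ENNReal.sum_le_tsum s
  calc (∑' i, w i * g i) ^ p
      ≤ ((∑' i, w i) ^ (1 - p⁻¹) * (∑' i, w i * g i ^ p) ^ p⁻¹) ^ p := by gcongr
    _ = _ := by
      rw [ENNReal.mul_rpow_of_nonneg _ _ hp0.le, ← ENNReal.rpow_mul, ← ENNReal.rpow_mul,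
        inv_mul_cancel₀ hp0.ne', ENNReal.rpow_one]
      congr 2
      field_simp

theorem tsum_rpow_le {ι : Type*} {p : ℝ} (hp : 0 < p) (hp1 : p ≤ 1) (g : ι → ℝ≥0∞) :
    (∑' i, g i) ^ p ≤ ∑' i, g i ^ p := by
  classical
  have hfin : ∀ s : Finset ι, (∑ i ∈ s, g i) ^ p ≤ ∑ i ∈ s, g i ^ p := by
    intro s
    induction s using Finset.induction_on with
    | empty => simp [hp]
    | insert a s ha ih =>
      rw [Finset.sum_insert ha, Finset.sum_insert ha]
      exact (ENNReal.rpow_add_le_add_rpow _ _ hp.le hp1).trans (by gcongr)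
  have h : ∑' i, g i ≤ (∑' i, g i ^ p) ^ p⁻¹ := by
    rw [ENNReal.tsum_eq_iSup_sum (f := g)]
    refine iSup_le fun s => ?_
    rw [ENNReal.le_rpow_inv_iff hp]
    exact (hfin s).trans (ENNReal.sum_le_tsum s)
  rwa [ENNReal.le_rpow_inv_iff hp] at h

/-- The constant in the quasi-triangle inequality of `Lᵖ` for weighted sums. -/
def quasiConst {ι : Type*} (p : ℝ≥0∞) (w : ι → ℝ≥0∞) : ℝ≥0∞ :=
  if 1 ≤ p then ∑' i, w i else (∑' i, w i ^ p.toReal) ^ p.toReal⁻¹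

/-- For `1 ≤ p < ∞` this is Hölder in the sum followed by Tonelli; for `p < 1` the subadditivity of
`t ↦ t ^ p` replaces Hölder; for `p = ∞` it is pointwise almost everywhere. It serves both for `Lᵖ`
on `ℝⁿ` and for `ℓ^q`. -/
theorem eLpNorm_le_quasiConst_mul {α ι : Type*} [MeasurableSpace α] {μ : Measure α} [Countable ι]
    {p : ℝ≥0∞} (hp : 0 < p) (w : ι → ℝ≥0∞) {F : α → ℝ≥0∞} {G : ι → α → ℝ≥0∞}
    (hG : ∀ i, AEMeasurable (G i) μ) (hF : ∀ x, F x ≤ ∑' i, w i * G i x) {A : ℝ≥0∞}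
    (hA : ∀ i, eLpNorm (G i) p μ ≤ A) : eLpNorm F p μ ≤ quasiConst p w * A := by
  rcases eq_or_ne p ∞ with rfl | hpt
  · rw [quasiConst, if_pos le_top]
    have hae : ∀ᵐ x ∂μ, ∀ i, G i x ≤ A := by
      rw [ae_all_iff]
      intro i
      have h1 := ae_le_eLpNormEssSup (f := G i) (μ := μ)
      filter_upwards [h1] with x hx
      have := hA i
      rw [eLpNorm_exponent_top] at this
      exact hx.trans this
    rw [eLpNorm_exponent_top]
    refine eLpNormEssSup_le_of_ae_enorm_bound ?_
    filter_upwards [hae] with x hx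
    rw [enorm_eq_self, ← ENNReal.tsum_mul_right]
    exact (hF x).trans (ENNReal.tsum_le_tsum fun i => by gcongr; exact hx i)
  · have hp0 : 0 < p.toReal := ENNReal.toReal_pos hp.ne' hpt
    have hA' : ∀ i, ∫⁻ x, G i x ^ p.toReal ∂μ ≤ A ^ p.toReal := by
      intro i
      have := hA i
      rw [eLpNorm_eq_lintegral_rpow_enorm_toReal hp.ne' hpt, one_div, ENNReal.rpow_inv_le_iff hp0]
        at this
      simpa using this
    rw [eLpNorm_eq_lintegral_rpow_enorm_toReal hp.ne' hpt, one_div, ENNReal.rpow_inv_le_iff hp0,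
      ENNReal.mul_rpow_of_nonneg _ _ hp0.le]
    simp only [enorm_eq_self]
    have hmeas : ∀ i (c : ℝ≥0∞), AEMeasurable (fun x => c * G i x ^ p.toReal) μ := fun i c =>
      ((hG i).pow_const _).const_mul _
    by_cases h1 : 1 ≤ p
    · have h1' : 1 ≤ p.toReal := by
        rw [← ENNReal.toReal_one]; exact ENNReal.toReal_mono hpt h1
      rw [quasiConst, if_pos h1]
      calc ∫⁻ x, F x ^ p.toReal ∂μ
          ≤ ∫⁻ x, (∑' i, w i) ^ (p.toReal - 1) * ∑' i, w i * G i x ^ p.toReal ∂μ := by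
            refine lintegral_mono fun x => ?_
            calc F x ^ p.toReal ≤ (∑' i, w i * G i x) ^ p.toReal := by gcongr; exact hF x
              _ ≤ _ := tsum_mul_rpow_le h1' _ _
        _ = (∑' i, w i) ^ (p.toReal - 1) * ∑' i, ∫⁻ x, w i * G i x ^ p.toReal ∂μ := by
            rw [lintegral_const_mul'' _ (AEMeasurable.tsum fun i => hmeas i _),
              lintegral_tsum fun i => hmeas i _]
        _ ≤ (∑' i, w i) ^ (p.toReal - 1) * ∑' i, w i * A ^ p.toReal := by
            gcongr with i
            rw [lintegral_const_mul'' _ ((hG i).pow_const _)]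
            gcongr
            exact hA' i
        _ ≤ (∑' i, w i) ^ p.toReal * A ^ p.toReal := by
            rw [ENNReal.tsum_mul_right, ← mul_assoc]
            gcongr
            nth_rewrite 2 [← ENNReal.rpow_one (∑' i, w i)]
            rw [← ENNReal.rpow_add_of_nonneg _ _ (by linarith) zero_le_one]
            simp
    · have h1' : p.toReal ≤ 1 := by
        rw [← ENNReal.toReal_one]
        exact ENNReal.toReal_mono ENNReal.one_ne_top (not_le.1 h1).le
      rw [quasiConst, if_neg h1, ENNReal.rpow_inv_rpow hp0.ne']
      calc ∫⁻ x, F x ^ p.toReal ∂μ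
          ≤ ∫⁻ x, ∑' i, w i ^ p.toReal * G i x ^ p.toReal ∂μ := by
            refine lintegral_mono fun x => ?_
            calc F x ^ p.toReal ≤ (∑' i, w i * G i x) ^ p.toReal := by gcongr; exact hF x
              _ ≤ ∑' i, (w i * G i x) ^ p.toReal := tsum_rpow_le hp0 h1' _
              _ = _ := by simp_rw [ENNReal.mul_rpow_of_nonneg _ _ hp0.le]
        _ = ∑' i, ∫⁻ x, w i ^ p.toReal * G i x ^ p.toReal ∂μ := lintegral_tsum fun i => hmeas i _
        _ ≤ ∑' i, w i ^ p.toReal * A ^ p.toReal := by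
            gcongr with i
            rw [lintegral_const_mul'' _ ((hG i).pow_const _)]
            gcongr
            exact hA' i
        _ = _ := ENNReal.tsum_mul_right

end QuasiTriangle

/-! ### Sums over separated sets and over the integer lattice. -/

section Packing

variable {n : ℕ}

/-- Sums of a decaying function over a separated set are bounded uniformly under translation. -/
theorem exists_packing_bound {ι : Type*} [Countable ι] (z : ι → EuclideanSpace ℝ (Fin n)) {δ : ℝ}
    (hδ : 0 < δ) (hz : ∀ i j, i ≠ j → δ ≤ ‖z i - z j‖) {r : ℝ} (hr : (n : ℝ) < r) :
    ∃ C : ℝ≥0, ∀ x, ∑' i, ENNReal.ofReal ((1 + ‖x - z i‖) ^ (-r)) ≤ C := by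
  have hr0 : 0 ≤ r := (Nat.cast_nonneg n).trans hr.le
  -- With `ρ ≤ δ / 2` the balls around the points are disjoint, and with `ρ ≤ 1` the weight changes
  -- by a factor of at most `2 ^ r` on each. The sum is thus dominated by `2 ^ r * I / V`.
  set ρ : ℝ := min (δ / 2) 1 with hρ
  have hρ0 : 0 < ρ := lt_min (by linarith) one_pos
  set I : ℝ≥0∞ := ∫⁻ v : EuclideanSpace ℝ (Fin n), ENNReal.ofReal ((1 + ‖v‖) ^ (-r)) with hI
  have hIfin : I < ∞ := finite_integral_one_add_norm (by simpa using hr)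
  set V : ℝ≥0∞ := volume (Metric.ball (0 : EuclideanSpace ℝ (Fin n)) ρ) with hV
  have hV0 : V ≠ 0 := (Metric.measure_ball_pos _ _ hρ0).ne'
  have hVt : V ≠ ∞ := measure_ball_lt_top.ne
  have hfin : ENNReal.ofReal (2 ^ r) * I / V ≠ ∞ :=
    ENNReal.div_ne_top (ENNReal.mul_ne_top ENNReal.ofReal_ne_top hIfin.ne) hV0
  refine ⟨(ENNReal.ofReal (2 ^ r) * I / V).toNNReal, fun x => ?_⟩
  rw [ENNReal.coe_toNNReal hfin, ENNReal.le_div_iff_mul_le (Or.inl hV0) (Or.inl hVt),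
    ← ENNReal.tsum_mul_right]
  have hball : ∀ i, ENNReal.ofReal ((1 + ‖x - z i‖) ^ (-r)) * V ≤
      ∫⁻ v in Metric.ball (z i) ρ, ENNReal.ofReal (2 ^ r) *
        ENNReal.ofReal ((1 + ‖x - v‖) ^ (-r)) := by
    intro i
    have hVi : V = volume (Metric.ball (z i) ρ) := by rw [hV]; exact (Measure.addHaar_ball_center _ _ _).symm
    rw [hVi, ← setLIntegral_const]
    refine setLIntegral_mono' measurableSet_ball fun v hv => ?_
    rw [← ENNReal.ofReal_mul (by positivity)]
    apply ENNReal.ofReal_le_ofReal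
    have h1 : ‖v - z i‖ ≤ 1 := by
      rw [← dist_eq_norm]; exact (Metric.mem_ball.1 hv).le.trans (min_le_right _ _)
    have h2 : 1 + ‖x - v‖ ≤ 2 * (1 + ‖x - z i‖) := by
      have h3 : ‖x - v‖ ≤ ‖x - z i‖ + ‖v - z i‖ := by
        have := norm_sub_le (x - z i) (v - z i)
        rwa [sub_sub_sub_cancel_right] at this
      have := norm_nonneg (x - z i)
      linarith
    calc (1 + ‖x - z i‖) ^ (-r) = 2 ^ r * (2 * (1 + ‖x - z i‖)) ^ (-r) := by
          rw [Real.mul_rpow (by norm_num) (by positivity), ← mul_assoc, ← Real.rpow_add two_pos]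
          simp
      _ ≤ 2 ^ r * (1 + ‖x - v‖) ^ (-r) := by
          gcongr 2 ^ r * ?_
          exact Real.rpow_le_rpow_of_nonpos (by positivity) h2 (by linarith)
  have hdisj : Pairwise (Function.onFun Disjoint fun i => Metric.ball (z i) ρ) := by
    intro i j hij
    refine Metric.ball_disjoint_ball ?_
    rw [dist_eq_norm]
    have := hz i j hij
    have := min_le_left (δ / 2) 1
    linarith
  calc ∑' i, ENNReal.ofReal ((1 + ‖x - z i‖) ^ (-r)) * V
      ≤ ∑' i, ∫⁻ v in Metric.ball (z i) ρ, ENNReal.ofReal (2 ^ r) *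
        ENNReal.ofReal ((1 + ‖x - v‖) ^ (-r)) := ENNReal.tsum_le_tsum hball
    _ = ∫⁻ v in ⋃ i, Metric.ball (z i) ρ, ENNReal.ofReal (2 ^ r) *
        ENNReal.ofReal ((1 + ‖x - v‖) ^ (-r)) :=
        (lintegral_iUnion (fun i => measurableSet_ball) hdisj _).symm
    _ ≤ ∫⁻ v, ENNReal.ofReal (2 ^ r) * ENNReal.ofReal ((1 + ‖x - v‖) ^ (-r)) :=
        setLIntegral_le_lintegral _ _
    _ = ENNReal.ofReal (2 ^ r) * I := by
        rw [lintegral_const_mul _ (by fun_prop)]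
        congr 1
        exact lintegral_sub_left_eq_self
          (fun v : EuclideanSpace ℝ (Fin n) => ENNReal.ofReal ((1 + ‖v‖) ^ (-r))) x

theorem exists_packing_bound_rpow {ι : Type*} [Countable ι] (z : ι → EuclideanSpace ℝ (Fin n))
    {δ : ℝ} (hδ : 0 < δ) (hz : ∀ i j, i ≠ j → δ ≤ ‖z i - z j‖) {p : ℝ} (hp : 0 < p) {k : ℕ}
    (hk : (n : ℝ) < k * p) :
    ∃ C : ℝ≥0, ∀ (A : ℝ≥0) x,
      ∑' i, ENNReal.ofReal (A / (1 + ‖x - z i‖) ^ k) ^ p ≤ (A : ℝ≥0∞) ^ p * C := by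
  obtain ⟨C, hC⟩ := exists_packing_bound z hδ hz hk
  refine ⟨C, fun A x => ?_⟩
  have e : ∀ i, ENNReal.ofReal (A / (1 + ‖x - z i‖) ^ k) ^ p =
      (A : ℝ≥0∞) ^ p * ENNReal.ofReal ((1 + ‖x - z i‖) ^ (-(k * p))) := by
    intro i
    rw [div_eq_mul_inv, ENNReal.ofReal_mul (NNReal.coe_nonneg A), ENNReal.mul_rpow_of_nonneg _ _ hp.le,
      ENNReal.ofReal_coe_nnreal, ENNReal.ofReal_rpow_of_nonneg (by positivity) hp.le,
      Real.rpow_neg (by positivity), Real.rpow_mul (by positivity), Real.rpow_natCast,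
      Real.inv_rpow (by positivity)]
  simp_rw [e, ENNReal.tsum_mul_left]
  gcongr
  exact hC x

theorem exists_packing_bound_schwartz {ι : Type*} [Countable ι]
    (z : ι → EuclideanSpace ℝ (Fin n)) {δ : ℝ} (hδ : 0 < δ)
    (hz : ∀ i j, i ≠ j → δ ≤ ‖z i - z j‖) {p : ℝ} (hp : 0 < p)
    (u : 𝓢(EuclideanSpace ℝ (Fin n), ℂ)) :
    ∃ C : ℝ≥0, ∀ x, ∑' i, ‖u (x - z i)‖ₑ ^ p ≤ C := by
  obtain ⟨k, hk⟩ := exists_nat_gt (n / p)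
  rw [div_lt_iff₀ hp] at hk
  obtain ⟨C, hC⟩ := exists_packing_bound_rpow z hδ hz hp hk
  let A : ℝ≥0 := ⟨2 ^ k * (SchwartzMap.seminorm ℂ 0 0 u + SchwartzMap.seminorm ℂ k 0 u),
    by positivity⟩
  refine ⟨A ^ p * C, fun x => ?_⟩
  rw [ENNReal.coe_mul, ENNReal.coe_rpow_of_nonneg _ hp.le]
  refine le_trans (ENNReal.tsum_le_tsum fun i => ?_) (hC A x)
  gcongr
  rw [← ofReal_norm]
  exact ENNReal.ofReal_le_ofReal (norm_le_seminorm_div u k _)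

/-- The point of `ℝⁿ` with given integer coordinates. -/
def latticePt (l : Fin n → ℤ) : EuclideanSpace ℝ (Fin n) := WithLp.toLp 2 fun i => (l i : ℝ)

theorem latticePt_separated (l m : Fin n → ℤ) (h : l ≠ m) :
    (1 : ℝ) ≤ ‖latticePt l - latticePt m‖ := by
  obtain ⟨i, hi⟩ := Function.ne_iff.1 h
  have h1 : (1 : ℝ) ≤ |((l i - m i : ℤ) : ℝ)| := by
    rw [← Int.cast_abs]
    exact_mod_cast Int.one_le_abs (sub_ne_zero.2 hi)
  refine h1.trans ?_
  have := PiLp.norm_apply_le (latticePt l - latticePt m) i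
  simpa [latticePt] using this

theorem exists_lattice_bound {p : ℝ} (hp : 0 < p) {k : ℕ} (hk : (n : ℝ) < k * p) :
    ∃ C : ℝ≥0, ∀ A : ℝ≥0,
      ∑' l : Fin n → ℤ, ENNReal.ofReal (A / (1 + ‖latticePt l‖) ^ k) ^ p ≤ (A : ℝ≥0∞) ^ p * C := by
  obtain ⟨C, hC⟩ := exists_packing_bound_rpow (latticePt (n := n)) one_pos latticePt_separated hp hk
  exact ⟨C, fun A => by simpa using hC A 0⟩

theorem summable_lattice {k : ℕ} (hk : n < k) :
    Summable fun l : Fin n → ℤ => 1 / (1 + ‖latticePt l‖) ^ k := by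
  obtain ⟨C, hC⟩ := exists_lattice_bound (n := n) (p := 1) one_pos (k := k) (by simpa using hk)
  have h1 := (hC 1).trans_lt (by simp : _ < ∞)
  simp only [ENNReal.rpow_one, NNReal.coe_one] at h1
  have := ENNReal.summable_toReal h1.ne
  refine this.congr fun l => ?_
  rw [ENNReal.toReal_ofReal (by positivity)]

/-- The decay needed depends on `p` and the dimension alone: `k = n + 1` if `p ≥ 1`, and any `k > n
/ p` if `p < 1`. Schwartz kernels supply every order of decay. -/
theorem quasiConst_lattice_lt_top {p : ℝ≥0∞} (hp : 0 < p) :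
    ∃ k : ℕ, ∀ A : ℝ≥0, quasiConst p
      (fun l : Fin n → ℤ => ENNReal.ofReal (A / (1 + ‖latticePt l‖) ^ k)) < ∞ := by
  by_cases h1 : 1 ≤ p
  · refine ⟨n + 1, fun A => ?_⟩
    obtain ⟨C, hC⟩ := exists_lattice_bound (n := n) (p := 1) one_pos (k := n + 1)
      (by push_cast; linarith)
    rw [quasiConst, if_pos h1]
    have := hC A
    simp only [ENNReal.rpow_one] at this
    exact this.trans_lt (by exact_mod_cast ENNReal.coe_lt_top (r := A * C))
  · have hp0 : 0 < p.toReal := ENNReal.toReal_pos hp.ne' (ne_top_of_lt (not_le.1 h1))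
    obtain ⟨k, hk⟩ := exists_nat_gt (n / p.toReal)
    rw [div_lt_iff₀ hp0] at hk
    obtain ⟨C, hC⟩ := exists_lattice_bound hp0 hk
    refine ⟨k, fun A => ?_⟩
    rw [quasiConst, if_neg h1]
    refine ENNReal.rpow_lt_top_of_nonneg (by positivity) ?_
    refine ((hC A).trans_lt ?_).ne
    exact ENNReal.mul_lt_top (ENNReal.rpow_lt_top_of_nonneg hp0.le ENNReal.coe_ne_top)
      ENNReal.coe_lt_top

end Packing

/-! ### Fourier series on the torus and the sampling formula. -/

section Sampling

variable {n : ℕ}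

theorem summable_norm_schwartz_lattice (K : 𝓢(EuclideanSpace ℝ (Fin n), ℂ)) (k : ℕ) :
    Summable fun l : Fin n → ℤ => (1 + ‖latticePt l‖) ^ k * ‖K (latticePt l)‖ := by
  set A : ℝ := 2 ^ (k + n + 1) * (SchwartzMap.seminorm ℂ 0 0 K +
    SchwartzMap.seminorm ℂ (k + n + 1) 0 K) with hA
  refine Summable.of_nonneg_of_le (fun l => by positivity) (fun l => ?_)
    ((summable_lattice (n := n) (Nat.lt_succ_self n)).mul_left A)
  have h := norm_le_seminorm_div K (k + n + 1) (latticePt l)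
  calc (1 + ‖latticePt l‖) ^ k * ‖K (latticePt l)‖
      ≤ (1 + ‖latticePt l‖) ^ k * (A / (1 + ‖latticePt l‖) ^ (k + n + 1)) := by gcongr
    _ = A * (1 / (1 + ‖latticePt l‖) ^ (n + 1)) := by
      have : (1 + ‖latticePt l‖) ≠ 0 := by positivity
      rw [add_assoc k n 1, pow_add _ k (n + 1)]
      field_simp

theorem mFourier_coe (l : Fin n → ℤ) (x : EuclideanSpace ℝ (Fin n)) :
    UnitAddTorus.mFourier l (fun i => (x i : UnitAddCircle)) =
      Complex.exp (((2 * Real.pi * inner ℝ x (latticePt l) : ℝ) : ℂ) * Complex.I) := by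
  simp only [UnitAddTorus.mFourier, ContinuousMap.coe_mk]
  simp_rw [fourier_coe_apply]
  rw [← Complex.exp_sum]
  congr 1
  simp only [PiLp.inner_apply, latticePt, Finset.mul_sum, Finset.sum_mul, Complex.ofReal_sum,
    Complex.ofReal_mul]
  refine Finset.sum_congr rfl fun i _ => ?_
  simp
  ring

/-- The periodisation on the torus of a function supported near the origin. -/
def torusLift (h : EuclideanSpace ℝ (Fin n) → ℂ) (t : UnitAddTorus (Fin n)) : ℂ :=
  h (WithLp.toLp 2 fun i => ((AddCircle.equivIco (1 : ℝ) (-(1 / 2)) (t i) : ℝ)))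

theorem norm_coe_le_abs (x : ℝ) : ‖(x : UnitAddCircle)‖ ≤ |x| := by
  rw [← Real.norm_eq_abs]
  exact QuotientAddGroup.norm_mk_le_norm

theorem norm_coe_half : ‖((1 / 2 : ℝ) : UnitAddCircle)‖ = 1 / 2 := by
  rw [UnitAddCircle.norm_eq]
  have : round (1 / 2 : ℝ) = 1 := by
    rw [round_eq]; norm_num
  rw [this]; norm_num

theorem torusLift_eq_zero {h : EuclideanSpace ℝ (Fin n) → ℂ} (hh : ∀ ξ, 1 / 4 ≤ ‖ξ‖ → h ξ = 0)
    (t : UnitAddTorus (Fin n)) (i : Fin n) (ht : 1 / 4 ≤ ‖t i‖) : torusLift h t = 0 := by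
  apply hh
  have h1 : ((AddCircle.equivIco (1 : ℝ) (-(1 / 2)) (t i) : ℝ) : UnitAddCircle) = t i :=
    (AddCircle.equivIco (1 : ℝ) (-(1 / 2))).symm_apply_apply (t i)
  have h2 := norm_coe_le_abs (AddCircle.equivIco (1 : ℝ) (-(1 / 2)) (t i) : ℝ)
  rw [h1] at h2
  have h3 := PiLp.norm_apply_le (WithLp.toLp 2 fun i =>
    ((AddCircle.equivIco (1 : ℝ) (-(1 / 2)) (t i) : ℝ)) : EuclideanSpace ℝ (Fin n)) i
  simp only [Real.norm_eq_abs] at h3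
  linarith

/-- The chart of the fundamental domain jumps only at the class of `1/2`, and the lift vanishes near
such points because `h` is supported within radius `1/4`. -/
theorem continuous_torusLift {h : EuclideanSpace ℝ (Fin n) → ℂ} (hc : Continuous h)
    (hh : ∀ ξ, 1 / 4 ≤ ‖ξ‖ → h ξ = 0) : Continuous (torusLift h) := by
  rw [continuous_iff_continuousAt]
  intro t
  by_cases H : ∃ i, 1 / 4 < ‖t i‖
  · obtain ⟨i, hi⟩ := H
    have hev : ∀ᶠ s in 𝓝 t, 1 / 4 < ‖s i‖ :=
      (isOpen_lt continuous_const (continuous_norm.comp (continuous_apply i))).mem_nhds hi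
    have : torusLift h =ᶠ[𝓝 t] fun _ => 0 := by
      filter_upwards [hev] with s hs
      exact torusLift_eq_zero hh s i hs.le
    exact continuousAt_const.congr this.symm
  · push Not at H
    refine hc.continuousAt.comp ?_
    refine (PiLp.continuous_toLp 2 _).continuousAt.comp ?_
    rw [continuousAt_pi]
    intro i
    have hne : t i ≠ ((-(1 / 2) : ℝ) : UnitAddCircle) := by
      intro he
      have h1 := H i
      have h2 := norm_coe_half
      rw [he, AddCircle.coe_neg, norm_neg, h2] at h1
      norm_num at h1
    have := (AddCircle.continuousAt_equivIco (1 : ℝ) (-(1 / 2)) hne)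
    exact ContinuousAt.comp (f := fun s : UnitAddTorus (Fin n) => s i)
      (continuous_subtype_val.continuousAt.comp this) (continuous_apply i).continuousAt

/-- The torus integral runs over `Ioc` while the chart takes values in `Ico`. The two disagree only
when some coordinate is `1/2`, where both sides are zero. -/
theorem torusLift_coe {h : EuclideanSpace ℝ (Fin n) → ℂ} (hh : ∀ ξ, 1 / 4 ≤ ‖ξ‖ → h ξ = 0)
    (x : EuclideanSpace ℝ (Fin n)) (hx : ∀ i, x i ∈ Ioc (-(1 / 2) : ℝ) (-(1 / 2) + 1)) :
    torusLift h (fun i => (x i : UnitAddCircle)) = h x := by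
  by_cases H : ∃ i, x i = 1 / 2
  · obtain ⟨i, hi⟩ := H
    rw [torusLift_eq_zero hh _ i (by rw [hi, norm_coe_half]; norm_num), hh]
    have := PiLp.norm_apply_le x i
    rw [hi, Real.norm_of_nonneg (by norm_num)] at this
    linarith
  · push Not at H
    unfold torusLift
    congr 1
    ext i
    have : x i ∈ Ico (-(1 / 2) : ℝ) (-(1 / 2) + 1) := by
      refine ⟨(hx i).1.le, lt_of_le_of_ne (hx i).2 ?_⟩
      have := H i
      norm_num at this ⊢
      exact this
    have h2 := (AddCircle.equivIco (1 : ℝ) (-(1 / 2))).apply_symm_apply ⟨x i, this⟩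
    exact congrArg Subtype.val h2

theorem mFourierCoeff_torusLift {h : EuclideanSpace ℝ (Fin n) → ℂ}
    (hh : ∀ ξ, 1 / 4 ≤ ‖ξ‖ → h ξ = 0) (l : Fin n → ℤ) :
    UnitAddTorus.mFourierCoeff (torusLift h) l = 𝓕 h (latticePt l) := by
  rw [UnitAddTorus.mFourierCoeff_eq_integral _ l fun _ => -(1 / 2), Real.fourier_eq']
  rw [← (PiLp.volume_preserving_toLp (Fin n)).integral_comp
    (MeasurableEquiv.toLp 2 (Fin n → ℝ)).measurableEmbedding]
  have hms : MeasurableSet {x : Fin n → ℝ | ∀ i, x i ∈ Ioc (-(1 / 2) : ℝ) (-(1 / 2) + 1)} := by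
    have : {x : Fin n → ℝ | ∀ i, x i ∈ Ioc (-(1 / 2) : ℝ) (-(1 / 2) + 1)} =
      Set.univ.pi fun _ => Ioc (-(1 / 2) : ℝ) (-(1 / 2) + 1) := by ext; simp
    rw [this]
    exact MeasurableSet.univ_pi fun _ => measurableSet_Ioc
  refine Eq.trans (setIntegral_congr_fun hms fun x hx => ?_)
    (setIntegral_eq_integral_of_forall_compl_eq_zero fun x hx => ?_)
  · have h1 := torusLift_coe hh (WithLp.toLp 2 x) hx
    have h2 := mFourier_coe (-l) (WithLp.toLp 2 x)
    dsimp only at h1 h2 ⊢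
    rw [h1, h2]
    congr 4
    have : latticePt (-l) = -latticePt l := by ext i; simp [latticePt]
    rw [this, inner_neg_right]
    ring
  · have : h (WithLp.toLp 2 x) = 0 := by
      simp only [mem_ofPred_eq, mem_Ioc, not_forall] at hx
      obtain ⟨i, hi⟩ := hx
      apply hh
      refine le_trans ?_ (PiLp.norm_apply_le (WithLp.toLp 2 x : EuclideanSpace ℝ (Fin n)) i)
      rw [Real.norm_eq_abs]
      by_contra hlt
      push Not at hlt
      have := abs_lt.1 hlt
      dsimp only at this
      exact hi ⟨by linarith [this.1], by linarith [this.2]⟩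
    exact (congrArg _ this).trans (smul_zero _)

/-- The `l`-th Fourier coefficient of the periodised `𝓕 K` is `𝓕 (𝓕 K)` at `l`, that is `K (-l)`;
hence the reindexing by negation. The coefficients are absolutely summable, so the Fourier series
converges pointwise. -/
theorem hasSum_sampling_fourier (K : 𝓢(EuclideanSpace ℝ (Fin n), ℂ))
    (hK : ∀ ξ, 1 / 4 ≤ ‖ξ‖ → 𝓕 K ξ = 0) {ξ : EuclideanSpace ℝ (Fin n)} (hξ : ‖ξ‖ < 1 / 2) :
    HasSum (fun l : Fin n → ℤ => K (latticePt l) *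
      Complex.exp (((-2 * Real.pi * inner ℝ ξ (latticePt l) : ℝ) : ℂ) * Complex.I)) (𝓕 K ξ) := by
  have hneg : ∀ l : Fin n → ℤ, latticePt (-l) = -latticePt l := fun l => by
    ext i; simp [latticePt]
  have hcoef : ∀ l, UnitAddTorus.mFourierCoeff (torusLift (𝓕 K : 𝓢(EuclideanSpace ℝ (Fin n), ℂ))) l =
      K (latticePt (-l)) := by
    intro l
    rw [mFourierCoeff_torusLift hK, ← SchwartzMap.fourier_coe, hneg]
    have h1 : 𝓕⁻ (𝓕 K) (-latticePt l) = K (-latticePt l) := by simp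
    rw [← h1, SchwartzMap.fourierInv_coe, Real.fourierInv_eq_fourier_neg, neg_neg,
      SchwartzMap.fourier_coe]
  have hsum0 := summable_norm_schwartz_lattice K 0
  simp only [pow_zero, one_mul] at hsum0
  have hsum : Summable (UnitAddTorus.mFourierCoeff
      (⟨torusLift (𝓕 K : 𝓢(EuclideanSpace ℝ (Fin n), ℂ)),
        continuous_torusLift (𝓕 K).continuous hK⟩ : C(UnitAddTorus (Fin n), ℂ))) := by
    rw [← (Equiv.neg (Fin n → ℤ)).summable_iff]
    refine hsum0.of_norm.congr fun l => ?_
    have := hcoef (-l)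
    rw [neg_neg] at this
    exact this.symm
  have hx : ∀ i, ξ i ∈ Ioc (-(1 / 2) : ℝ) (-(1 / 2) + 1) := by
    intro i
    have := (PiLp.norm_apply_le ξ i).trans_lt hξ
    rw [Real.norm_eq_abs] at this
    have := abs_lt.1 this
    exact ⟨this.1, by linarith [this.2]⟩
  have H := UnitAddTorus.hasSum_mFourier_series_apply_of_summable hsum
    (fun i => (ξ i : UnitAddCircle))
  rw [← (Equiv.neg (Fin n → ℤ)).hasSum_iff] at H
  simp only [ContinuousMap.coe_mk] at H
  rw [torusLift_coe hK ξ hx] at H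
  convert H using 2 with l
  simp only [Function.comp, Equiv.neg_apply]
  rw [hcoef, neg_neg, mFourier_coe, hneg, inner_neg_right, smul_eq_mul]
  congr 4
  ring

/-- Dilation `u ↦ u(R ·)` on Schwartz functions. -/
def dilate (R : ℝ) (hR : R ≠ 0) (u : 𝓢(EuclideanSpace ℝ (Fin n), ℂ)) :
    𝓢(EuclideanSpace ℝ (Fin n), ℂ) :=
  SchwartzMap.compCLMOfContinuousLinearEquiv ℂ
    (ContinuousLinearEquiv.smulLeft (Units.mk0 R hR)) u

theorem fourier_translate (a : EuclideanSpace ℝ (Fin n)) (u : 𝓢(EuclideanSpace ℝ (Fin n), ℂ))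
    (ξ : EuclideanSpace ℝ (Fin n)) : 𝓕 (SchwartzMap.compSubConstCLM ℂ a u) ξ =
      Complex.exp (((-2 * Real.pi * inner ℝ a ξ : ℝ) : ℂ) * Complex.I) * 𝓕 u ξ := by
  rw [SchwartzMap.fourier_coe, SchwartzMap.fourier_coe, Real.fourier_eq', Real.fourier_eq',
    ← integral_const_mul, ← integral_add_right_eq_self _ a]
  refine integral_congr_ae (Eventually.of_forall fun v => ?_)
  simp only [SchwartzMap.compSubConstCLM_apply, add_sub_cancel_right, smul_eq_mul]
  rw [← mul_assoc, ← Complex.exp_add, inner_add_left]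
  congr 2
  push_cast
  ring

theorem schwartz_ext_fourier {u v : 𝓢(EuclideanSpace ℝ (Fin n), ℂ)}
    (h : ∀ ξ, 𝓕 u ξ = 𝓕 v ξ) : u = v := by
  have : (𝓕 u : 𝓢(EuclideanSpace ℝ (Fin n), ℂ)) = 𝓕 v := SchwartzMap.ext h
  simpa using congrArg (fun w : 𝓢(EuclideanSpace ℝ (Fin n), ℂ) =>
    (𝓕⁻ w : 𝓢(EuclideanSpace ℝ (Fin n), ℂ))) this

/-- Band-limited convolutions are discrete sums of translates. -/
theorem hasSum_sampling (K u v : 𝓢(EuclideanSpace ℝ (Fin n), ℂ)) {R : ℝ} (hR : 1 ≤ R)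
    (hK : ∀ ξ, 1 / 4 ≤ ‖ξ‖ → 𝓕 K ξ = 0) (hu : ∀ ξ, R / 2 ≤ ‖ξ‖ → 𝓕 u ξ = 0)
    (hv : ∀ ξ, 𝓕 v ξ = 𝓕 K (R⁻¹ • ξ) * 𝓕 u ξ) :
    HasSum (fun l : Fin n → ℤ =>
      K (latticePt l) • SchwartzMap.compSubConstCLM ℂ (R⁻¹ • latticePt l) u) v := by
  have hR0 : 0 < R := by linarith
  have hs : ∀ k l, Summable fun i : Fin n → ℤ => SchwartzMap.seminorm ℂ k l
      (K (latticePt i) • SchwartzMap.compSubConstCLM ℂ (R⁻¹ • latticePt i) u) := by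
    intro k l
    set B := 2 ^ k * (SchwartzMap.seminorm ℂ 0 l u + SchwartzMap.seminorm ℂ k l u) with hB
    refine Summable.of_nonneg_of_le (fun i => apply_nonneg _ _) (fun i => ?_)
      ((summable_norm_schwartz_lattice K k).mul_right B)
    rw [map_smul_eq_mul]
    have h1 := seminorm_translate_le u k l (R⁻¹ • latticePt i)
    have h2 : ‖R⁻¹ • latticePt i‖ ≤ ‖latticePt i‖ := by
      rw [norm_smul, Real.norm_of_nonneg (by positivity)]
      exact mul_le_of_le_one_left (norm_nonneg _) (inv_le_one_of_one_le₀ hR)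
    calc _ ≤ ‖K (latticePt i)‖ * ((1 + ‖R⁻¹ • latticePt i‖) ^ k * B) := by gcongr
      _ ≤ ‖K (latticePt i)‖ * ((1 + ‖latticePt i‖) ^ k * B) := by gcongr
      _ = _ := by ring
  obtain ⟨g, hg⟩ := exists_hasSum_schwartz _ hs
  have : g = v := by
    refine schwartz_ext_fourier fun ξ => ?_
    have h1 := hg.mapL (((BoundedContinuousFunction.evalCLM ℂ ξ).comp
      (SchwartzMap.toBoundedContinuousFunctionCLM ℂ (EuclideanSpace ℝ (Fin n)) ℂ)).comp
      (FourierTransform.fourierCLM ℂ 𝓢(EuclideanSpace ℝ (Fin n), ℂ)))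
    refine h1.unique ?_
    have h3 : ∀ i, (((BoundedContinuousFunction.evalCLM ℂ ξ).comp
      (SchwartzMap.toBoundedContinuousFunctionCLM ℂ (EuclideanSpace ℝ (Fin n)) ℂ)).comp
      (FourierTransform.fourierCLM ℂ 𝓢(EuclideanSpace ℝ (Fin n), ℂ)))
      (K (latticePt i) • SchwartzMap.compSubConstCLM ℂ (R⁻¹ • latticePt i) u) =
      K (latticePt i) * Complex.exp (((-2 * Real.pi * inner ℝ (R⁻¹ • ξ) (latticePt i) : ℝ) : ℂ) *
        Complex.I) * 𝓕 u ξ := by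
      intro i
      rw [map_smul, smul_eq_mul, mul_assoc]
      congr 1
      change 𝓕 (SchwartzMap.compSubConstCLM ℂ (R⁻¹ • latticePt i) u) ξ = _
      rw [fourier_translate, inner_smul_left, inner_smul_left, real_inner_comm]
    simp_rw [h3]
    rw [hv]
    -- The Fourier series is periodic and represents `𝓕 K (R⁻¹ • ξ)` only inside the band; outside
    -- it the factor `𝓕 u` vanishes.
    by_cases hξ : ‖ξ‖ < R / 2
    · refine (hasSum_sampling_fourier K hK ?_).mul_right _
      rw [norm_smul, Real.norm_of_nonneg (by positivity), inv_mul_lt_iff₀ hR0]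
      linarith
    · rw [hu ξ (not_lt.1 hξ)]
      simp
  rwa [this] at hg

end Sampling

/-! ### Convolutions with distributions and the transposed operators. -/

section Convolution

variable {n : ℕ}

theorem reflect_apply (u : 𝓢(EuclideanSpace ℝ (Fin n), ℂ)) (x : EuclideanSpace ℝ (Fin n)) :
    reflect u x = u (-x) := rfl

theorem fourier_reflect (u : 𝓢(EuclideanSpace ℝ (Fin n), ℂ)) (ξ : EuclideanSpace ℝ (Fin n)) :
    𝓕 (reflect u) ξ = 𝓕 u (-ξ) := by
  rw [SchwartzMap.fourier_coe, SchwartzMap.fourier_coe, Real.fourier_eq', Real.fourier_eq',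
    ← integral_neg_eq_self]
  simp [reflect_apply]

theorem fourier_convolution_mul (u v : 𝓢(EuclideanSpace ℝ (Fin n), ℂ))
    (ξ : EuclideanSpace ℝ (Fin n)) :
    𝓕 (SchwartzMap.convolution (ContinuousLinearMap.mul ℂ ℂ) u v) ξ = 𝓕 u ξ * 𝓕 v ξ := by
  rw [SchwartzMap.fourier_convolution]
  rfl

/-- The Schwartz function on which `f` is evaluated in `⟨τ_y (u ∗ f), g⟩`. -/
def dualTest (u : 𝓢(EuclideanSpace ℝ (Fin n), ℂ)) (y : EuclideanSpace ℝ (Fin n))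
    (g : 𝓢(EuclideanSpace ℝ (Fin n), ℂ)) : 𝓢(EuclideanSpace ℝ (Fin n), ℂ) :=
  SchwartzMap.convolution (ContinuousLinearMap.mul ℂ ℂ) (reflect u)
    (SchwartzMap.compSubConstCLM ℂ (-y) g)

theorem partialSum_apply (φ : ℕ → 𝓢(EuclideanSpace ℝ (Fin n), ℂ))
    (y : ℕ → EuclideanSpace ℝ (Fin n)) (J : ℕ) (f : 𝓢'(EuclideanSpace ℝ (Fin n), ℂ))
    (g : 𝓢(EuclideanSpace ℝ (Fin n), ℂ)) :
    partialSum φ y J f g = ∑ j ∈ Finset.Icc 1 J, f (dualTest (φ j) (y j) g) := by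
  have h1 : partialSum φ y J f =
      ∑ j ∈ Finset.Icc 1 J, translateDist (y j) (convDist (φ j) f) := by
    simp [partialSum]
  rw [h1]
  have h2 := map_sum (PointwiseConvergenceCLM.evalCLM (RingHom.id ℂ) (F := ℂ) g)
    (fun j => translateDist (y j) (convDist (φ j) f)) (Finset.Icc 1 J)
  exact h2

theorem fourier_dualTest (u : 𝓢(EuclideanSpace ℝ (Fin n), ℂ)) (y : EuclideanSpace ℝ (Fin n))
    (g : 𝓢(EuclideanSpace ℝ (Fin n), ℂ)) (ξ : EuclideanSpace ℝ (Fin n)) :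
    𝓕 (dualTest u y g) ξ = 𝓕 u (-ξ) *
      (Complex.exp (((2 * Real.pi * inner ℝ y ξ : ℝ) : ℂ) * Complex.I) * 𝓕 g ξ) := by
  rw [dualTest, fourier_convolution_mul, fourier_reflect, fourier_translate, inner_neg_left]
  simp

theorem convFun_translate (u : 𝓢(EuclideanSpace ℝ (Fin n), ℂ))
    (f : 𝓢'(EuclideanSpace ℝ (Fin n), ℂ)) (a x : EuclideanSpace ℝ (Fin n)) :
    convFun (SchwartzMap.compSubConstCLM ℂ a u) f x = convFun u f (x - a) := by
  unfold convFun
  congr 1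
  ext v
  simp only [SchwartzMap.compSubConstCLM_apply, reflect_apply]
  congr 1
  abel

theorem hasSum_convFun {ι : Type*} {u : ι → 𝓢(EuclideanSpace ℝ (Fin n), ℂ)}
    {v : 𝓢(EuclideanSpace ℝ (Fin n), ℂ)} (h : HasSum u v)
    (f : 𝓢'(EuclideanSpace ℝ (Fin n), ℂ)) (x : EuclideanSpace ℝ (Fin n)) :
    HasSum (fun i => convFun (u i) f x) (convFun v f x) := by
  have h1 : HasSum (fun i => reflect (u i)) (reflect v) :=
    h.mapL (SchwartzMap.compCLMOfContinuousLinearEquiv ℂ (ContinuousLinearEquiv.neg ℝ))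
  have h2 := h1.mapL (SchwartzMap.compSubConstCLM ℂ x)
  exact h2.map f (map_continuous f)

theorem convFun_smul (c : ℂ) (u : 𝓢(EuclideanSpace ℝ (Fin n), ℂ))
    (f : 𝓢'(EuclideanSpace ℝ (Fin n), ℂ)) (x : EuclideanSpace ℝ (Fin n)) :
    convFun (c • u) f x = c * convFun u f x := by
  simp [convFun, reflect]

theorem convFun_zero (f : 𝓢'(EuclideanSpace ℝ (Fin n), ℂ)) (x : EuclideanSpace ℝ (Fin n)) :
    convFun 0 f x = 0 := by
  simp [convFun, reflect]

theorem continuous_convFun (u : 𝓢(EuclideanSpace ℝ (Fin n), ℂ))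
    (f : 𝓢'(EuclideanSpace ℝ (Fin n), ℂ)) : Continuous (convFun u f) :=
  (map_continuous f).comp (continuous_translate (reflect u))

/-- Applied to a distribution, this says that `v ∗ τ_y (u ∗ f)` at `x` is `(v ∗ u ∗ f)(x - y)`; it
is how the pieces of `T f` get computed. -/
theorem dualTest_translate_reflect (u v : 𝓢(EuclideanSpace ℝ (Fin n), ℂ))
    (x y : EuclideanSpace ℝ (Fin n)) :
    dualTest u y (SchwartzMap.compSubConstCLM ℂ x (reflect v)) =
      SchwartzMap.compSubConstCLM ℂ (x - y)
        (reflect (SchwartzMap.convolution (ContinuousLinearMap.mul ℂ ℂ) v u)) := by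
  refine schwartz_ext_fourier fun ξ => ?_
  rw [fourier_dualTest, fourier_translate, fourier_translate, fourier_reflect, fourier_reflect,
    fourier_convolution_mul, inner_sub_left]
  have : Complex.exp (((-2 * Real.pi * (inner ℝ x ξ - inner ℝ y ξ) : ℝ) : ℂ) * Complex.I) =
      Complex.exp (((2 * Real.pi * inner ℝ y ξ : ℝ) : ℂ) * Complex.I) *
        Complex.exp (((-2 * Real.pi * inner ℝ x ξ : ℝ) : ℂ) * Complex.I) := by
    rw [← Complex.exp_add]
    congr 1
    push_cast
    ring
  rw [this]
  ring

end Convolution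

/-! ### Frequency localisation of the Littlewood–Paley pieces. -/

section Frequency

variable {n : ℕ}

/-- Pointwise product of Schwartz functions, the first one dilated. -/
def dilateMul (R : ℝ) (hR : R ≠ 0) (m u : 𝓢(EuclideanSpace ℝ (Fin n), ℂ)) :
    𝓢(EuclideanSpace ℝ (Fin n), ℂ) :=
  SchwartzMap.pairing (ContinuousLinearMap.mul ℂ ℂ) (dilate R hR m) u

/-- Frequency localisation away from the origin gains arbitrary powers of the frequency. -/
theorem seminorm_localised_le (m u : 𝓢(EuclideanSpace ℝ (Fin n), ℂ)) {ρ : ℝ} (hρ : 0 < ρ)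
    (hm : ∀ ξ, ‖ξ‖ < ρ → m ξ = 0) (w : ℕ → 𝓢(EuclideanSpace ℝ (Fin n), ℂ)) (j₀ : ℕ)
    (hw : ∀ j, j₀ ≤ j → ∀ ξ, w j ξ = m ((2 ^ j : ℝ)⁻¹ • ξ) * u ξ) (M k l : ℕ) :
    ∃ C, 0 ≤ C ∧ ∀ j, j₀ ≤ j → SchwartzMap.seminorm ℂ k l (w j) ≤ C * ((2 ^ j : ℝ)⁻¹) ^ M := by
  set C : ℝ := ∑ i ∈ Finset.range (l + 1), (l.choose i) * SchwartzMap.seminorm ℂ 0 i m *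
    (SchwartzMap.seminorm ℂ (k + M) (l - i) u / ρ ^ M) with hC
  have hC0 : 0 ≤ C := by positivity
  refine ⟨C, hC0, fun j hj => SchwartzMap.seminorm_le_bound ℂ k l _ (by positivity) fun ξ => ?_⟩
  have hj0 : (0 : ℝ) < 2 ^ j := by positivity
  have e : ⇑(w j) = fun ξ => m ((2 ^ j : ℝ)⁻¹ • ξ) * u ξ := funext (hw j hj)
  -- Below this radius the product vanishes in a neighbourhood. Above it, `‖ξ‖ ^ M ≥ (ρ * 2 ^ j) ^
  -- M` gives the gain, and each derivative falling on the dilated factor only contributes `2 ^ (-j)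
  -- ≤ 1`.
  by_cases hξ : ‖ξ‖ < ρ * 2 ^ j
  · have hz : ⇑(w j) =ᶠ[𝓝 ξ] fun _ => 0 := by
      filter_upwards [(isOpen_lt continuous_norm continuous_const).mem_nhds hξ] with x hx
      rw [hw j hj, hm, zero_mul]
      rw [norm_smul, Real.norm_of_nonneg (by positivity), inv_mul_lt_iff₀ hj0, mul_comm]
      exact hx
    have : iteratedFDeriv ℝ l (w j) ξ = 0 := by
      rw [hz.iteratedFDeriv ℝ l |>.eq_of_nhds]
      exact congrFun iteratedFDeriv_fun_zero ξ
    rw [this, norm_zero, mul_zero]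
    positivity
  · push Not at hξ
    have hξ0 : 0 < ‖ξ‖ := lt_of_lt_of_le (by positivity) hξ
    have hs : ContDiff ℝ l fun ξ => m ((2 ^ j : ℝ)⁻¹ • ξ) :=
      (m.smooth l).comp (contDiff_const_smul _)
    have h1 := norm_iteratedFDeriv_mul_le hs (u.smooth l) ξ (n := l) le_rfl
    rw [e]
    calc ‖ξ‖ ^ k * ‖iteratedFDeriv ℝ l (fun ξ => m ((2 ^ j : ℝ)⁻¹ • ξ) * u ξ) ξ‖
        ≤ ‖ξ‖ ^ k * ∑ i ∈ Finset.range (l + 1), (l.choose i) *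
          ‖iteratedFDeriv ℝ i (fun ξ => m ((2 ^ j : ℝ)⁻¹ • ξ)) ξ‖ *
            ‖iteratedFDeriv ℝ (l - i) u ξ‖ := by gcongr
      _ = ∑ i ∈ Finset.range (l + 1), (l.choose i) *
          ‖iteratedFDeriv ℝ i (fun ξ => m ((2 ^ j : ℝ)⁻¹ • ξ)) ξ‖ *
            (‖ξ‖ ^ k * ‖iteratedFDeriv ℝ (l - i) u ξ‖) := by
          rw [Finset.mul_sum]
          refine Finset.sum_congr rfl fun i _ => by ring
      _ ≤ ∑ i ∈ Finset.range (l + 1), (l.choose i) * SchwartzMap.seminorm ℂ 0 i m *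
            (SchwartzMap.seminorm ℂ (k + M) (l - i) u / ρ ^ M * ((2 ^ j : ℝ)⁻¹) ^ M) := by
          refine Finset.sum_le_sum fun i _ => mul_le_mul
            (mul_le_mul_of_nonneg_left ?_ (by positivity)) ?_ (by positivity) (by positivity)
          · rw [iteratedFDeriv_comp_const_smul _ (m.smooth i), norm_smul, norm_pow,
              Real.norm_of_nonneg (by positivity)]
            calc _ ≤ 1 * ‖iteratedFDeriv ℝ i m ((2 ^ j : ℝ)⁻¹ • ξ)‖ := by
                  gcongr
                  exact pow_le_one₀ (by positivity)
                    (inv_le_one_of_one_le₀ (one_le_pow₀ one_le_two))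
              _ ≤ _ := by
                  rw [one_mul]
                  exact SchwartzMap.norm_iteratedFDeriv_le_seminorm ℂ m i _
          · have h2 := SchwartzMap.le_seminorm ℂ (k + M) (l - i) u ξ
            have h3 : (ρ * 2 ^ j) ^ M ≤ ‖ξ‖ ^ M := by gcongr
            rw [inv_pow, div_mul_eq_mul_div, ← div_eq_mul_inv, div_div, mul_comm ((2 ^ j : ℝ) ^ M),
              ← mul_pow, le_div_iff₀ (by positivity)]
            calc _ ≤ ‖ξ‖ ^ k * ‖iteratedFDeriv ℝ (l - i) u ξ‖ * ‖ξ‖ ^ M := by gcongr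
              _ = ‖ξ‖ ^ (k + M) * ‖iteratedFDeriv ℝ (l - i) u ξ‖ := by ring
              _ ≤ _ := h2
      _ = C * ((2 ^ j : ℝ)⁻¹) ^ M := by
          rw [hC, Finset.sum_mul]
          refine Finset.sum_congr rfl fun i _ => by ring

namespace IsLittlewoodPaleyFamily

variable {φ : ℕ → 𝓢(EuclideanSpace ℝ (Fin n), ℂ)}

/-- Compactness of the unit ball and of the support turns the open conditions on `φ̂₀` into
quantitative room on both sides, so that `φ̂ⱼ` is `1` on a ball of fixed radius around each point of
norm `2 ^ j`, `j ≥ 1`. -/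
theorem exists_margin (hφ : IsLittlewoodPaleyFamily φ) : ∃ ε : ℝ, 0 < ε ∧ ε < 1 / 2 ∧
    (∀ ξ, ‖ξ‖ ≤ 1 + ε → 𝓕 (φ 0) ξ = 1) ∧ ∀ ξ, 2 - 2 * ε ≤ ‖ξ‖ → 𝓕 (φ 0) ξ = 0 := by
  obtain ⟨U, hU, hsub, hU1⟩ := mem_nhdsSet_iff_exists.1 hφ.eq_one
  obtain ⟨δ, hδ, hδU⟩ := (isCompact_closedBall (0 : EuclideanSpace ℝ (Fin n)) 1).exists_cthickening_subset_open hU hsub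
  have hcomp : IsCompact (tsupport (𝓕 (φ 0) : 𝓢(EuclideanSpace ℝ (Fin n), ℂ))) :=
    (isCompact_closedBall (0 : EuclideanSpace ℝ (Fin n)) 2).of_isClosed_subset
      (isClosed_tsupport _) (hφ.tsupport_subset.trans Metric.ball_subset_closedBall)
  obtain ⟨r, hr, hr2⟩ : ∃ r < (2 : ℝ), ∀ ξ ∈ tsupport (𝓕 (φ 0) : 𝓢(EuclideanSpace ℝ (Fin n), ℂ)),
      ‖ξ‖ ≤ r := by
    rcases (tsupport (𝓕 (φ 0) : 𝓢(EuclideanSpace ℝ (Fin n), ℂ))).eq_empty_or_nonempty with h | h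
    · exact ⟨0, by norm_num, fun ξ hξ => by simp [h] at hξ⟩
    · obtain ⟨ξ, hξ, hmax⟩ := hcomp.exists_isMaxOn h continuous_norm.continuousOn
      refine ⟨‖ξ‖, ?_, fun η hη => hmax hη⟩
      simpa using hφ.tsupport_subset hξ
  refine ⟨min (1 / 4) (min δ ((2 - r) / 4)), ?_, ?_, fun ξ hξ => ?_, fun ξ hξ => ?_⟩
  · exact lt_min (by norm_num) (lt_min hδ (by linarith))
  · exact (min_le_left _ _).trans_lt (by norm_num)
  · refine hU1 (hδU ?_)
    rw [cthickening_closedBall hδ.le zero_le_one]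
    have : min (1 / 4) (min δ ((2 - r) / 4)) ≤ δ := (min_le_right _ _).trans (min_le_left _ _)
    simp only [Metric.mem_closedBall, dist_zero_right]
    linarith
  · by_contra h
    have h1 := hr2 ξ (subset_tsupport _ h)
    have : min (1 / 4) (min δ ((2 - r) / 4)) ≤ (2 - r) / 4 :=
      (min_le_right _ _).trans (min_le_right _ _)
    linarith

theorem fourier_apply (hφ : IsLittlewoodPaleyFamily φ) {j : ℕ} (hj : 1 ≤ j)
    (ξ : EuclideanSpace ℝ (Fin n)) : 𝓕 (φ j) ξ =
      𝓕 (φ 0) ((2 ^ j : ℝ)⁻¹ • ξ) - 𝓕 (φ 0) ((2 : ℝ) • (2 ^ j : ℝ)⁻¹ • ξ) := by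
  rw [hφ.dilation j hj, smul_smul, zpow_sub₀ two_ne_zero, zpow_neg, zpow_natCast, zpow_one,
    div_eq_mul_inv]

/-- The profile `φ̂₀ - φ̂₀(2 ·)` of the annular pieces. -/
def profile (φ : ℕ → 𝓢(EuclideanSpace ℝ (Fin n), ℂ)) : 𝓢(EuclideanSpace ℝ (Fin n), ℂ) :=
  𝓕 (φ 0) - dilate 2 two_ne_zero (𝓕 (φ 0))

theorem profile_apply (ξ : EuclideanSpace ℝ (Fin n)) :
    profile φ ξ = 𝓕 (φ 0) ξ - 𝓕 (φ 0) ((2 : ℝ) • ξ) := rfl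

theorem fourier_eq_profile (hφ : IsLittlewoodPaleyFamily φ) {j : ℕ} (hj : 1 ≤ j)
    (ξ : EuclideanSpace ℝ (Fin n)) : 𝓕 (φ j) ξ = profile φ ((2 ^ j : ℝ)⁻¹ • ξ) :=
  hφ.fourier_apply hj ξ

theorem fourier_zero_eq_one (hφ : IsLittlewoodPaleyFamily φ) {ξ : EuclideanSpace ℝ (Fin n)}
    (h : ‖ξ‖ ≤ 1) : 𝓕 (φ 0) ξ = 1 := by
  obtain ⟨ε, h0, -, h1, -⟩ := hφ.exists_margin
  exact h1 ξ (by linarith)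

theorem fourier_zero_eq_zero (hφ : IsLittlewoodPaleyFamily φ) {ξ : EuclideanSpace ℝ (Fin n)}
    (h : 2 ≤ ‖ξ‖) : 𝓕 (φ 0) ξ = 0 := by
  obtain ⟨ε, h0, -, -, h1⟩ := hφ.exists_margin
  exact h1 ξ (by linarith)

theorem profile_eq_zero_of_le (hφ : IsLittlewoodPaleyFamily φ) {ξ : EuclideanSpace ℝ (Fin n)}
    (h : ‖ξ‖ ≤ 1 / 2) : profile φ ξ = 0 := by
  rw [profile_apply, hφ.fourier_zero_eq_one (by linarith), hφ.fourier_zero_eq_one, sub_self]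
  rw [norm_smul, Real.norm_of_nonneg two_pos.le]
  linarith

theorem profile_eq_zero_of_ge (hφ : IsLittlewoodPaleyFamily φ) {ξ : EuclideanSpace ℝ (Fin n)}
    (h : 2 ≤ ‖ξ‖) : profile φ ξ = 0 := by
  rw [profile_apply, hφ.fourier_zero_eq_zero h, hφ.fourier_zero_eq_zero, sub_self]
  rw [norm_smul, Real.norm_of_nonneg two_pos.le]
  linarith

theorem fourier_eq_zero_of_ge (hφ : IsLittlewoodPaleyFamily φ) (j : ℕ)
    {ξ : EuclideanSpace ℝ (Fin n)} (h : 2 ^ (j + 1) ≤ ‖ξ‖) : 𝓕 (φ j) ξ = 0 := by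
  rcases Nat.eq_zero_or_pos j with rfl | hj
  · exact hφ.fourier_zero_eq_zero (by simpa using h)
  · rw [hφ.fourier_eq_profile hj, hφ.profile_eq_zero_of_ge]
    rw [norm_smul, Real.norm_of_nonneg (by positivity), le_inv_mul_iff₀ (by positivity)]
    rwa [← pow_succ]

theorem fourier_eq_zero_of_le (hφ : IsLittlewoodPaleyFamily φ) {j : ℕ} (hj : 1 ≤ j)
    {ξ : EuclideanSpace ℝ (Fin n)} (h : 2 * ‖ξ‖ ≤ 2 ^ j) : 𝓕 (φ j) ξ = 0 := by
  rw [hφ.fourier_eq_profile hj, hφ.profile_eq_zero_of_le]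
  rw [norm_smul, Real.norm_of_nonneg (by positivity), inv_mul_le_iff₀ (by positivity)]
  linarith

/-- Littlewood–Paley pieces at distance at least two do not interact. -/
theorem fourier_mul_eq_zero (hφ : IsLittlewoodPaleyFamily φ) {j k : ℕ} (h : j + 2 ≤ k)
    (ξ : EuclideanSpace ℝ (Fin n)) : 𝓕 (φ j) ξ * 𝓕 (φ k) ξ = 0 := by
  rcases le_total (2 ^ (j + 1)) ‖ξ‖ with h1 | h1
  · rw [hφ.fourier_eq_zero_of_ge j h1, zero_mul]
  · rw [hφ.fourier_eq_zero_of_le (j := k) (by omega), mul_zero]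
    calc 2 * ‖ξ‖ ≤ 2 * 2 ^ (j + 1) := by gcongr
      _ = 2 ^ (j + 2) := by ring
      _ ≤ 2 ^ k := pow_le_pow_right₀ one_le_two h

end IsLittlewoodPaleyFamily

end Frequency

/-! ### The series on test functions; sufficiency of exponential growth. -/

section ShiftedSum

variable {n : ℕ} {φ : ℕ → 𝓢(EuclideanSpace ℝ (Fin n), ℂ)} {y : ℕ → EuclideanSpace ℝ (Fin n)}

theorem partialSum_apply_range (J : ℕ) (f : 𝓢'(EuclideanSpace ℝ (Fin n), ℂ))
    (g : 𝓢(EuclideanSpace ℝ (Fin n), ℂ)) :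
    partialSum φ y J f g = ∑ j ∈ Finset.range J, f (dualTest (φ (j + 1)) (y (j + 1)) g) := by
  rw [partialSum_apply, Finset.range_eq_Ico, Finset.sum_Ico_add' (fun j =>
    f (dualTest (φ j) (y j) g)) 0 J 1]
  rfl

theorem mem_domain_of_summable (f : 𝓢'(EuclideanSpace ℝ (Fin n), ℂ))
    (h : ∀ g, Summable fun j : ℕ => f (dualTest (φ (j + 1)) (y (j + 1)) g)) :
    f ∈ (shiftedSum φ y).domain := by
  obtain ⟨u, -, hu⟩ := exists_tempered_limit (fun J => partialSum φ y J f)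
    (fun g => ∑' j : ℕ, f (dualTest (φ (j + 1)) (y (j + 1)) g)) (fun g => by
      simp_rw [partialSum_apply_range]
      exact (h g).hasSum.tendsto_sum_nat)
  exact ⟨u, hu⟩

theorem tendsto_partialSum_apply (f : (shiftedSum φ y).domain)
    (g : 𝓢(EuclideanSpace ℝ (Fin n), ℂ)) :
    Tendsto (fun J => ∑ j ∈ Finset.range J,
      (f : 𝓢'(EuclideanSpace ℝ (Fin n), ℂ)) (dualTest (φ (j + 1)) (y (j + 1)) g)) atTop
      (𝓝 (shiftedSum φ y f g)) := by
  have := (PointwiseConvergenceCLM.tendsto_iff_forall_tendsto.1 (tendsto_shiftedSum φ y f)) g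
  simpa only [partialSum_apply_range] using this

theorem shiftedSum_apply_eq (f : (shiftedSum φ y).domain)
    (g : 𝓢(EuclideanSpace ℝ (Fin n), ℂ)) {a : ℂ}
    (h : HasSum (fun j : ℕ => (f : 𝓢'(EuclideanSpace ℝ (Fin n), ℂ))
      (dualTest (φ (j + 1)) (y (j + 1)) g)) a) : shiftedSum φ y f g = a :=
  tendsto_nhds_unique (tendsto_partialSum_apply f g) h.tendsto_sum_nat

theorem dualTest_eq_translate (u g : 𝓢(EuclideanSpace ℝ (Fin n), ℂ))
    (y : EuclideanSpace ℝ (Fin n)) :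
    dualTest u y g = SchwartzMap.compSubConstCLM ℂ (-y) (dualTest u 0 g) := by
  refine schwartz_ext_fourier fun ξ => ?_
  rw [fourier_translate, fourier_dualTest, fourier_dualTest, inner_neg_left]
  simp
  ring

/-- On the Fourier side this function is `ĝ` times a factor vanishing for `‖ξ‖ ≤ 2 ^ (j - 1)`, and
the inverse Fourier transform preserves uniform seminorm bounds. The case `j = 0` is excluded
because `φ̂₀` does not vanish near the origin. -/
theorem IsLittlewoodPaleyFamily.seminorm_dualTest_zero_le (hφ : IsLittlewoodPaleyFamily φ)
    (g : 𝓢(EuclideanSpace ℝ (Fin n), ℂ)) (M k l : ℕ) :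
    ∃ C, 0 ≤ C ∧ ∀ j, 1 ≤ j →
      SchwartzMap.seminorm ℂ k l (dualTest (φ j) 0 g) ≤ C * ((2 ^ j : ℝ)⁻¹) ^ M := by
  have h1 : ∀ k l, ∃ C, 0 ≤ C ∧ ∀ j : {j : ℕ // 1 ≤ j}, SchwartzMap.seminorm ℂ k l
      (𝓕 (dualTest (φ j) 0 g) : 𝓢(EuclideanSpace ℝ (Fin n), ℂ)) ≤
        C * ((2 ^ (j : ℕ) : ℝ)⁻¹) ^ M := by
    intro k l
    obtain ⟨C, hC, h⟩ := seminorm_localised_le (reflect (profile φ)) (𝓕 g) (ρ := 1 / 2)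
      (by norm_num) (fun ξ hξ => by
        rw [reflect_apply, hφ.profile_eq_zero_of_le]
        rw [norm_neg]; exact hξ.le)
      (fun j => 𝓕 (dualTest (φ j) 0 g)) 1 (fun j hj ξ => by
        rw [fourier_dualTest, hφ.fourier_eq_profile hj, reflect_apply]
        simp) M k l
    exact ⟨C, hC, fun j => h j j.2⟩
  obtain ⟨C, hC, h⟩ := seminorm_family_bound_map
    (FourierTransform.fourierInvCLM ℂ 𝓢(EuclideanSpace ℝ (Fin n), ℂ))
    (fun j : {j : ℕ // 1 ≤ j} => (𝓕 (dualTest (φ j) 0 g) : 𝓢(EuclideanSpace ℝ (Fin n), ℂ))) _ h1 k l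
  refine ⟨C, hC, fun j hj => ?_⟩
  have := h ⟨j, hj⟩
  simpa using this

/-- With `N ≥ N₀` a natural number, translation by `y j` costs at most `2 ^ (j * (N + 1) * k)`.
Asking for the decay exponent `(N + 1) * k + 1` therefore leaves a geometric factor `2 ^ (-j)`. -/
theorem summable_dualTest (hφ : IsLittlewoodPaleyFamily φ) {N₀ : ℝ}
    (hy : ∀ j : ℕ, 1 ≤ j → ‖y j‖ ≤ (2 : ℝ) ^ (N₀ * (j : ℝ)))
    (g : 𝓢(EuclideanSpace ℝ (Fin n), ℂ)) (k l : ℕ) :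
    Summable fun j : ℕ => SchwartzMap.seminorm ℂ k l (dualTest (φ (j + 1)) (y (j + 1)) g) := by
  obtain ⟨N, hN⟩ := exists_nat_ge N₀
  have hy' : ∀ j : ℕ, 1 ≤ j → 1 + ‖y j‖ ≤ ((2 : ℝ) ^ j) ^ (N + 1) := by
    intro j hj
    have h1 : ‖y j‖ ≤ ((2 : ℝ) ^ j) ^ N := by
      refine (hy j hj).trans ?_
      rw [← pow_mul, ← Real.rpow_natCast]
      apply Real.rpow_le_rpow_of_exponent_le one_le_two
      push_cast
      rw [mul_comm (j : ℝ)]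
      gcongr
    have h2 : (2 : ℝ) ≤ 2 ^ j := by
      calc (2 : ℝ) = 2 ^ 1 := (pow_one _).symm
        _ ≤ 2 ^ j := pow_le_pow_right₀ one_le_two hj
    have h3 : (1 : ℝ) ≤ ((2 : ℝ) ^ j) ^ N := one_le_pow₀ (by linarith)
    calc 1 + ‖y j‖ ≤ ((2 : ℝ) ^ j) ^ N * 2 := by linarith
      _ ≤ ((2 : ℝ) ^ j) ^ N * 2 ^ j := by gcongr
      _ = _ := (pow_succ _ _).symm
  obtain ⟨C, hC, h⟩ := hφ.seminorm_dualTest_zero_le g ((N + 1) * k + 1) k l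
  obtain ⟨C', hC', h'⟩ := hφ.seminorm_dualTest_zero_le g ((N + 1) * k + 1) 0 l
  refine Summable.of_nonneg_of_le (fun j => apply_nonneg _ _) (fun j => ?_)
    ((summable_geometric_of_lt_one (r := (1 / 2 : ℝ)) (by norm_num) (by norm_num)).mul_left
      (2 ^ k * (C' + C)))
  rw [dualTest_eq_translate]
  refine (seminorm_translate_le _ k l _).trans ?_
  have hj : 1 ≤ j + 1 := by omega
  have hp : (0 : ℝ) < 2 ^ (j + 1) := by positivity
  rw [norm_neg]
  calc (1 + ‖y (j + 1)‖) ^ k * (2 ^ k * (SchwartzMap.seminorm ℂ 0 l (dualTest (φ (j + 1)) 0 g) +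
        SchwartzMap.seminorm ℂ k l (dualTest (φ (j + 1)) 0 g)))
      ≤ (((2 : ℝ) ^ (j + 1)) ^ (N + 1)) ^ k * (2 ^ k *
        (C' * ((2 ^ (j + 1) : ℝ)⁻¹) ^ ((N + 1) * k + 1) +
          C * ((2 ^ (j + 1) : ℝ)⁻¹) ^ ((N + 1) * k + 1))) := by
        have a1 := hy' (j + 1) hj
        have a2 := h' (j + 1) hj
        have a3 := h (j + 1) hj
        gcongr
    _ = 2 ^ k * (C' + C) * (2 ^ (j + 1) : ℝ)⁻¹ := by
        rw [← pow_mul, pow_succ ((2 ^ (j + 1) : ℝ)⁻¹), inv_pow]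
        field_simp
    _ ≤ 2 ^ k * (C' + C) * (1 / 2) ^ j := by
        gcongr
        rw [one_div, inv_pow]
        gcongr
        · norm_num
        · omega

/-- The transposed series converges in the Schwartz space to some `S g`, so `⟨T f, g⟩ = f (S g)`.
For pointwise convergence this is already continuous in `f`, being evaluation at a fixed function;
continuity of `S` plays no role. -/
theorem domain_eq_top_and_continuous (hφ : IsLittlewoodPaleyFamily φ) {N₀ : ℝ}
    (hy : ∀ j : ℕ, 1 ≤ j → ‖y j‖ ≤ (2 : ℝ) ^ (N₀ * (j : ℝ))) :
    (shiftedSum φ y).domain = ⊤ ∧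
      Continuous fun f : (shiftedSum φ y).domain => shiftedSum φ y f := by
  have H : ∀ g, ∃ S : 𝓢(EuclideanSpace ℝ (Fin n), ℂ),
      HasSum (fun j : ℕ => dualTest (φ (j + 1)) (y (j + 1)) g) S := fun g =>
    exists_hasSum_schwartz _ (summable_dualTest hφ hy g)
  choose S hS using H
  have hf : ∀ (f : 𝓢'(EuclideanSpace ℝ (Fin n), ℂ)) g,
      HasSum (fun j : ℕ => f (dualTest (φ (j + 1)) (y (j + 1)) g)) (f (S g)) := fun f g =>
    (hS g).map f (map_continuous f)
  refine ⟨?_, ?_⟩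
  · rw [eq_top_iff]
    exact fun f _ => mem_domain_of_summable f fun g => (hf f g).summable
  · refine PointwiseConvergenceCLM.continuous_of_continuous_eval fun g => ?_
    have : (fun f : (shiftedSum φ y).domain => shiftedSum φ y f g) =
        fun f : (shiftedSum φ y).domain => (f : 𝓢'(EuclideanSpace ℝ (Fin n), ℂ)) (S g) :=
      funext fun f => shiftedSum_apply_eq f g (hf f g)
    rw [this]
    exact (PointwiseConvergenceCLM.evalCLM (RingHom.id ℂ) (F := ℂ) (S g)).continuous.comp
      continuous_subtype_val

end ShiftedSum

/-! ### Bump functions near the frequencies `2ʲ e`. -/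

section Bump

variable {n : ℕ} {φ : ℕ → 𝓢(EuclideanSpace ℝ (Fin n), ℂ)}

theorem exists_schwartz_bump {ε : ℝ} (hε : 0 < ε) : ∃ χ : 𝓢(EuclideanSpace ℝ (Fin n), ℂ),
    (∀ ξ, ‖ξ‖ ≤ ε / 2 → χ ξ = 1) ∧ ∀ ξ, ε ≤ ‖ξ‖ → χ ξ = 0 := by
  let b : ContDiffBump (0 : EuclideanSpace ℝ (Fin n)) := ⟨ε / 2, ε, by linarith, by linarith⟩
  have h1 : HasCompactSupport fun ξ => ((b ξ : ℝ) : ℂ) :=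
    b.hasCompactSupport.comp_left (g := fun t : ℝ => (t : ℂ)) (by simp)
  have h2 : ContDiff ℝ ((⊤ : ℕ∞) : WithTop ℕ∞) fun ξ => ((b ξ : ℝ) : ℂ) :=
    Complex.ofRealCLM.contDiff.comp b.contDiff
  refine ⟨h1.toSchwartzMap h2, fun ξ hξ => ?_, fun ξ hξ => ?_⟩
  · change ((b ξ : ℝ) : ℂ) = 1
    rw [b.one_of_mem_closedBall (by simpa using hξ)]
    simp
  · change ((b ξ : ℝ) : ℂ) = 0
    rw [b.zero_of_le_dist (by simpa using hξ)]
    simp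

/-- Near `2ʲ e`, with `e` a unit vector, only the `j`-th piece is active. -/
theorem IsLittlewoodPaleyFamily.exists_pieces_near (hφ : IsLittlewoodPaleyFamily φ) :
    ∃ ε : ℝ, 0 < ε ∧ ε < 1 / 2 ∧ ∀ (e : EuclideanSpace ℝ (Fin n)), ‖e‖ = 1 → ∀ j k : ℕ, 1 ≤ j →
      ∀ ξ, ‖ξ - (2 ^ j : ℝ) • e‖ < ε → 𝓕 (φ k) ξ = if k = j then 1 else 0 := by
  obtain ⟨ε, h0, h12, h1, h2⟩ := hφ.exists_margin
  refine ⟨ε, h0, h12, fun e he j k hj ξ hξ => ?_⟩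
  have hn : ‖(2 ^ j : ℝ) • e‖ = 2 ^ j := by
    rw [norm_smul, he, mul_one, Real.norm_of_nonneg (by positivity)]
  have hu : ‖ξ‖ ≤ 2 ^ j + ε := by
    have := norm_le_insert' ξ ((2 ^ j : ℝ) • e)
    rw [hn] at this
    linarith
  have hl : 2 ^ j - ε ≤ ‖ξ‖ := by
    have := norm_le_insert ξ ((2 ^ j : ℝ) • e)
    rw [hn] at this
    linarith
  -- At scale `2 ^ i` the point `ξ` lies where `φ̂₀` is `1` if `i ≥ j`, and where it is `0` if `i <
  -- j`. Since `φ̂ₖ` is the difference of scales `k` and `k - 1`, only `k = j` survives.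
  have key : ∀ i : ℕ, 𝓕 (φ 0) ((2 ^ i : ℝ)⁻¹ • ξ) = if j ≤ i then 1 else 0 := by
    intro i
    have hi : (0 : ℝ) < 2 ^ i := by positivity
    split_ifs with hij
    · apply h1
      rw [norm_smul, Real.norm_of_nonneg (by positivity), inv_mul_le_iff₀ hi]
      have : (2 : ℝ) ^ j ≤ 2 ^ i := pow_le_pow_right₀ one_le_two hij
      have : (1 : ℝ) ≤ 2 ^ i := one_le_pow₀ one_le_two
      nlinarith
    · apply h2
      rw [norm_smul, Real.norm_of_nonneg (by positivity), le_inv_mul_iff₀ hi]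
      have h3 : (2 : ℝ) ^ (i + 1) ≤ 2 ^ j := pow_le_pow_right₀ one_le_two (by omega)
      rw [pow_succ] at h3
      have : (1 : ℝ) ≤ 2 ^ i := one_le_pow₀ one_le_two
      nlinarith
  rcases Nat.eq_zero_or_pos k with rfl | hk
  · have := key 0
    simp only [pow_zero, inv_one, one_smul] at this
    rw [this, if_neg (by omega), if_neg (by omega)]
  · obtain ⟨i, rfl⟩ : ∃ i, k = i + 1 := ⟨k - 1, by omega⟩
    have e2 : (2 : ℝ) • (2 ^ (i + 1) : ℝ)⁻¹ • ξ = (2 ^ i : ℝ)⁻¹ • ξ := by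
      rw [smul_smul]; congr 1; rw [pow_succ]; field_simp
    rw [hφ.fourier_apply hk, e2, key, key]
    split_ifs <;> first | omega | simp

end Bump

/-! ### Necessity of exponential growth. -/

section Growth

variable {n : ℕ} {φ : ℕ → 𝓢(EuclideanSpace ℝ (Fin n), ℂ)} {y : ℕ → EuclideanSpace ℝ (Fin n)}

open LineDeriv

/-- The functional `g ↦ ∂ₑ ĝ (a)`. -/
def derivFourierAt (e a : EuclideanSpace ℝ (Fin n)) : 𝓢(EuclideanSpace ℝ (Fin n), ℂ) →L[ℂ] ℂ :=
  ((BoundedContinuousFunction.evalCLM ℂ a).comp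
    (SchwartzMap.toBoundedContinuousFunctionCLM ℂ (EuclideanSpace ℝ (Fin n)) ℂ)).comp
    ((lineDerivOpCLM ℂ 𝓢(EuclideanSpace ℝ (Fin n), ℂ) e).comp
      (FourierTransform.fourierCLM ℂ 𝓢(EuclideanSpace ℝ (Fin n), ℂ)))

theorem derivFourierAt_apply (e a : EuclideanSpace ℝ (Fin n))
    (g : 𝓢(EuclideanSpace ℝ (Fin n), ℂ)) :
    derivFourierAt e a g = fderiv ℝ (𝓕 g : 𝓢(EuclideanSpace ℝ (Fin n), ℂ)) a e := rfl

theorem summable_derivFourierAt {e : EuclideanSpace ℝ (Fin n)} (he : ‖e‖ = 1)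
    (g : 𝓢(EuclideanSpace ℝ (Fin n), ℂ)) :
    Summable fun j : ℕ => derivFourierAt e (-((2 ^ (j + 1) : ℝ) • e)) g := by
  set G : 𝓢(EuclideanSpace ℝ (Fin n), ℂ) := ∂_{e} (𝓕 g : 𝓢(EuclideanSpace ℝ (Fin n), ℂ))
  refine Summable.of_norm_bounded ((summable_geometric_of_lt_one (r := (1 / 2 : ℝ)) (by norm_num)
    (by norm_num)).mul_left (SchwartzMap.seminorm ℂ 1 0 G)) fun j => ?_
  have h := SchwartzMap.norm_pow_mul_le_seminorm ℂ G 1 (-((2 ^ (j + 1) : ℝ) • e))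
  rw [norm_neg, norm_smul, he, mul_one, pow_one, Real.norm_of_nonneg (by positivity)] at h
  change ‖G (-((2 ^ (j + 1) : ℝ) • e))‖ ≤ _
  rw [one_div, inv_pow, ← div_eq_mul_inv, le_div_iff₀ (by positivity), mul_comm]
  refine le_trans ?_ h
  gcongr
  · norm_num
  · omega

/-- A distribution built to detect translations: they act on the Fourier side by a phase, and a
derivative of the phase brings down `y`. -/
theorem exists_derivFourier_sum {e : EuclideanSpace ℝ (Fin n)} (he : ‖e‖ = 1) :
    ∃ f : 𝓢'(EuclideanSpace ℝ (Fin n), ℂ), ∀ g,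
      HasSum (fun j : ℕ => derivFourierAt e (-((2 ^ (j + 1) : ℝ) • e)) g) (f g) := by
  obtain ⟨f, hf, -⟩ := exists_tempered_limit
    (fun N => (∑ j ∈ Finset.range N, derivFourierAt e
      (-((2 ^ (j + 1) : ℝ) • e))).toPointwiseConvergenceCLM ℂ (RingHom.id ℂ) _ _)
    (fun g => ∑' j : ℕ, derivFourierAt e (-((2 ^ (j + 1) : ℝ) • e)) g) (fun g => by
      refine ((summable_derivFourierAt he g).hasSum.tendsto_sum_nat).congr fun N => ?_
      change _ = (∑ j ∈ Finset.range N, derivFourierAt e (-((2 ^ (j + 1) : ℝ) • e))) g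
      rw [_root_.sum_apply])
  exact ⟨f, fun g => by rw [hf]; exact (summable_derivFourierAt he g).hasSum⟩

theorem exists_sum_seminorm_translate_le (s : Finset (ℕ × ℕ))
    (u : 𝓢(EuclideanSpace ℝ (Fin n), ℂ)) : ∃ (C : ℝ) (M : ℕ), 0 ≤ C ∧ ∀ a,
      ∑ m ∈ s, SchwartzMap.seminorm ℂ m.1 m.2 (SchwartzMap.compSubConstCLM ℂ a u) ≤
        C * (1 + ‖a‖) ^ M := by
  refine ⟨∑ m ∈ s, 2 ^ m.1 * (SchwartzMap.seminorm ℂ 0 m.2 u + SchwartzMap.seminorm ℂ m.1 m.2 u),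
    s.sup Prod.fst, by positivity, fun a => ?_⟩
  rw [Finset.sum_mul]
  refine Finset.sum_le_sum fun m hm => (seminorm_translate_le u m.1 m.2 a).trans ?_
  rw [mul_comm]
  gcongr
  · have := norm_nonneg a; linarith
  · exact Finset.le_sup (f := Prod.fst) hm

/-- Banach–Steinhaus on the inverse Fourier transforms of the terms of `T f` gives one finite family
of seminorms controlling them all. On a bump translated by `2 ^ J • e` the seminorms grow
polynomially in `2 ^ J`, whereas the `J`-th term has modulus `2π |⟨y J, e⟩|`. -/
theorem exists_coordinate_bound (hφ : IsLittlewoodPaleyFamily φ)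
    (hT : (shiftedSum φ y).domain = ⊤) {e : EuclideanSpace ℝ (Fin n)} (he : ‖e‖ = 1) :
    ∃ (C : ℝ) (M : ℕ), 0 ≤ C ∧ ∀ j : ℕ, |inner ℝ (y (j + 1)) e| ≤ C * (2 ^ (j + 1)) ^ M := by
  obtain ⟨ε, hε, hε2, hnear⟩ := hφ.exists_pieces_near
  obtain ⟨χ, hχ1, hχ0⟩ := exists_schwartz_bump (n := n) hε
  obtain ⟨f, hf⟩ := exists_derivFourier_sum he
  have hfd : f ∈ (shiftedSum φ y).domain := by rw [hT]; trivial
  -- Each term is a difference of consecutive partial sums, and these converge.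
  have hbd : ∀ g, ∃ C, ∀ j : ℕ, ‖(𝓕⁻ (translateDist (y (j + 1)) (convDist (φ (j + 1)) f)) :
      𝓢'(EuclideanSpace ℝ (Fin n), ℂ)) g‖ ≤ C := by
    intro g
    have h1 := tendsto_partialSum_apply ⟨f, hfd⟩
      (𝓕⁻ g : 𝓢(EuclideanSpace ℝ (Fin n), ℂ))
    have h2 := (h1.comp (tendsto_add_atTop_nat 1)).sub h1
    obtain ⟨C, hC⟩ := (Metric.isBounded_range_of_tendsto _ h2).exists_norm_le
    refine ⟨C, fun j => ?_⟩
    have := hC _ (mem_range_self j)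
    simp only [Function.comp_apply, Finset.sum_range_succ,
      add_sub_cancel_left] at this
    exact this
  obtain ⟨s, C, hC⟩ := tempered_uniform_bound _ hbd
  obtain ⟨D, M, hD, hDM⟩ := exists_sum_seminorm_translate_le s χ
  refine ⟨C * (D * 2 ^ M), M, by positivity, fun j => ?_⟩
  set J := j + 1 with hJ
  have hJ1 : 1 ≤ J := by omega
  -- The sign comes from transposition, which replaces `φ̂_J(ξ)` by `φ̂_J(-ξ)`.
  set a : EuclideanSpace ℝ (Fin n) := -((2 ^ J : ℝ) • e) with ha
  set g : 𝓢(EuclideanSpace ℝ (Fin n), ℂ) := SchwartzMap.compSubConstCLM ℂ a χ with hg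
  set H : 𝓢(EuclideanSpace ℝ (Fin n), ℂ) := 𝓕 (dualTest (φ J) (y J) (𝓕⁻ g)) with hH
  have hHx : ∀ ξ, H ξ = 𝓕 (φ J) (-ξ) *
      (Complex.exp (((2 * Real.pi * inner ℝ (y J) ξ : ℝ) : ℂ) * Complex.I) * χ (ξ - a)) := by
    intro ξ
    rw [hH, fourier_dualTest, FourierTransform.fourier_fourierInv_eq]
    rfl
  -- Distinct points `2 ^ i • e` with `i ≥ 1` are at distance at least one, while the bump has
  -- radius `ε < 1/2`; so no other summand of `f` sees it.
  have hclose : ∀ i : ℕ, i ≠ j → derivFourierAt e (-((2 ^ (i + 1) : ℝ) • e))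
      (dualTest (φ J) (y J) (𝓕⁻ g)) = 0 := by
    intro i hij
    have hz : ⇑H =ᶠ[𝓝 (-((2 ^ (i + 1) : ℝ) • e))] fun _ => 0 := by
      filter_upwards [Metric.ball_mem_nhds _ (show (0 : ℝ) < 1 / 2 by norm_num)] with ξ hξ
      rw [hHx, hχ0, mul_zero, mul_zero]
      rw [Metric.mem_ball, dist_eq_norm] at hξ
      have h3 : (1 : ℝ) ≤ ‖-((2 ^ (i + 1) : ℝ) • e) - a‖ := by
        have : -((2 ^ (i + 1) : ℝ) • e) - a = ((2 ^ J : ℝ) - 2 ^ (i + 1)) • e := by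
          rw [ha]; module
        rw [this, norm_smul, he, mul_one, Real.norm_eq_abs]
        have h5 : ((2 : ℤ) ^ J - 2 ^ (i + 1)) ≠ 0 := by
          rw [sub_ne_zero]
          intro h
          have := Int.pow_right_injective (a := 2) (by norm_num) h
          omega
        have := Int.one_le_abs h5
        exact_mod_cast this
      have h4 : ‖-((2 ^ (i + 1) : ℝ) • e) - a‖ ≤ ‖ξ - a‖ + ‖ξ - -((2 ^ (i + 1) : ℝ) • e)‖ := by
        have := norm_sub_le (ξ - a) (ξ - -((2 ^ (i + 1) : ℝ) • e))
        rwa [sub_sub_sub_cancel_left] at this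
      linarith
    rw [derivFourierAt_apply, hz.fderiv_eq]
    simp
  have hmain : ‖derivFourierAt e a (dualTest (φ J) (y J) (𝓕⁻ g))‖ =
      2 * Real.pi * |inner ℝ (y J) e| := by
    -- Near `a` both the bump and `φ̂_J(-·)` equal one, leaving the pure phase.
    have hz : ⇑H =ᶠ[𝓝 a] fun ξ =>
        Complex.exp (((2 * Real.pi * inner ℝ (y J) ξ : ℝ) : ℂ) * Complex.I) := by
      filter_upwards [Metric.ball_mem_nhds a (half_pos hε)] with ξ hξ
      rw [Metric.mem_ball, dist_eq_norm] at hξ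
      have h3 := hnear e he J J hJ1 (-ξ) (by
        have : -ξ - (2 ^ J : ℝ) • e = -(ξ - a) := by rw [ha]; abel
        rw [this, norm_neg]; linarith)
      rw [if_pos rfl] at h3
      rw [hHx, h3, hχ1 _ hξ.le]
      ring
    have hd : HasFDerivAt (fun ξ : EuclideanSpace ℝ (Fin n) =>
        (((2 * Real.pi * inner ℝ (y J) ξ : ℝ) : ℂ) * Complex.I))
        ((Complex.I • Complex.ofRealCLM).comp ((2 * Real.pi) • innerSL ℝ (y J))) a := by
      have h6 := ((Complex.I • Complex.ofRealCLM).comp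
        ((2 * Real.pi) • innerSL ℝ (y J))).hasFDerivAt (x := a)
      refine h6.congr_of_eventuallyEq (Eventually.of_forall fun ξ => ?_)
      simp
      ring
    rw [derivFourierAt_apply, hz.fderiv_eq, hd.cexp.fderiv]
    simp [Complex.norm_exp, abs_of_pos Real.pi_pos]
  have hval : f (dualTest (φ J) (y J) (𝓕⁻ g)) =
      derivFourierAt e a (dualTest (φ J) (y J) (𝓕⁻ g)) :=
    (hf _).unique (hasSum_single j fun i hi => hclose i hi)
  have h7 := hC j g
  have h8 : (𝓕⁻ (translateDist (y (j + 1)) (convDist (φ (j + 1)) f)) :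
      𝓢'(EuclideanSpace ℝ (Fin n), ℂ)) g = f (dualTest (φ J) (y J) (𝓕⁻ g)) := rfl
  rw [h8, hval, hmain] at h7
  have h9 : (1 + ‖a‖) ^ M ≤ 2 ^ M * (2 ^ J) ^ M := by
    rw [← mul_pow]
    gcongr
    rw [ha, norm_neg, norm_smul, he, mul_one, Real.norm_of_nonneg (by positivity)]
    have : (1 : ℝ) ≤ 2 ^ J := one_le_pow₀ one_le_two
    linarith
  have hpi : 1 ≤ 2 * Real.pi := by linarith [Real.pi_gt_three]
  calc |inner ℝ (y J) e| ≤ 2 * Real.pi * |inner ℝ (y J) e| :=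
        le_mul_of_one_le_left (abs_nonneg _) hpi
    _ ≤ C * (D * (2 ^ M * (2 ^ J) ^ M)) := by
        refine h7.trans ?_
        gcongr
        exact (hDM a).trans (by gcongr)
    _ = _ := by ring

theorem exists_growth_of_domain_eq_top (hφ : IsLittlewoodPaleyFamily φ)
    (hT : (shiftedSum φ y).domain = ⊤) :
    ∃ N₀ : ℝ, 0 < N₀ ∧ ∀ j : ℕ, 1 ≤ j → ‖y j‖ ≤ (2 : ℝ) ^ (N₀ * (j : ℝ)) := by
  have h : ∀ i : Fin n, ∃ (C : ℝ) (M : ℕ), 0 ≤ C ∧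
      ∀ j : ℕ, |inner ℝ (y (j + 1)) (EuclideanSpace.single i (1 : ℝ))| ≤ C * (2 ^ (j + 1)) ^ M :=
    fun i => exists_coordinate_bound hφ hT (by simp)
  choose C M hC hCM using h
  obtain ⟨A, hA⟩ := pow_unbounded_of_one_lt (∑ i, C i) one_lt_two
  set B := Finset.univ.sup M
  -- `2 ^ A` absorbs the constants of all coordinates and `B` their exponents; the extra `1` makes
  -- the exponent positive.
  refine ⟨A + B + 1, by positivity, fun j hj => ?_⟩
  obtain ⟨i, rfl⟩ : ∃ i, j = i + 1 := ⟨j - 1, by omega⟩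
  have h1 : ‖y (i + 1)‖ ≤ ∑ l, C l * (2 ^ (i + 1)) ^ B := by
    calc ‖y (i + 1)‖ ≤ ∑ l, ‖y (i + 1) l‖ := by
          have h0 : y (i + 1) = ∑ l, EuclideanSpace.single l (y (i + 1) l) := by
            ext m
            simp [Finset.sum_apply, Pi.single_apply]
          conv_lhs => rw [h0]
          refine (norm_sum_le _ _).trans (by simp)
      _ ≤ _ := Finset.sum_le_sum fun l _ => by
          have h2 := hCM l i
          simp only [EuclideanSpace.inner_single_right, conj_trivial, one_mul] at h2
          rw [Real.norm_eq_abs]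
          refine h2.trans ?_
          have := hC l
          gcongr
          · exact one_le_pow₀ one_le_two
          · exact Finset.le_sup (Finset.mem_univ l)
  rw [← Finset.sum_mul] at h1
  have h3 : (∑ l, C l) * (2 ^ (i + 1)) ^ B ≤ (2 : ℝ) ^ ((A + B + 1) * (i + 1)) := by
    calc (∑ l, C l) * (2 ^ (i + 1)) ^ B ≤ 2 ^ A * (2 ^ (i + 1)) ^ B := by gcongr
      _ ≤ (2 ^ (i + 1)) ^ A * (2 ^ (i + 1)) ^ B := by
          gcongr
          calc (2 : ℝ) = 2 ^ 1 := (pow_one _).symm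
            _ ≤ 2 ^ (i + 1) := pow_le_pow_right₀ one_le_two (by omega)
      _ = (2 : ℝ) ^ ((A + B) * (i + 1)) := by rw [← pow_add, ← pow_mul]; congr 1; ring
      _ ≤ _ := pow_le_pow_right₀ one_le_two (Nat.mul_le_mul_right _ (by omega))
  refine (h1.trans h3).trans (le_of_eq ?_)
  rw [← Real.rpow_natCast]
  push_cast
  ring_nf

end Growth

/-! ### Uniform multiplier bounds and Nikolskii's inequality, for all `p > 0`. -/

section BandLimited

variable {n : ℕ} {φ : ℕ → 𝓢(EuclideanSpace ℝ (Fin n), ℂ)} {y : ℕ → EuclideanSpace ℝ (Fin n)}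

theorem exists_schwartz_decay (K : 𝓢(EuclideanSpace ℝ (Fin n), ℂ)) (k : ℕ) :
    ∃ A : ℝ≥0, ∀ x, ‖K x‖ ≤ A / (1 + ‖x‖) ^ k :=
  ⟨⟨_, by positivity⟩, fun x => norm_le_seminorm_div K k x⟩

theorem enorm_convFun_le_tsum {u v : 𝓢(EuclideanSpace ℝ (Fin n), ℂ)} {ι : Type*} {c : ι → ℂ}
    {a : ι → EuclideanSpace ℝ (Fin n)}
    (h : HasSum (fun i => c i • SchwartzMap.compSubConstCLM ℂ (a i) u) v)
    (f : 𝓢'(EuclideanSpace ℝ (Fin n), ℂ)) (x : EuclideanSpace ℝ (Fin n)) :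
    ‖convFun v f x‖ₑ ≤ ∑' i, ‖c i‖ₑ * ‖convFun u f (x - a i)‖ₑ := by
  have h1 := hasSum_convFun h f x
  simp_rw [convFun_smul, convFun_translate] at h1
  rw [← h1.tsum_eq]
  refine enorm_tsum_le_tsum_enorm.trans (le_of_eq ?_)
  simp_rw [enorm_mul]

theorem enorm_le_ofReal_of_norm_le {z : ℂ} {r : ℝ} (h : ‖z‖ ≤ r) : ‖z‖ₑ ≤ ENNReal.ofReal r := by
  rw [← ofReal_norm]
  exact ENNReal.ofReal_le_ofReal h

theorem norm_inv_two_pow_smul (j i : ℕ) (ξ : EuclideanSpace ℝ (Fin n)) :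
    ‖((2 ^ (j + i) : ℝ)⁻¹) • ξ‖ * 2 ^ (j + i) = ‖ξ‖ := by
  rw [norm_smul, norm_inv, Real.norm_of_nonneg (by positivity)]
  field_simp

/-- Smooth multipliers adapted to the frequency scale `2 ^ j` are bounded on band-limited functions,
uniformly in `j`, for every exponent `p > 0`. -/
theorem exists_eLpNorm_convFun_multiplier_le (m : 𝓢(EuclideanSpace ℝ (Fin n), ℂ))
    (hm : ∀ ξ, 4 ≤ ‖ξ‖ → m ξ = 0) {p : ℝ≥0∞} (hp : 0 < p) :
    ∃ C : ℝ≥0, ∀ (j : ℕ) (u v : 𝓢(EuclideanSpace ℝ (Fin n), ℂ))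
      (f : 𝓢'(EuclideanSpace ℝ (Fin n), ℂ)), (∀ ξ, 2 ^ (j + 3) ≤ ‖ξ‖ → 𝓕 u ξ = 0) →
      (∀ ξ, 𝓕 v ξ = m ((2 ^ j : ℝ)⁻¹ • ξ) * 𝓕 u ξ) →
      eLpNorm (convFun v f) p volume ≤ C * eLpNorm (convFun u f) p volume := by
  -- Dilation by `16` brings the support of `m` inside radius `1/4`, as sampling requires. With `R =
  -- 2 ^ (j + 4)` this gives `𝓕 K (R⁻¹ • ξ) = m (2 ^ (-j) • ξ)`, and `R / 2 = 2 ^ (j + 3)` is the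
  -- band of `u`.
  set K : 𝓢(EuclideanSpace ℝ (Fin n), ℂ) := 𝓕⁻ (dilate 16 (by norm_num) m) with hKdef
  have hK : ∀ ξ, 𝓕 K ξ = m ((16 : ℝ) • ξ) := by
    intro ξ
    rw [hKdef, FourierTransform.fourier_fourierInv_eq]
    rfl
  obtain ⟨k, hk⟩ := quasiConst_lattice_lt_top (n := n) hp
  obtain ⟨A, hA⟩ := exists_schwartz_decay K k
  refine ⟨(quasiConst p (fun l : Fin n → ℤ =>
    ENNReal.ofReal (A / (1 + ‖latticePt l‖) ^ k))).toNNReal, fun j u v f hu hv => ?_⟩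
  rw [ENNReal.coe_toNNReal (hk A).ne]
  have hs := hasSum_sampling K u v (R := 2 ^ (j + 4)) (one_le_pow₀ one_le_two)
    (fun ξ hξ => by
      rw [hK, hm]
      rw [norm_smul, Real.norm_of_nonneg (by norm_num)]
      linarith)
    (fun ξ hξ => hu ξ (by rw [pow_succ] at hξ; linarith))
    (fun ξ => by
      rw [hv, hK, smul_smul]
      congr 3
      rw [pow_add]
      field_simp
      norm_num)
  have hm' : ∀ a : EuclideanSpace ℝ (Fin n), eLpNorm (fun x => ‖convFun u f (x - a)‖ₑ) p volume =
      eLpNorm (convFun u f) p volume := fun a => by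
    rw [eLpNorm_enorm]
    exact eLpNorm_comp_measurePreserving (continuous_convFun u f).aestronglyMeasurable
      (measurePreserving_sub_right volume a)
  rw [← eLpNorm_enorm (convFun v f)]
  refine eLpNorm_le_quasiConst_mul hp _
    (G := fun l x => ‖convFun u f (x - (2 ^ (j + 4) : ℝ)⁻¹ • latticePt l)‖ₑ)
    (fun l => ?_) (fun x => (enorm_convFun_le_tsum hs f x).trans ?_) (fun l => (hm' _).le)
  · exact (((continuous_convFun u f).comp
      (continuous_id.sub continuous_const)).enorm).measurable.aemeasurable
  · exact ENNReal.tsum_le_tsum fun l => mul_le_mul_left (enorm_le_ofReal_of_norm_le (hA _)) _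

/-- Nikolskii's inequality: band-limited functions in `Lᵖ` are bounded. -/
theorem IsLittlewoodPaleyFamily.exists_enorm_convFun_le (hφ : IsLittlewoodPaleyFamily φ)
    {p : ℝ≥0∞} (hp : 0 < p) :
    ∃ (C : ℝ≥0), ∀ (j : ℕ) (u : 𝓢(EuclideanSpace ℝ (Fin n), ℂ))
      (f : 𝓢'(EuclideanSpace ℝ (Fin n), ℂ)), (∀ ξ, 2 ^ (j + 1) ≤ ‖ξ‖ → 𝓕 u ξ = 0) → ∀ x,
      ‖convFun u f x‖ₑ ≤ C * ENNReal.ofReal ((2 ^ (j + 4)) ^ n) ^ (1 / p).toReal *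
        eLpNorm (convFun u f) p volume := by
  -- `φ̂₀(8 ·)` vanishes beyond radius `1/4` and is `1` up to `1/8`; after rescaling by `R = 2 ^ (j
  -- + 4)` it is `1` on the whole band `‖ξ‖ ≤ 2 ^ (j + 1)`, so sampling reproduces `u`.
  set K : 𝓢(EuclideanSpace ℝ (Fin n), ℂ) := 𝓕⁻ (dilate 8 (by norm_num) (𝓕 (φ 0))) with hKdef
  have hK : ∀ ξ, 𝓕 K ξ = 𝓕 (φ 0) ((8 : ℝ) • ξ) := by
    intro ξ
    rw [hKdef, FourierTransform.fourier_fourierInv_eq]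
    rfl
  obtain ⟨k, hk⟩ := quasiConst_lattice_lt_top (n := n) hp
  obtain ⟨A, hA⟩ := exists_schwartz_decay K k
  set Q := quasiConst p (fun l : Fin n → ℤ =>
    ENNReal.ofReal ((A * 2 ^ k : ℝ≥0) / (1 + ‖latticePt l‖) ^ k)) with hQ
  have hQt : Q ≠ ∞ := (hk (A * 2 ^ k)).ne
  set μ := (volume : Measure (EuclideanSpace ℝ (Fin n))).restrict (Metric.ball 0 1) with hμ
  have hV0 : volume (Metric.ball (0 : EuclideanSpace ℝ (Fin n)) 1) ≠ 0 :=
    (Metric.measure_ball_pos volume _ one_pos).ne'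
  have hVt : volume (Metric.ball (0 : EuclideanSpace ℝ (Fin n)) 1) ≠ ∞ := measure_ball_lt_top.ne
  set V : ℝ≥0∞ := volume (Metric.ball (0 : EuclideanSpace ℝ (Fin n)) 1) ^ (1 / p.toReal) with hV
  have hV0' : V ≠ 0 := by simp [hV, ENNReal.rpow_eq_zero_iff, hV0, hVt]
  have hVt' : V ≠ ∞ := by simp [hV, ENNReal.rpow_eq_top_iff, hV0, hVt]
  refine ⟨(V⁻¹ * Q).toNNReal, fun j u f hu x => ?_⟩
  rw [ENNReal.coe_toNNReal (ENNReal.mul_ne_top (ENNReal.inv_ne_top.2 hV0') hQt)]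
  set R : ℝ := 2 ^ (j + 4) with hR
  have hR0 : 0 < R := by positivity
  set B := ENNReal.ofReal (R ^ n) ^ (1 / p).toReal * eLpNorm (convFun u f) p volume with hB
  have hmap : ∀ a : EuclideanSpace ℝ (Fin n),
      eLpNorm (fun t => ‖convFun u f (x - R⁻¹ • t - a)‖ₑ) p volume = B := by
    intro a
    rw [eLpNorm_enorm]
    have e1 : eLpNorm (fun t => convFun u f (x - t - a)) p volume =
        eLpNorm (convFun u f) p volume := by
      have := eLpNorm_comp_measurePreserving (p := p)
        (continuous_convFun u f).aestronglyMeasurable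
        ((measurePreserving_sub_right volume a).comp (Measure.measurePreserving_sub_left volume x))
      exact this
    have e2 := (Homeomorph.smulOfNeZero (R⁻¹) (inv_ne_zero hR0.ne') :
      EuclideanSpace ℝ (Fin n) ≃ₜ _).measurableEmbedding.eLpNorm_map_measure
      (μ := volume) (p := p) (g := fun t => convFun u f (x - t - a))
    have e3 : Measure.map (Homeomorph.smulOfNeZero (R⁻¹) (inv_ne_zero hR0.ne') :
        EuclideanSpace ℝ (Fin n) ≃ₜ _) volume = ENNReal.ofReal (R ^ n) •
        (volume : Measure (EuclideanSpace ℝ (Fin n))) := by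
      have := Measure.map_addHaar_smul (volume : Measure (EuclideanSpace ℝ (Fin n)))
        (inv_ne_zero hR0.ne')
      rw [finrank_euclideanSpace_fin, inv_pow, inv_inv, abs_of_pos (by positivity)] at this
      exact this
    rw [e3, eLpNorm_smul_measure_of_ne_zero (by simpa using by positivity), e1] at e2
    exact e2.symm
  have hmain : eLpNorm (fun _ : EuclideanSpace ℝ (Fin n) => ‖convFun u f x‖ₑ) p μ ≤ Q * B := by
    -- Sampling with the shifted kernel `K (· + t)` expresses the same value at `x` through a grid
    -- displaced by `t`. Averaging in `Lᵖ` over `t` in the unit ball turns point values into an `Lᵖ`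
    -- norm; the factor `2 ^ k` compares `1 + ‖l‖` with `1 + ‖l + t‖`.
    have hF : ∀ t ∈ Metric.ball (0 : EuclideanSpace ℝ (Fin n)) 1, ‖convFun u f x‖ₑ ≤
        ∑' l, ENNReal.ofReal ((A * 2 ^ k : ℝ≥0) / (1 + ‖latticePt l‖) ^ k) *
          ‖convFun u f (x - R⁻¹ • t - R⁻¹ • latticePt l)‖ₑ := by
      intro t ht
      have hs := hasSum_sampling (SchwartzMap.compSubConstCLM ℂ (-t) K) u
        (SchwartzMap.compSubConstCLM ℂ (-(R⁻¹ • t)) u) (R := R) (one_le_pow₀ one_le_two)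
        (fun ξ hξ => by
          rw [fourier_translate, hK, hφ.fourier_zero_eq_zero, mul_zero]
          rw [norm_smul, Real.norm_of_nonneg (by norm_num)]
          linarith)
        (fun ξ hξ => hu ξ (le_trans (by
          rw [hR, pow_add, pow_add]
          have : (0 : ℝ) < 2 ^ j := by positivity
          linarith) hξ))
        (fun ξ => by
          rw [fourier_translate, fourier_translate, inner_smul_right, inner_neg_left,
            inner_neg_left, inner_smul_left, conj_trivial, ← mul_neg]
          by_cases hξ : 2 ^ (j + 1) ≤ ‖ξ‖
          · rw [hu ξ hξ, mul_zero, mul_zero]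
          · push Not at hξ
            rw [hK, hφ.fourier_zero_eq_one, mul_one]
            · have := norm_inv_two_pow_smul j 4 ξ
              rw [norm_smul, Real.norm_of_nonneg (by norm_num)]
              rw [hR]
              generalize ‖((2 ^ (j + 4) : ℝ)⁻¹) • ξ‖ = N at this ⊢
              rw [← this, pow_add, pow_add] at hξ
              have h2 : (0 : ℝ) < 2 ^ j := by positivity
              by_contra! hcon
              nlinarith)
      have h1 := enorm_convFun_le_tsum hs f (x - R⁻¹ • t)
      rw [convFun_translate, sub_neg_eq_add, sub_add_cancel] at h1
      refine h1.trans (ENNReal.tsum_le_tsum fun l => mul_le_mul_left ?_ _)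
      refine enorm_le_ofReal_of_norm_le ?_
      rw [SchwartzMap.compSubConstCLM_apply, sub_neg_eq_add]
      refine (hA _).trans ?_
      have ht1 : ‖t‖ ≤ 1 := (mem_ball_zero_iff.1 ht).le
      have h3 : 1 + ‖latticePt l‖ ≤ 2 * (1 + ‖latticePt l + t‖) := by
        have := norm_sub_le (latticePt l + t) t
        rw [add_sub_cancel_right] at this
        have := norm_nonneg (latticePt l + t)
        linarith
      rw [div_le_div_iff₀ (by positivity) (by positivity)]
      push_cast
      calc (A : ℝ) * (1 + ‖latticePt l‖) ^ k ≤ A * (2 * (1 + ‖latticePt l + t‖)) ^ k := by gcongr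
        _ = _ := by rw [mul_pow]; ring
    have hind : eLpNorm (fun _ : EuclideanSpace ℝ (Fin n) => ‖convFun u f x‖ₑ) p μ =
        eLpNorm ((Metric.ball (0 : EuclideanSpace ℝ (Fin n)) 1).indicator
          fun _ => ‖convFun u f x‖ₑ) p μ := by
      refine eLpNorm_congr_ae ?_
      filter_upwards [ae_restrict_mem Metric.isOpen_ball.measurableSet] with t ht
      rw [indicator_of_mem ht]
    rw [hind]
    refine eLpNorm_le_quasiConst_mul hp _
      (G := fun l t => ‖convFun u f (x - R⁻¹ • t - R⁻¹ • latticePt l)‖ₑ)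
      (fun l => ?_) (fun t => ?_) (fun l => ?_)
    · have : Continuous fun t => ‖convFun u f (x - R⁻¹ • t - R⁻¹ • latticePt l)‖ₑ :=
        ((continuous_convFun u f).comp (by fun_prop)).enorm
      exact this.measurable.aemeasurable
    · by_cases ht : t ∈ Metric.ball (0 : EuclideanSpace ℝ (Fin n)) 1
      · rw [indicator_of_mem ht]
        exact hF t ht
      · rw [indicator_of_notMem ht]
        exact zero_le
    · exact (eLpNorm_mono_measure _ Measure.restrict_le_self).trans (hmap _).le
  rw [eLpNorm_const _ hp.ne' (by simpa [hμ, Measure.restrict_eq_zero] using hV0), hμ,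
    Measure.restrict_apply_univ, ← hV, enorm_enorm, mul_comm] at hmain
  calc ‖convFun u f x‖ₑ = V⁻¹ * (V * ‖convFun u f x‖ₑ) := by
        rw [← mul_assoc, ENNReal.inv_mul_cancel hV0' hVt', one_mul]
    _ ≤ V⁻¹ * (Q * B) := by gcongr
    _ = _ := by rw [hB]; ring

end BandLimited

/-! ### Convergence of the series when the pieces grow at most exponentially. -/

section Besov

variable {n : ℕ} {φ : ℕ → 𝓢(EuclideanSpace ℝ (Fin n), ℂ)} {y : ℕ → EuclideanSpace ℝ (Fin n)}

theorem apply_translate_translate_reflect (u : 𝓢(EuclideanSpace ℝ (Fin n), ℂ))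
    (f : 𝓢'(EuclideanSpace ℝ (Fin n), ℂ)) (a y : EuclideanSpace ℝ (Fin n)) :
    f (SchwartzMap.compSubConstCLM ℂ a (SchwartzMap.compSubConstCLM ℂ (-y) (reflect u))) =
      convFun u f (a - y) := by
  rw [convFun]
  congr 1
  ext x
  simp only [SchwartzMap.compSubConstCLM_apply]
  congr 1
  abel

/-- The sampling kernel at `R = 2 ^ (j + 4)` for the multiplier `m (2 ^ (-j) • ξ) ĝ(ξ)`. Rescaling
by `R` costs `R ^ l` in the seminorms with `l` derivatives, which is why the localisation estimate
is invoked with exponent `M + l`. -/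
theorem exists_kernel_decay (m g : 𝓢(EuclideanSpace ℝ (Fin n), ℂ))
    (hm : ∀ ξ, ‖ξ‖ < 1 / 4 → m ξ = 0) (M k : ℕ) :
    ∃ (D : ℝ), 0 ≤ D ∧ ∀ j : ℕ, ∃ K : 𝓢(EuclideanSpace ℝ (Fin n), ℂ),
      (∀ η, 𝓕 K η = m ((16 : ℝ) • η) * 𝓕 g ((2 ^ (j + 4) : ℝ) • η)) ∧
      ∀ x, ‖K x‖ ≤ D * ((2 ^ j : ℝ)⁻¹) ^ M / (1 + ‖x‖) ^ k := by
  set w : ℕ → 𝓢(EuclideanSpace ℝ (Fin n), ℂ) := fun j =>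
    dilateMul ((2 ^ j : ℝ)⁻¹) (by positivity) m (𝓕 g) with hw
  set W : ℕ → 𝓢(EuclideanSpace ℝ (Fin n), ℂ) := fun j =>
    dilate (2 ^ (j + 4)) (by positivity) (w j) with hW
  have hWb : ∀ k l, ∃ C, 0 ≤ C ∧ ∀ j, SchwartzMap.seminorm ℂ k l (W j) ≤
      C * ((2 ^ j : ℝ)⁻¹) ^ M := by
    intro k l
    obtain ⟨C, hC, h⟩ := seminorm_localised_le m (𝓕 g) (ρ := 1 / 4) (by norm_num) hm w 0
      (fun j _ ξ => rfl) (M + l) k l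
    refine ⟨16 ^ l * C, by positivity, fun j => ?_⟩
    have h1 := seminorm_comp_smul_le (w j) (W j) (R := 2 ^ (j + 4)) (one_le_pow₀ one_le_two)
      (fun x => rfl) k l
    refine h1.trans ((mul_le_mul_of_nonneg_left (h j (Nat.zero_le _)) (by positivity)).trans
      (le_of_eq ?_))
    rw [pow_add, pow_add, mul_pow, inv_pow, inv_pow]
    field_simp
    rw [mul_comm]
    norm_num
  have hmap := seminorm_family_bound_map
    (FourierTransform.fourierInvCLM ℂ 𝓢(EuclideanSpace ℝ (Fin n), ℂ)) W _ hWb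
  obtain ⟨C₀, hC₀, h₀⟩ := hmap 0 0
  obtain ⟨C₁, hC₁, h₁⟩ := hmap k 0
  refine ⟨2 ^ k * (C₀ + C₁), by positivity, fun j => ⟨𝓕⁻ (W j), fun η => ?_, fun x => ?_⟩⟩
  · rw [FourierTransform.fourier_fourierInv_eq]
    change m ((2 ^ j : ℝ)⁻¹ • (2 ^ (j + 4) : ℝ) • η) * 𝓕 g ((2 ^ (j + 4) : ℝ) • η) = _
    rw [smul_smul]
    congr 3
    rw [pow_add]
    field_simp
    norm_num
  · refine (norm_le_seminorm_div _ k x).trans ?_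
    refine div_le_div_of_nonneg_right ?_ (by positivity)
    calc _ ≤ 2 ^ k * (C₀ * ((2 ^ j : ℝ)⁻¹) ^ M + C₁ * ((2 ^ j : ℝ)⁻¹) ^ M) := by
          gcongr
          · exact h₀ j
          · exact h₁ j
      _ = _ := by ring

/-- A distribution whose Littlewood–Paley pieces are bounded functions of at most exponential
growth belongs to the domain of `T`, whatever the translations. -/
theorem IsLittlewoodPaleyFamily.mem_domain_of_growth (hφ : IsLittlewoodPaleyFamily φ)
    {f : 𝓢'(EuclideanSpace ℝ (Fin n), ℂ)} {B : ℝ} {N : ℕ}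
    (hf : ∀ j x, ‖convFun (φ j) f x‖ ≤ B * (2 ^ j) ^ N) : f ∈ (shiftedSum φ y).domain := by
  refine mem_domain_of_summable f fun g => ?_
  -- An annular cutoff equal to `1` on `1/2 ≤ ‖ξ‖ ≤ 2`, where `φ̂ⱼ(2ʲ ξ)` lives; inserting it leaves
  -- `φ̂ⱼ` unchanged and localises `ĝ` at frequency `2 ^ j`.
  set m : 𝓢(EuclideanSpace ℝ (Fin n), ℂ) := dilate (1 / 2) (by norm_num) (𝓕 (φ 0)) -
    dilate 4 (by norm_num) (𝓕 (φ 0)) with hmdef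
  have hm : ∀ ξ, m ξ = 𝓕 (φ 0) ((1 / 2 : ℝ) • ξ) - 𝓕 (φ 0) ((4 : ℝ) • ξ) := fun ξ => rfl
  have hn2 : ∀ ξ : EuclideanSpace ℝ (Fin n), ‖(1 / 2 : ℝ) • ξ‖ = 1 / 2 * ‖ξ‖ := fun ξ => by
    rw [norm_smul, Real.norm_of_nonneg (by norm_num)]
  have hn4 : ∀ ξ : EuclideanSpace ℝ (Fin n), ‖(4 : ℝ) • ξ‖ = 4 * ‖ξ‖ := fun ξ => by
    rw [norm_smul, Real.norm_of_nonneg (by norm_num)]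
  have hm0 : ∀ ξ, ‖ξ‖ < 1 / 4 → m ξ = 0 := fun ξ hξ => by
    rw [hm, hφ.fourier_zero_eq_one (by rw [hn2]; linarith),
      hφ.fourier_zero_eq_one (by rw [hn4]; linarith), sub_self]
  have hm4 : ∀ ξ, 4 ≤ ‖ξ‖ → m ξ = 0 := fun ξ hξ => by
    rw [hm, hφ.fourier_zero_eq_zero (by rw [hn2]; linarith),
      hφ.fourier_zero_eq_zero (by rw [hn4]; linarith), sub_self]
  have hm1 : ∀ ξ, 1 / 2 ≤ ‖ξ‖ → ‖ξ‖ ≤ 2 → m ξ = 1 := fun ξ hξ hξ' => by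
    rw [hm, hφ.fourier_zero_eq_one (by rw [hn2]; linarith),
      hφ.fourier_zero_eq_zero (by rw [hn4]; linarith), sub_zero]
  obtain ⟨D, hD, hK⟩ := exists_kernel_decay m g hm0 (N + 1) (n + 1)
  have hB : 0 ≤ B := by
    have := (norm_nonneg _).trans (hf 0 0)
    simpa using this
  set S : ℝ := ∑' l : Fin n → ℤ, 1 / (1 + ‖latticePt l‖) ^ (n + 1) with hS
  have hSs := summable_lattice (n := n) (k := n + 1) (by omega)
  have hbound : ∀ j, 1 ≤ j → ‖f (dualTest (φ j) (y j) g)‖ ≤ D * B * S * (1 / 2) ^ j := by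
    intro j hj
    obtain ⟨K, hKF, hKx⟩ := hK j
    have hnorm : ∀ ξ : EuclideanSpace ℝ (Fin n),
        ‖(2 ^ j : ℝ)⁻¹ • ξ‖ = (2 ^ j : ℝ)⁻¹ * ‖ξ‖ := fun ξ => by
      rw [norm_smul, Real.norm_of_nonneg (by positivity)]
    -- Here `g` is moved into the kernel and `φ j` is the function being translated. Hence `f` of
    -- the test function is a sum of values of `φ j ∗ f` at points shifted by `y j`, and the uniform
    -- bound does not notice the shift. The kernel decay `2 ^ (-j * (N + 1))` beats the growth `2 ^
    -- (j * N)`.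
    have hs := hasSum_sampling K (SchwartzMap.compSubConstCLM ℂ (-(y j)) (reflect (φ j)))
      (dualTest (φ j) (y j) g) (R := 2 ^ (j + 4)) (one_le_pow₀ one_le_two)
      (fun ξ hξ => by
        rw [hKF, hm4, zero_mul]
        rw [norm_smul, Real.norm_of_nonneg (by norm_num)]
        linarith)
      (fun ξ hξ => by
        rw [fourier_translate, fourier_reflect, hφ.fourier_eq_zero_of_ge, mul_zero]
        rw [norm_neg]
        refine le_trans ?_ hξ
        rw [pow_add, pow_add]
        have : (0 : ℝ) < 2 ^ j := by positivity
        linarith)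
      (fun ξ => by
        rw [hKF, fourier_dualTest, fourier_translate, fourier_reflect, inner_neg_left,
          smul_inv_smul₀ (by positivity), smul_smul, neg_mul, neg_mul, mul_neg, neg_neg]
        have e : (16 : ℝ) * (2 ^ (j + 4))⁻¹ = (2 ^ j : ℝ)⁻¹ := by
          rw [pow_add]
          field_simp
          norm_num
        rw [e]
        by_cases h1 : 𝓕 (φ j) (-ξ) = 0
        · rw [h1]; ring
        · rw [hm1]
          · ring
          · rw [hnorm, le_inv_mul_iff₀ (by positivity)]
            by_contra! hcon
            exact h1 (hφ.fourier_eq_zero_of_le hj (by rw [norm_neg]; linarith))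
          · rw [hnorm, inv_mul_le_iff₀ (by positivity)]
            by_contra! hcon
            exact h1 (hφ.fourier_eq_zero_of_ge j (by rw [norm_neg, pow_succ]; linarith)))
    have hs' := hs.mapL (⟨f.toLinearMap, map_continuous f⟩ : 𝓢(EuclideanSpace ℝ (Fin n), ℂ) →L[ℂ] ℂ)
    refine hs'.norm_le_of_bounded (hSs.hasSum.mul_left (D * B * (1 / 2) ^ j)) (fun l => ?_)
      |>.trans (le_of_eq (by ring))
    rw [map_smul, smul_eq_mul, norm_mul]
    change _ * ‖f _‖ ≤ _
    rw [apply_translate_translate_reflect]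
    calc _ ≤ D * ((2 ^ j : ℝ)⁻¹) ^ (N + 1) / (1 + ‖latticePt l‖) ^ (n + 1) * (B * (2 ^ j) ^ N) := by
          gcongr
          · exact hKx _
          · exact hf j _
      _ = _ := by
          rw [pow_succ, inv_pow (2 ^ j : ℝ) N, one_div (2 : ℝ), inv_pow 2 j]
          field_simp
  refine Summable.of_norm_bounded (((summable_geometric_of_lt_one (r := (1 / 2 : ℝ)) (by norm_num)
    (by norm_num)).mul_left (D * B * S)).comp_injective (add_left_injective 1)) fun j => ?_
  exact hbound (j + 1) (by omega)

end Besov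

/-! ### Boundedness on Besov spaces. -/

section BesovBound

variable {n : ℕ} {φ : ℕ → 𝓢(EuclideanSpace ℝ (Fin n), ℂ)} {y : ℕ → EuclideanSpace ℝ (Fin n)}

theorem le_eLpNorm_count {q : ℝ≥0∞} (hq : 0 < q) (γ : ℕ → ℝ≥0∞) (j : ℕ) :
    γ j ≤ eLpNorm γ q Measure.count := by
  rcases eq_or_ne q ∞ with rfl | hqt
  · rw [eLpNorm_exponent_top]
    have h := Measure.ae_count_iff.1 (ae_le_eLpNormEssSup (f := γ) (μ := Measure.count)) j
    rwa [enorm_eq_self] at h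
  · have hq0 := ENNReal.toReal_pos hq.ne' hqt
    rw [eLpNorm_eq_lintegral_rpow_enorm_toReal hq.ne' hqt, lintegral_count, one_div]
    rw [ENNReal.le_rpow_inv_iff hq0]
    simp_rw [enorm_eq_self]
    exact ENNReal.le_tsum (f := fun i => γ i ^ q.toReal) j

/-- Used with the shifts `k ↦ k + i - 1`, whose truncated subtraction is injective only where the
predicate holds. -/
theorem eLpNorm_count_comp_le {q : ℝ≥0∞} (hq : 0 < q) (γ : ℕ → ℝ≥0∞) (P : ℕ → Prop)
    [DecidablePred P] (σ : ℕ → ℕ) (hσ : ∀ i j, P i → P j → σ i = σ j → i = j) :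
    eLpNorm (fun j => if P j then γ (σ j) else 0) q Measure.count ≤
      eLpNorm γ q Measure.count := by
  rcases eq_or_ne q ∞ with rfl | hqt
  · rw [eLpNorm_exponent_top (f := fun j => if P j then γ (σ j) else 0)]
    refine essSup_le_of_ae_le _ (Measure.ae_count_iff.2 fun j => ?_)
    simp only [enorm_eq_self]
    split_ifs
    · exact le_eLpNorm_count hq γ _
    · exact zero_le
  · have hq0 := ENNReal.toReal_pos hq.ne' hqt
    rw [eLpNorm_eq_lintegral_rpow_enorm_toReal hq.ne' hqt,
      eLpNorm_eq_lintegral_rpow_enorm_toReal hq.ne' hqt, lintegral_count, lintegral_count]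
    refine ENNReal.rpow_le_rpow ?_ (by positivity)
    simp_rw [enorm_eq_self]
    have h1 := tsum_subtype {j | P j} fun j => (γ (σ j)) ^ q.toReal
    have h2 : ∀ j, (if P j then γ (σ j) else 0) ^ q.toReal =
        {j | P j}.indicator (fun j => (γ (σ j)) ^ q.toReal) j := by
      intro j
      by_cases hj : P j
      · rw [if_pos hj, indicator_of_mem (by exact hj)]
      · rw [if_neg hj, indicator_of_notMem (by exact hj), ENNReal.zero_rpow_of_pos hq0]
    simp_rw [h2]
    rw [← h1]
    exact ENNReal.tsum_comp_le_tsum_of_injective (f := fun j : {j | P j} => σ j)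
      (fun i j h => Subtype.ext (hσ i j i.2 j.2 h)) fun j => γ j ^ q.toReal

/-- The series index `j` stands for the piece `j + 1`, so the neighbours `k - 1, k, k + 1` of `k`
are `j = k + i - 2` with `i = 0, 1, 2`. The condition `2 ≤ k + i` drops pieces of index below `1`,
which do not occur in `T`. -/
theorem hasSum_near_diagonal (k : ℕ) (a : ℕ → ℂ) (h1 : ∀ j, j + 2 < k → a j = 0)
    (h2 : ∀ j, k < j → a j = 0) :
    HasSum a (∑ i : Fin 3, if 2 ≤ k + i then a (k + i - 2) else 0) := by
  have h := hasSum_sum_of_ne_finset_zero (f := a) (s := Finset.Icc (k - 2) k) (L := .unconditional ℕ) (fun j hj => by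
    rw [Finset.mem_Icc, not_and_or] at hj
    rcases hj with hj | hj
    · exact h1 j (by omega)
    · exact h2 j (by omega))
  convert h using 1
  rw [Fin.sum_univ_three]
  rcases k with _ | _ | k
  · simp
  · simp [Finset.sum_Icc_succ_top]
  · have e : Finset.Icc (k + 1 + 1 - 2) (k + 1 + 1) = {k, k + 1, k + 2} := by
      ext; simp only [Finset.mem_Icc, Finset.mem_insert, Finset.mem_singleton]; omega
    rw [e, Finset.sum_insert (by simp), Finset.sum_insert (by simp), Finset.sum_singleton]
    simp [add_assoc]

/-- The Littlewood–Paley pieces of `T f` are finite sums of translated pieces of `f`. -/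
theorem IsLittlewoodPaleyFamily.convFun_shiftedSum (hφ : IsLittlewoodPaleyFamily φ)
    (f : (shiftedSum φ y).domain) (k : ℕ) (x : EuclideanSpace ℝ (Fin n)) :
    convFun (φ k) (shiftedSum φ y f) x = ∑ i : Fin 3, if 2 ≤ k + i then
      convFun (SchwartzMap.convolution (ContinuousLinearMap.mul ℂ ℂ) (φ k) (φ (k + i - 1))) f
        (x - y (k + i - 1)) else 0 := by
  have hzero : ∀ j, (j + 3 ≤ k ∨ k < j) → SchwartzMap.convolution (ContinuousLinearMap.mul ℂ ℂ)
      (φ k) (φ (j + 1)) = 0 := by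
    intro j hj
    refine schwartz_ext_fourier fun ξ => ?_
    have e : 𝓕 (0 : 𝓢(EuclideanSpace ℝ (Fin n), ℂ)) ξ = 0 := by
      rw [show 𝓕 (0 : 𝓢(EuclideanSpace ℝ (Fin n), ℂ)) = 0 from
        map_zero (FourierTransform.fourierCLM ℂ 𝓢(EuclideanSpace ℝ (Fin n), ℂ))]
      rfl
    rw [fourier_convolution_mul, e]
    rcases hj with hj | hj
    · rw [mul_comm]; exact hφ.fourier_mul_eq_zero (by omega) ξ
    · exact hφ.fourier_mul_eq_zero (by omega) ξ
  have hterm : ∀ j, (f : 𝓢'(EuclideanSpace ℝ (Fin n), ℂ)) (dualTest (φ (j + 1)) (y (j + 1))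
      (SchwartzMap.compSubConstCLM ℂ x (reflect (φ k)))) =
      convFun (SchwartzMap.convolution (ContinuousLinearMap.mul ℂ ℂ) (φ k) (φ (j + 1))) f
        (x - y (j + 1)) := fun j => by
    rw [dualTest_translate_reflect, convFun]
  have hs := hasSum_near_diagonal k (fun j =>
    convFun (SchwartzMap.convolution (ContinuousLinearMap.mul ℂ ℂ) (φ k) (φ (j + 1))) f
        (x - y (j + 1)))
    (fun j hj => by rw [hzero j (Or.inl (by omega)), convFun_zero])
    (fun j hj => by rw [hzero j (Or.inr (by omega)), convFun_zero])
  simp_rw [← hterm] at hs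
  have h := shiftedSum_apply_eq f _ hs
  rw [convFun, h]
  refine Finset.sum_congr rfl fun i _ => ?_
  split_ifs with hi
  · rw [hterm, show k + (i : ℕ) - 2 + 1 = k + i - 1 by omega]
  · rfl

theorem eLpNorm_piece (s : ℝ) (p : ℝ≥0∞) (f : 𝓢'(EuclideanSpace ℝ (Fin n), ℂ)) (j : ℕ) :
    eLpNorm (fun x => piece φ s f j x) p volume =
      ENNReal.ofReal ((2 : ℝ) ^ ((j : ℝ) * s)) * eLpNorm (convFun (φ j) f) p volume := by
  have := eLpNorm_const_smul ((2 : ℝ) ^ ((j : ℝ) * s)) (convFun (φ j) f) p volume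
  rw [Real.enorm_of_nonneg (by positivity)] at this
  exact this

theorem ofReal_two_rpow_mul_le (s : ℝ) {k l : ℕ} (h1 : k ≤ l + 1) (h2 : l ≤ k + 1) :
    ENNReal.ofReal ((2 : ℝ) ^ ((k : ℝ) * s)) ≤
      ENNReal.ofReal (2 ^ |s|) * ENNReal.ofReal ((2 : ℝ) ^ ((l : ℝ) * s)) := by
  rw [← ENNReal.ofReal_mul (by positivity), ← Real.rpow_add two_pos]
  refine ENNReal.ofReal_le_ofReal (Real.rpow_le_rpow_of_exponent_le one_le_two ?_)
  have h3 : |(k : ℝ) - l| ≤ 1 := by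
    rw [abs_le]
    have : (k : ℝ) ≤ l + 1 := by exact_mod_cast h1
    have : (l : ℝ) ≤ k + 1 := by exact_mod_cast h2
    constructor <;> linarith
  have h4 : ((k : ℝ) - l) * s ≤ 1 * |s| := (le_abs_self _).trans (by rw [abs_mul]; gcongr)
  linarith

theorem quasiConst_fintype_lt_top {ι : Type*} [Fintype ι] (p : ℝ≥0∞) {w : ι → ℝ≥0∞}
    (hw : ∀ i, w i ≠ ∞) : quasiConst p w < ∞ := by
  rw [quasiConst, tsum_fintype, tsum_fintype]
  split_ifs
  · exact ENNReal.sum_lt_top.2 fun i _ => (hw i).lt_top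
  · refine ENNReal.rpow_lt_top_of_nonneg (by positivity) (ENNReal.sum_lt_top.2 fun i _ => ?_).ne
    exact ENNReal.rpow_lt_top_of_nonneg (by positivity) (hw i)

/-- Translation invariance of `Lᵖ` removes the shifts, and the multiplier bound removes the extra
convolution with `φ k`. Only two profiles occur, `φ̂₀` for `k = 0` and `profile φ` for `k ≥ 1`, so
the constant is uniform in `k`. -/
theorem IsLittlewoodPaleyFamily.exists_eLpNorm_piece_shiftedSum_le
    (hφ : IsLittlewoodPaleyFamily φ) (s : ℝ) {p : ℝ≥0∞} (hp : 0 < p) :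
    ∃ C : ℝ≥0, ∀ (f : (shiftedSum φ y).domain) (k : ℕ),
      eLpNorm (fun x => piece φ s (shiftedSum φ y f) k x) p volume ≤
        ∑ i : Fin 3, C * if 2 ≤ k + i then
          eLpNorm (fun x => piece φ s f (k + i - 1) x) p volume else 0 := by
  obtain ⟨C₀, h₀⟩ := exists_eLpNorm_convFun_multiplier_le (𝓕 (φ 0))
    (fun ξ hξ => hφ.fourier_zero_eq_zero (by linarith)) hp
  obtain ⟨C₁, h₁⟩ := exists_eLpNorm_convFun_multiplier_le (profile φ)
    (fun ξ hξ => hφ.profile_eq_zero_of_ge (by linarith)) hp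
  have hconv : ∀ (f : 𝓢'(EuclideanSpace ℝ (Fin n), ℂ)) (k l : ℕ), l ≤ k + 1 →
      eLpNorm (convFun (SchwartzMap.convolution (ContinuousLinearMap.mul ℂ ℂ) (φ k) (φ l)) f) p
        volume ≤ (C₀ + C₁ : ℝ≥0) * eLpNorm (convFun (φ l) f) p volume := by
    intro f k l hl
    have hu : ∀ ξ : EuclideanSpace ℝ (Fin n), 2 ^ (k + 3) ≤ ‖ξ‖ → 𝓕 (φ l) ξ = 0 := fun ξ hξ =>
      hφ.fourier_eq_zero_of_ge l (le_trans (pow_le_pow_right₀ one_le_two (by omega)) hξ)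
    rcases Nat.eq_zero_or_pos k with rfl | hk
    · refine (h₀ 0 (φ l) _ f hu fun ξ => ?_).trans ?_
      · rw [fourier_convolution_mul]; simp
      · gcongr; exact le_self_add
    · refine (h₁ k (φ l) _ f hu fun ξ => ?_).trans ?_
      · rw [fourier_convolution_mul, hφ.fourier_eq_profile hk]
      · gcongr; exact le_add_self
  set Q := quasiConst p (fun _ : Fin 3 => (1 : ℝ≥0∞)) with hQ
  have hQt : Q ≠ ∞ := (quasiConst_fintype_lt_top p fun _ => ENNReal.one_ne_top).ne
  set D : ℝ≥0∞ := Q * (ENNReal.ofReal (2 ^ |s|) * (C₀ + C₁ : ℝ≥0)) with hD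
  have hDt : D ≠ ∞ := ENNReal.mul_ne_top hQt
    (ENNReal.mul_ne_top ENNReal.ofReal_ne_top ENNReal.coe_ne_top)
  refine ⟨D.toNNReal, fun f k => ?_⟩
  rw [ENNReal.coe_toNNReal hDt, eLpNorm_piece]
  set G : Fin 3 → EuclideanSpace ℝ (Fin n) → ℝ≥0∞ := fun i x => if 2 ≤ k + i then
    ‖convFun (SchwartzMap.convolution (ContinuousLinearMap.mul ℂ ℂ) (φ k) (φ (k + i - 1))) f
        (x - y (k + i - 1))‖ₑ else 0 with hG
  have hGn : ∀ i : Fin 3, eLpNorm (G i) p volume ≤ (C₀ + C₁ : ℝ≥0) * if 2 ≤ k + i then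
      eLpNorm (convFun (φ (k + i - 1)) f) p volume else 0 := by
    intro i
    by_cases hi : 2 ≤ k + (i : ℕ)
    · simp only [hG, hi, if_true]
      rw [eLpNorm_enorm]
      refine le_trans (le_of_eq ?_) (hconv f k (k + i - 1) (by omega))
      exact eLpNorm_comp_measurePreserving (continuous_convFun _ _).aestronglyMeasurable
        (measurePreserving_sub_right volume _)
    · simp only [hG, hi, if_false]
      simp
  have hmain : eLpNorm (convFun (φ k) (shiftedSum φ y f)) p volume ≤
      Q * ∑ i : Fin 3, eLpNorm (G i) p volume := by
    rw [← eLpNorm_enorm]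
    refine eLpNorm_le_quasiConst_mul hp _ (G := G) (fun i => ?_) (fun x => ?_) (fun i => ?_)
    · by_cases hi : 2 ≤ k + (i : ℕ)
      · simp only [hG, hi, if_true]
        exact ((continuous_convFun _ _).comp
          (continuous_id.sub continuous_const)).enorm.measurable.aemeasurable
      · simp only [hG, hi, if_false]
        exact aemeasurable_const
    · rw [hφ.convFun_shiftedSum, tsum_fintype]
      refine (enorm_sum_le _ _).trans (Finset.sum_le_sum fun i _ => ?_)
      rw [one_mul]
      simp only [hG]
      split_ifs <;> simp
    · exact Finset.single_le_sum (f := fun i => eLpNorm (G i) p volume) (fun _ _ => zero_le)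
        (Finset.mem_univ i)
  refine (mul_le_mul_right hmain _).trans ?_
  rw [Finset.mul_sum, Finset.mul_sum]
  refine Finset.sum_le_sum fun i _ => ?_
  by_cases hi : 2 ≤ k + (i : ℕ)
  · have h3 := hGn i
    rw [if_pos hi] at h3 ⊢
    rw [eLpNorm_piece]
    calc _ ≤ ENNReal.ofReal (2 ^ |s|) * ENNReal.ofReal ((2 : ℝ) ^ (((k + i - 1 : ℕ) : ℝ) * s)) *
          (Q * ((C₀ + C₁ : ℝ≥0) * eLpNorm (convFun (φ (k + i - 1)) f) p volume)) := by
          gcongr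
          exact ofReal_two_rpow_mul_le s (by omega) (by omega)
      _ = _ := by rw [hD]; ring
  · have h3 := hGn i
    rw [if_neg hi, mul_zero] at h3
    rw [nonpos_iff_eq_zero.1 h3]
    simp

/-- Nikolskii's inequality converts `Lᵖ` control of each piece into a supremum bound, losing powers
of `2 ^ j` from `n / p` and `|s|` that the domain criterion tolerates. -/
theorem IsLittlewoodPaleyFamily.mem_domain_of_mem_besovSpace (hφ : IsLittlewoodPaleyFamily φ)
    {s : ℝ} {p q : ℝ≥0∞} (hp : 0 < p) (hq : 0 < q) {f : 𝓢'(EuclideanSpace ℝ (Fin n), ℂ)}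
    (hf : f ∈ besovSpace φ s p q) : f ∈ (shiftedSum φ y).domain := by
  obtain ⟨C, hC⟩ := hφ.exists_enorm_convFun_le hp
  obtain ⟨N₁, hN₁⟩ := exists_nat_ge |s|
  obtain ⟨N₂, hN₂⟩ := exists_nat_ge (1 / p).toReal
  have hft : besovNorm φ s p q f ≠ ∞ := LT.lt.ne hf
  set B := (besovNorm φ s p q f).toReal with hB
  refine hφ.mem_domain_of_growth (B := C * (16 ^ n) ^ N₂ * B) (N := n * N₂ + N₁) fun j x => ?_
  have h1 : eLpNorm (convFun (φ j) f) p volume ≤ ENNReal.ofReal ((2 ^ j) ^ N₁ * B) := by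
    have h2 := le_eLpNorm_count hq (fun j => eLpNorm (fun x => piece φ s f j x) p volume) j
    change _ ≤ besovNorm φ s p q f at h2
    rw [eLpNorm_piece, ← ENNReal.ofReal_toReal hft, ← hB] at h2
    have h3 : (1 : ℝ≥0∞) ≤
        ENNReal.ofReal ((2 ^ j) ^ N₁) * ENNReal.ofReal ((2 : ℝ) ^ ((j : ℝ) * s)) := by
      rw [← ENNReal.ofReal_mul (by positivity), ← pow_mul, ← Real.rpow_natCast,
        ← Real.rpow_add two_pos, ENNReal.one_le_ofReal]
      refine Real.one_le_rpow one_le_two ?_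
      push_cast
      rw [← mul_add]
      have := neg_abs_le s
      exact mul_nonneg (Nat.cast_nonneg _) (by linarith)
    calc eLpNorm (convFun (φ j) f) p volume = 1 * eLpNorm (convFun (φ j) f) p volume :=
          (one_mul _).symm
      _ ≤ ENNReal.ofReal ((2 ^ j) ^ N₁) * ENNReal.ofReal ((2 : ℝ) ^ ((j : ℝ) * s)) *
          eLpNorm (convFun (φ j) f) p volume := by gcongr
      _ ≤ ENNReal.ofReal ((2 ^ j) ^ N₁) * ENNReal.ofReal B := by rw [mul_assoc]; gcongr
      _ = _ := by rw [ENNReal.ofReal_mul (by positivity)]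
  have h2 := hC j (φ j) f (fun ξ hξ => hφ.fourier_eq_zero_of_ge j hξ) x
  have h3 : ENNReal.ofReal ((2 ^ (j + 4)) ^ n) ^ (1 / p).toReal ≤
      ENNReal.ofReal (((2 ^ (j + 4)) ^ n) ^ N₂) := by
    have h4 : (1 : ℝ) ≤ (2 ^ (j + 4)) ^ n := one_le_pow₀ (one_le_pow₀ one_le_two)
    rw [ENNReal.ofReal_rpow_of_nonneg (by positivity) ENNReal.toReal_nonneg,
      ← Real.rpow_natCast _ N₂]
    exact ENNReal.ofReal_le_ofReal (Real.rpow_le_rpow_of_exponent_le h4 hN₂)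
  have h5 : ‖convFun (φ j) f x‖ₑ ≤ ENNReal.ofReal
      (C * (16 ^ n) ^ N₂ * B * (2 ^ j) ^ (n * N₂ + N₁)) := by
    calc _ ≤ (C : ℝ≥0∞) * ENNReal.ofReal (((2 ^ (j + 4)) ^ n) ^ N₂) *
          ENNReal.ofReal ((2 ^ j) ^ N₁ * B) := h2.trans (by gcongr)
      _ = _ := by
          rw [← ENNReal.ofReal_coe_nnreal, ← ENNReal.ofReal_mul (by positivity),
            ← ENNReal.ofReal_mul (by positivity)]
          congr 1
          rw [pow_add 2 j 4, mul_pow, mul_pow, pow_add, pow_mul]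
          norm_num
          ring
  rw [← ofReal_norm] at h5
  exact (ENNReal.ofReal_le_ofReal_iff (by positivity)).1 h5

/-- `T` is bounded on every Besov space. -/
theorem IsLittlewoodPaleyFamily.exists_besovNorm_shiftedSum_le (hφ : IsLittlewoodPaleyFamily φ)
    (s : ℝ) {p q : ℝ≥0∞} (hp : 0 < p) (hq : 0 < q) :
    ∃ C : ℝ≥0, ∀ f ∈ besovSpace φ s p q, ∃ hf : f ∈ (shiftedSum φ y).domain,
      besovNorm φ s p q (shiftedSum φ y ⟨f, hf⟩) ≤ C * besovNorm φ s p q f := by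
  obtain ⟨C, hC⟩ := hφ.exists_eLpNorm_piece_shiftedSum_le (y := y) s hp
  set Q := quasiConst q (fun _ : Fin 3 => (C : ℝ≥0∞)) with hQ
  have hQt : Q ≠ ∞ := (quasiConst_fintype_lt_top q fun _ => ENNReal.coe_ne_top).ne
  refine ⟨Q.toNNReal, fun f hf => ⟨hφ.mem_domain_of_mem_besovSpace hp hq hf, ?_⟩⟩
  rw [ENNReal.coe_toNNReal hQt]
  refine eLpNorm_le_quasiConst_mul hq _ (G := fun (i : Fin 3) (k : ℕ) => if 2 ≤ k + i then
    eLpNorm (fun x => piece φ s f (k + i - 1) x) p volume else 0)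
    (fun i => (measurable_of_countable _).aemeasurable) (fun k => ?_) (fun i => ?_)
  · rw [tsum_fintype]
    exact hC _ k
  · exact eLpNorm_count_comp_le hq (fun j => eLpNorm (fun x => piece φ s f j x) p volume)
      (fun k => 2 ≤ k + i) (fun k => k + i - 1) (fun a b ha hb h => by omega)

end BesovBound

/-! ### Lacunary series with prescribed centres. -/

section Lacunary

variable {n : ℕ} {φ : ℕ → 𝓢(EuclideanSpace ℝ (Fin n), ℂ)} {y : ℕ → EuclideanSpace ℝ (Fin n)}

/-- The modulation of the inverse Fourier transform of `χ` to the frequency `2 ^ j • e`. -/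
def modulated (e : EuclideanSpace ℝ (Fin n)) (χ : 𝓢(EuclideanSpace ℝ (Fin n), ℂ)) (j : ℕ) :
    𝓢(EuclideanSpace ℝ (Fin n), ℂ) :=
  𝓕⁻ (SchwartzMap.compSubConstCLM ℂ ((2 ^ j : ℝ) • e) χ)

theorem fourier_smul_modulated (c : ℂ) (e : EuclideanSpace ℝ (Fin n))
    (χ : 𝓢(EuclideanSpace ℝ (Fin n), ℂ)) (j : ℕ) (ξ : EuclideanSpace ℝ (Fin n)) :
    𝓕 (c • modulated e χ j) ξ = c * χ (ξ - (2 ^ j : ℝ) • e) := by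
  rw [show 𝓕 (c • modulated e χ j) = c • 𝓕 (modulated e χ j) from
    map_smul (FourierTransform.fourierCLM ℂ 𝓢(EuclideanSpace ℝ (Fin n), ℂ)) _ _, modulated,
    FourierTransform.fourier_fourierInv_eq]
  rfl

theorem fourierInv_apply_eq_fourier_neg (u : 𝓢(EuclideanSpace ℝ (Fin n), ℂ))
    (x : EuclideanSpace ℝ (Fin n)) : 𝓕⁻ u x = 𝓕 u (-x) := by
  rw [SchwartzMap.fourierInv_coe, Real.fourierInv_eq_fourier_neg, SchwartzMap.fourier_coe]

theorem norm_modulated (e : EuclideanSpace ℝ (Fin n)) (χ : 𝓢(EuclideanSpace ℝ (Fin n), ℂ)) (j : ℕ)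
    (x : EuclideanSpace ℝ (Fin n)) : ‖modulated e χ j x‖ = ‖𝓕⁻ χ x‖ := by
  rw [modulated, fourierInv_apply_eq_fourier_neg, fourierInv_apply_eq_fourier_neg,
    fourier_translate, norm_mul, Complex.norm_exp_ofReal_mul_I, one_mul]

theorem norm_apply_le_integral_fourier (u : 𝓢(EuclideanSpace ℝ (Fin n), ℂ))
    (x : EuclideanSpace ℝ (Fin n)) : ‖u x‖ ≤ ∫ ξ, ‖𝓕 u ξ‖ := by
  have h : u x = 𝓕⁻ (𝓕 u) x := by rw [FourierTransform.fourierInv_fourier_eq]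
  rw [h, fourierInv_apply_eq_fourier_neg, SchwartzMap.fourier_coe]
  exact VectorFourier.norm_fourierIntegral_le_integral_norm _ _ _ _ _

/-- The value at `0` is at most the integral of the Fourier transform, which sits near `-2 ^ j • e`
where `ĝ` is small. The centres `z` enter only through unimodular phases, so they may be arbitrary.
-/
theorem summable_dualTest_modulated {e : EuclideanSpace ℝ (Fin n)} (he : ‖e‖ = 1)
    {χ : 𝓢(EuclideanSpace ℝ (Fin n), ℂ)} (hχ : ∀ ξ, 1 / 2 ≤ ‖ξ‖ → χ ξ = 0) {a : ℕ → ℝ} {N : ℕ}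
    (ha : ∀ j, |a j| ≤ (2 ^ j) ^ N) (z : ℕ → EuclideanSpace ℝ (Fin n))
    (g : 𝓢(EuclideanSpace ℝ (Fin n), ℂ)) :
    Summable fun j : ℕ => TemperedDistribution.delta (0 : EuclideanSpace ℝ (Fin n))
      (dualTest (((a (j + 1) : ℝ) : ℂ) • modulated e χ (j + 1)) (z (j + 1)) g) := by
  set S := 2 ^ (N + 1) * SchwartzMap.seminorm ℂ (N + 1) 0
    (𝓕 g : 𝓢(EuclideanSpace ℝ (Fin n), ℂ)) with hS
  have hS0 : 0 ≤ S := by positivity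
  have hint : Integrable fun ξ => ‖χ ξ‖ := χ.integrable.norm
  have hb : ∀ j, ‖TemperedDistribution.delta (0 : EuclideanSpace ℝ (Fin n))
      (dualTest (((a j : ℝ) : ℂ) • modulated e χ j) (z j) g)‖ ≤
      S * (∫ ξ, ‖χ ξ‖) * (1 / 2) ^ j := by
    intro j
    rw [TemperedDistribution.delta_apply]
    refine (norm_apply_le_integral_fourier _ _).trans ?_
    have hpt : ∀ ξ, ‖𝓕 (dualTest (((a j : ℝ) : ℂ) • modulated e χ j) (z j) g) ξ‖ ≤
        S * (1 / 2) ^ j * ‖χ (-ξ - (2 ^ j : ℝ) • e)‖ := by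
      intro ξ
      rw [fourier_dualTest, fourier_smul_modulated, norm_mul, norm_mul, norm_mul,
        Complex.norm_exp_ofReal_mul_I, one_mul, Complex.norm_real, Real.norm_eq_abs]
      by_cases h0 : 1 / 2 ≤ ‖-ξ - (2 ^ j : ℝ) • e‖
      · rw [hχ _ h0]; simp
      push Not at h0
      have h1 : (2 ^ j : ℝ) / 2 ≤ ‖ξ‖ := by
        have h2 := norm_sub_le (-ξ) (-ξ - (2 ^ j : ℝ) • e)
        rw [sub_sub_cancel, norm_neg, norm_smul, he, mul_one,
          Real.norm_of_nonneg (by positivity)] at h2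
        have : (1 : ℝ) ≤ 2 ^ j := one_le_pow₀ one_le_two
        linarith
      have h3 := SchwartzMap.norm_pow_mul_le_seminorm ℂ
        (𝓕 g : 𝓢(EuclideanSpace ℝ (Fin n), ℂ)) (N + 1) ξ
      have h4 : (2 ^ j) ^ (N + 1) * ‖𝓕 g ξ‖ ≤ S := by
        calc (2 ^ j : ℝ) ^ (N + 1) * ‖𝓕 g ξ‖ =
            2 ^ (N + 1) * ((2 ^ j / 2) ^ (N + 1) * ‖𝓕 g ξ‖) := by
              rw [div_pow]; field_simp
          _ ≤ 2 ^ (N + 1) * (‖ξ‖ ^ (N + 1) * ‖𝓕 g ξ‖) := by gcongr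
          _ ≤ S := by rw [hS]; gcongr
      have h5 : (2 ^ j : ℝ) ^ N * ‖𝓕 g ξ‖ ≤ S * (1 / 2) ^ j := by
        rw [one_div, inv_pow, ← div_eq_mul_inv, le_div_iff₀ (by positivity)]
        calc _ = (2 ^ j : ℝ) ^ (N + 1) * ‖𝓕 g ξ‖ := by ring
          _ ≤ S := h4
      calc _ = |a j| * ‖𝓕 g ξ‖ * ‖χ (-ξ - (2 ^ j : ℝ) • e)‖ := by ring
        _ ≤ (2 ^ j : ℝ) ^ N * ‖𝓕 g ξ‖ * ‖χ (-ξ - (2 ^ j : ℝ) • e)‖ := by gcongr; exact ha j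
        _ ≤ _ := by gcongr
    have hint' : Integrable fun ξ => S * (1 / 2) ^ j * ‖χ (-ξ - (2 ^ j : ℝ) • e)‖ := by
      refine Integrable.const_mul ?_ _
      exact (hint.comp_sub_right ((2 ^ j : ℝ) • e)).comp_neg
    refine (integral_mono_of_nonneg (Eventually.of_forall fun _ => norm_nonneg _) hint'
      (Eventually.of_forall hpt)).trans (le_of_eq ?_)
    rw [integral_const_mul, integral_neg_eq_self (fun ξ => ‖χ (ξ - (2 ^ j : ℝ) • e)‖) volume,
      integral_sub_right_eq_self (fun ξ => ‖χ ξ‖)]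
    ring
  refine Summable.of_norm_bounded (((summable_geometric_of_lt_one (r := (1 / 2 : ℝ)) (by norm_num)
    (by norm_num)).mul_left (S * ∫ ξ, ‖χ ξ‖)).comp_injective (add_left_injective 1)) fun j => ?_
  exact hb (j + 1)

/-- Convolving `w` with a sum of shifted functions `u j` when at most the `k`-th interacts with `w`.
For `k = 0` nothing survives, since the sum starts at `1`. -/
theorem convFun_shiftedSum_delta {u : ℕ → 𝓢(EuclideanSpace ℝ (Fin n), ℂ)}
    {z : ℕ → EuclideanSpace ℝ (Fin n)}
    (hd : TemperedDistribution.delta (0 : EuclideanSpace ℝ (Fin n)) ∈ (shiftedSum u z).domain)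
    {w v : 𝓢(EuclideanSpace ℝ (Fin n), ℂ)} {k : ℕ}
    (h : ∀ j, 1 ≤ j → j ≠ k →
      SchwartzMap.convolution (ContinuousLinearMap.mul ℂ ℂ) w (u j) = 0)
    (hk : 1 ≤ k → SchwartzMap.convolution (ContinuousLinearMap.mul ℂ ℂ) w (u k) = v)
    (h0 : k = 0 → v = 0) (x : EuclideanSpace ℝ (Fin n)) :
    convFun w (shiftedSum u z ⟨_, hd⟩) x = v (x - z k) := by
  have hterm : ∀ j, TemperedDistribution.delta (0 : EuclideanSpace ℝ (Fin n))
      (dualTest (u (j + 1)) (z (j + 1)) (SchwartzMap.compSubConstCLM ℂ x (reflect w))) =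
      SchwartzMap.convolution (ContinuousLinearMap.mul ℂ ℂ) w (u (j + 1)) (x - z (j + 1)) := by
    intro j
    rw [dualTest_translate_reflect, TemperedDistribution.delta_apply,
      SchwartzMap.compSubConstCLM_apply, reflect_apply, zero_sub, neg_neg]
  refine shiftedSum_apply_eq _ _ ?_
  simp_rw [hterm]
  rcases k with _ | k
  · rw [h0 rfl]
    have hz : ∀ j, SchwartzMap.convolution (ContinuousLinearMap.mul ℂ ℂ) w (u (j + 1))
        (x - z (j + 1)) = 0 := fun j => by rw [h (j + 1) (by omega) (by omega)]; rfl
    simp_rw [hz]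
    exact hasSum_zero
  · rw [← hk (by omega)]
    exact hasSum_single k fun j hj => by rw [h (j + 1) (by omega) (by omega)]; rfl

/-- Lacunary series: for a fixed profile `ψ`, arbitrary bounded coefficients `b` and arbitrary
centres `z`, there is a distribution whose pieces have modulus `b k * |ψ (· - z k)|`, and `T`
shifts the centres by `y`. -/
theorem IsLittlewoodPaleyFamily.exists_lacunary (hφ : IsLittlewoodPaleyFamily φ) (hn : 1 ≤ n) :
    ∃ ψ : 𝓢(EuclideanSpace ℝ (Fin n), ℂ), (∃ x, ψ x ≠ 0) ∧
      ∀ (s : ℝ) (b : ℕ → ℝ) (z : ℕ → EuclideanSpace ℝ (Fin n)), (∀ k, 0 ≤ b k) → (∀ k, b k ≤ 1) →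
        b 0 = 0 → ∃ f : 𝓢'(EuclideanSpace ℝ (Fin n), ℂ),
          (∀ k x, ‖piece φ s f k x‖ = b k * ‖ψ (x - z k)‖) ∧
          ∃ hf : f ∈ (shiftedSum φ y).domain,
            ∀ k x, ‖piece φ s (shiftedSum φ y ⟨f, hf⟩) k x‖ = b k * ‖ψ (x - z k - y k)‖ := by
  obtain ⟨ε, hε, hε2, hnear⟩ := hφ.exists_pieces_near
  obtain ⟨χ, hχ1, hχ0⟩ := exists_schwartz_bump (n := n) hε
  set e : EuclideanSpace ℝ (Fin n) := EuclideanSpace.single ⟨0, hn⟩ 1 with he_def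
  have he : ‖e‖ = 1 := by simp [he_def]
  refine ⟨𝓕⁻ χ, ?_, fun s b z hb0 hb1 hbz => ?_⟩
  · by_contra! h
    have h1 : (𝓕⁻ χ : 𝓢(EuclideanSpace ℝ (Fin n), ℂ)) = 𝓕⁻ (0 : 𝓢(EuclideanSpace ℝ (Fin n), ℂ)) := by
      rw [show 𝓕⁻ (0 : 𝓢(EuclideanSpace ℝ (Fin n), ℂ)) = 0 from
        map_zero (FourierTransform.fourierInvCLM ℂ 𝓢(EuclideanSpace ℝ (Fin n), ℂ))]
      exact SchwartzMap.ext h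
    have h2 := congrArg (fun u : 𝓢(EuclideanSpace ℝ (Fin n), ℂ) =>
      (𝓕 u : 𝓢(EuclideanSpace ℝ (Fin n), ℂ)) 0) h1
    simp only [FourierTransform.fourier_fourierInv_eq] at h2
    rw [hχ1 0 (by simpa using by positivity)] at h2
    exact one_ne_zero h2
  obtain ⟨N, hN⟩ := exists_nat_ge |s|
  -- The factor `2 ^ (-j s)` cancels the weight in `piece`, leaving modulus `b j`.
  set a : ℕ → ℝ := fun j => (2 : ℝ) ^ (-((j : ℝ) * s)) * b j with ha
  have hab : ∀ j, |a j| ≤ (2 ^ j) ^ N := by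
    intro j
    rw [ha, abs_of_nonneg (mul_nonneg (by positivity) (hb0 j))]
    calc _ ≤ (2 : ℝ) ^ (-((j : ℝ) * s)) * 1 := by gcongr; exact hb1 j
      _ ≤ (2 : ℝ) ^ ((j : ℝ) * N) := by
          rw [mul_one]
          refine Real.rpow_le_rpow_of_exponent_le one_le_two ?_
          rw [← mul_neg]
          have := neg_le_abs s
          gcongr
          linarith
      _ = _ := by rw [← pow_mul, ← Real.rpow_natCast]; push_cast; rfl
  set u : ℕ → 𝓢(EuclideanSpace ℝ (Fin n), ℂ) := fun j => ((a j : ℝ) : ℂ) • modulated e χ j with hu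
  have hu0 : u 0 = 0 := by simp [hu, ha, hbz]
  have hnu : ∀ k x, ‖u k x‖ = (2 : ℝ) ^ (-((k : ℝ) * s)) * (b k * ‖𝓕⁻ χ x‖) := by
    intro k x
    change ‖((a k : ℝ) : ℂ) • modulated e χ k x‖ = _
    rw [norm_smul, norm_modulated, Complex.norm_real, Real.norm_of_nonneg
      (mul_nonneg (by positivity) (hb0 k)), mul_assoc]
  -- The lacunary series is itself an operator of the same form, with `u` and `z` in place of `φ`
  -- and `y`, applied to the Dirac mass at the origin.
  have hd : TemperedDistribution.delta (0 : EuclideanSpace ℝ (Fin n)) ∈ (shiftedSum u z).domain :=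
    mem_domain_of_summable _ fun g => summable_dualTest_modulated he
      (fun ξ hξ => hχ0 ξ (by linarith)) hab z g
  set f := shiftedSum u z ⟨_, hd⟩ with hf_def
  have hFu : ∀ k j, 1 ≤ j → ∀ ξ, 𝓕 (φ k) ξ * 𝓕 (u j) ξ = if k = j then 𝓕 (u j) ξ else 0 := by
    intro k j hj ξ
    rw [hu]
    simp only
    rw [fourier_smul_modulated]
    by_cases h : ‖ξ - (2 ^ j : ℝ) • e‖ < ε
    · rw [hnear e he j k hj ξ h]
      split_ifs <;> simp
    · rw [hχ0 _ (not_lt.1 h)]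
      simp
  have hconv : ∀ k, 1 ≤ k → SchwartzMap.convolution (ContinuousLinearMap.mul ℂ ℂ) (φ k) (u k) =
      u k := fun k hk => schwartz_ext_fourier fun ξ => by
    rw [fourier_convolution_mul, hFu k k hk, if_pos rfl]
  have hzero : ∀ v : 𝓢(EuclideanSpace ℝ (Fin n), ℂ), (∀ ξ, 𝓕 v ξ = 0) → v = 0 := fun v hv =>
    schwartz_ext_fourier fun ξ => by
      rw [hv, show 𝓕 (0 : 𝓢(EuclideanSpace ℝ (Fin n), ℂ)) = 0 from
        map_zero (FourierTransform.fourierCLM ℂ 𝓢(EuclideanSpace ℝ (Fin n), ℂ))]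
      rfl
  have hF : ∀ k x, convFun (φ k) f x = u k (x - z k) := fun k x =>
    convFun_shiftedSum_delta hd (fun j hj hjk => hzero _ fun ξ => by
      rw [fourier_convolution_mul, hFu k j hj, if_neg (Ne.symm hjk)])
      (hconv k) (fun hk => by rw [hk, hu0]) x
  have hpiece : ∀ (g : 𝓢'(EuclideanSpace ℝ (Fin n), ℂ)) k x x', convFun (φ k) g x = u k x' →
      ‖piece φ s g k x‖ = b k * ‖𝓕⁻ χ x'‖ := by
    intro g k x x' h
    rw [piece, h, norm_smul, hnu, Real.norm_of_nonneg (by positivity), ← mul_assoc,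
      ← Real.rpow_add two_pos, add_neg_cancel, Real.rpow_zero, one_mul]
  have hfd : f ∈ (shiftedSum φ y).domain := by
    refine hφ.mem_domain_of_growth
      (B := SchwartzMap.seminorm ℂ 0 0 (𝓕⁻ χ : 𝓢(EuclideanSpace ℝ (Fin n), ℂ))) (N := N)
      fun j x => ?_
    rw [hF, mul_comm]
    change ‖((a j : ℝ) : ℂ) • modulated e χ j (x - z j)‖ ≤ _
    rw [norm_smul, norm_modulated, Complex.norm_real]
    gcongr
    · exact hab j
    · exact SchwartzMap.norm_le_seminorm ℂ _ _
  refine ⟨f, fun k x => hpiece f k x _ (hF k x), hfd, fun k x => hpiece _ k x _ ?_⟩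
  -- Neighbouring `φ̂ₖ` and `φ̂ₗ` may overlap, but each `u j` has its frequencies where `φ̂ⱼ` alone
  -- is nonzero; so only the diagonal term contributes to a piece of `T f`.
  have hoff : ∀ l, 1 ≤ l → k ≠ l → ∀ x, convFun (SchwartzMap.convolution
      (ContinuousLinearMap.mul ℂ ℂ) (φ k) (φ l)) f x = 0 := by
    intro l hl hkl x
    have := convFun_shiftedSum_delta hd (w := SchwartzMap.convolution
      (ContinuousLinearMap.mul ℂ ℂ) (φ k) (φ l)) (v := 0) (k := 0) (fun j hj _ => hzero _ fun ξ => by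
      rw [fourier_convolution_mul, fourier_convolution_mul, mul_assoc, hFu l j hj]
      split_ifs with hlj
      · rw [hFu k j hj, if_neg (by omega)]
      · rw [mul_zero]) (fun h => absurd h (by omega)) (fun _ => rfl) x
    rw [this]
    rfl
  have hdiag : 1 ≤ k → ∀ x, convFun (SchwartzMap.convolution
      (ContinuousLinearMap.mul ℂ ℂ) (φ k) (φ k)) f x = u k (x - z k) := fun hk x =>
    convFun_shiftedSum_delta hd (fun j hj hjk => hzero _ fun ξ => by
      rw [fourier_convolution_mul, fourier_convolution_mul, mul_assoc, hFu k j hj,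
        if_neg (Ne.symm hjk), mul_zero])
      (fun hk => schwartz_ext_fourier fun ξ => by
        rw [fourier_convolution_mul, fourier_convolution_mul, mul_assoc, hFu k k hk, if_pos rfl,
          hFu k k hk, if_pos rfl]) (fun h => absurd h (by omega)) x
  rw [hφ.convFun_shiftedSum]
  rcases Nat.eq_zero_or_pos k with rfl | hk
  · rw [hu0]
    refine Finset.sum_eq_zero fun i _ => ?_
    split_ifs with hi
    · exact hoff _ (by omega) (by omega) _
    · rfl
  · rw [Finset.sum_eq_single 1]
    · rw [if_pos (by simpa using by omega)]
      simp only [Fin.val_one, Nat.add_sub_cancel]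
      rw [hdiag hk]
      congr 1
      abel
    · intro i _ hi
      have hi' : (i : ℕ) ≠ 1 := fun h => hi (Fin.ext h)
      split_ifs with h2
      · exact hoff _ (by omega) (by omega) _
      · rfl
    · simp

end Lacunary

/-! ### Failure on Triebel–Lizorkin spaces. -/

section TriebelLizorkin

variable {n : ℕ} {φ : ℕ → 𝓢(EuclideanSpace ℝ (Fin n), ℂ)} {y : ℕ → EuclideanSpace ℝ (Fin n)}

theorem eLpNorm_count_eq_tsum {q : ℝ≥0∞} (hq : 0 < q) (hqt : q ≠ ∞) {ε : Type*} [TopologicalSpace ε]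
    [ContinuousENorm ε] (g : ℕ → ε) :
    eLpNorm g q Measure.count = (∑' k, ‖g k‖ₑ ^ q.toReal) ^ (1 / q.toReal) := by
  rw [eLpNorm_eq_lintegral_rpow_enorm_toReal hq.ne' hqt, lintegral_count]

theorem eLpNorm_eq_top_of_eq_top {α : Type*} [MeasurableSpace α] {μ : Measure α} {p : ℝ≥0∞}
    (hp : 0 < p) (hpt : p ≠ ∞) {F : α → ℝ≥0∞} {s : Set α} (hs : MeasurableSet s) (hμ : μ s ≠ 0)
    (hF : ∀ x ∈ s, F x = ∞) : eLpNorm F p μ = ∞ := by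
  have hp0 := ENNReal.toReal_pos hp.ne' hpt
  rw [eLpNorm_eq_lintegral_rpow_enorm_toReal hp.ne' hpt]
  refine ENNReal.rpow_eq_top_iff.2 (Or.inr ⟨?_, by positivity⟩)
  rw [eq_top_iff]
  calc ∞ = ∫⁻ _ in s, ∞ ∂μ := by rw [setLIntegral_const, ENNReal.top_mul hμ]
    _ ≤ ∫⁻ x in s, ‖F x‖ₑ ^ p.toReal ∂μ := setLIntegral_mono' hs fun x hx => by
        rw [hF x hx, enorm_eq_self, ENNReal.top_rpow_of_pos hp0]
    _ ≤ _ := setLIntegral_le_lintegral _ _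

theorem exists_ball_le_norm {ψ : 𝓢(EuclideanSpace ℝ (Fin n), ℂ)} {x₀ : EuclideanSpace ℝ (Fin n)}
    (h : ψ x₀ ≠ 0) {δ : ℝ} (hδ : 0 < δ) :
    ∃ r c : ℝ, 0 < r ∧ r ≤ δ ∧ 0 < c ∧ ∀ x ∈ Metric.ball x₀ r, c ≤ ‖ψ x‖ := by
  have h0 : 0 < ‖ψ x₀‖ := norm_pos_iff.2 h
  have h1 : ∀ᶠ x in 𝓝 x₀, ‖ψ x₀‖ / 2 < ‖ψ x‖ :=
    ψ.continuous.norm.continuousAt.eventually (lt_mem_nhds (by linarith))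
  obtain ⟨r, hr, hball⟩ := Metric.eventually_nhds_iff_ball.1 h1
  refine ⟨min r δ, ‖ψ x₀‖ / 2, lt_min hr hδ, min_le_right _ _, by positivity, fun x hx => ?_⟩
  exact (hball x (Metric.ball_subset_ball (min_le_left _ _) hx)).le

theorem tsum_harmonic_eq_top : ∑' k : ℕ, ENNReal.ofReal ((k : ℝ)⁻¹) = ∞ := by
  by_contra h
  refine Real.not_summable_natCast_inv ((ENNReal.summable_toReal h).congr fun k => ?_)
  rw [ENNReal.toReal_ofReal (by positivity)]

theorem tsum_rpow_lt_top {r : ℝ} (hr : 1 < r) :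
    ∑' k : ℕ, ENNReal.ofReal ((k : ℝ) ^ (-r)) < ∞ :=
  (Real.summable_nat_rpow.2 (by linarith)).tsum_ofReal_lt_top

theorem natCast_rpow_neg_le_one {r : ℝ} (hr : 0 < r) (k : ℕ) : (k : ℝ) ^ (-r) ≤ 1 := by
  rcases Nat.eq_zero_or_pos k with rfl | hk
  · rw [Nat.cast_zero, Real.zero_rpow (by linarith)]
    exact zero_le_one
  · exact Real.rpow_le_one_of_one_le_of_nonpos (by exact_mod_cast hk) (by linarith)

theorem enorm_of_norm_eq_mul {z w : ℂ} {b : ℝ} (hb : 0 ≤ b) (h : ‖z‖ = b * ‖w‖) :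
    ‖z‖ₑ = ENNReal.ofReal b * ‖w‖ₑ := by
  rw [← ofReal_norm, ← ofReal_norm, h, ENNReal.ofReal_mul hb]

/-- If all pieces are concentrated at the same centre, the `ℓ^q` norm factors. -/
theorem eLpNorm_count_of_norm_eq_mul {q : ℝ≥0∞} {g : ℕ → ℂ} {b : ℕ → ℝ} (hb : ∀ k, 0 ≤ b k) {w : ℂ}
    (h : ∀ k, ‖g k‖ = b k * ‖w‖) :
    eLpNorm g q Measure.count = ‖w‖ₑ * eLpNorm b q Measure.count := by
  have h1 : eLpNorm g q Measure.count = eLpNorm (‖w‖ • b) q Measure.count := by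
    refine eLpNorm_congr_norm_ae (Eventually.of_forall fun k => ?_)
    rw [h k, Pi.smul_apply, smul_eq_mul, Real.norm_of_nonneg (mul_nonneg (norm_nonneg _) (hb k)),
      mul_comm]
  rw [h1, eLpNorm_const_smul, enorm_norm]

variable {ψ : 𝓢(EuclideanSpace ℝ (Fin n), ℂ)} {s : ℝ} {p q : ℝ≥0∞}

theorem triebelLizorkinNorm_lt_top_of_same_centre (hpt : p ≠ ∞)
    {f : 𝓢'(EuclideanSpace ℝ (Fin n), ℂ)} {b : ℕ → ℝ} (hb : ∀ k, 0 ≤ b k)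
    (hf : ∀ k x, ‖piece φ s f k x‖ = b k * ‖ψ x‖) (hbq : eLpNorm b q Measure.count ≠ ∞) :
    triebelLizorkinNorm φ s p q f < ∞ := by
  rw [triebelLizorkinNorm, if_neg hpt]
  have h1 : ∀ x, eLpNorm (fun j => piece φ s f j x) q Measure.count =
      eLpNorm b q Measure.count * ‖ψ x‖ₑ := fun x => by
    rw [eLpNorm_count_of_norm_eq_mul hb (fun k => hf k x), mul_comm]
  simp_rw [h1]
  have h2 : eLpNorm (fun x => eLpNorm b q Measure.count * ‖ψ x‖ₑ) p volume =
      eLpNorm ((eLpNorm b q Measure.count).toReal • (ψ : EuclideanSpace ℝ (Fin n) → ℂ)) p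
        volume := by
    refine eLpNorm_congr_enorm_ae (Eventually.of_forall fun x => ?_)
    rw [enorm_eq_self, Pi.smul_apply, enorm_smul, Real.enorm_of_nonneg ENNReal.toReal_nonneg,
      ENNReal.ofReal_toReal hbq]
  rw [h2, eLpNorm_const_smul]
  exact ENNReal.mul_lt_top enorm_lt_top (SchwartzMap.memLp ψ p volume).2

/-- On the ball around `x₀ + y k` the `k`-th piece alone gives at least a constant times `1 / k` to
the integral of the `p`-th power. The balls are disjoint, so the harmonic series diverges, whatever
`q` is. -/
theorem triebelLizorkinNorm_eq_top_of_separated (hp : 0 < p) (hpt : p ≠ ∞) (hq : 0 < q)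
    (hψ : ∃ x, ψ x ≠ 0) {δ : ℝ} (hδ : 0 < δ)
    (hy : ∀ j k : ℕ, 1 ≤ j → 1 ≤ k → j ≠ k → δ ≤ ‖y j - y k‖)
    {f : 𝓢'(EuclideanSpace ℝ (Fin n), ℂ)}
    (hf : ∀ k x, ‖piece φ s f k x‖ = (k : ℝ) ^ (-(1 / p.toReal)) * ‖ψ (x - y k)‖) :
    triebelLizorkinNorm φ s p q f = ∞ := by
  have hp0 := ENNReal.toReal_pos hp.ne' hpt
  obtain ⟨x₀, hx₀⟩ := hψ
  obtain ⟨r, c, hr, hrδ, hc, hball⟩ := exists_ball_le_norm hx₀ (half_pos hδ)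
  rw [triebelLizorkinNorm, if_neg hpt, eLpNorm_eq_lintegral_rpow_enorm_toReal hp.ne' hpt]
  refine ENNReal.rpow_eq_top_iff.2 (Or.inr ⟨?_, by positivity⟩)
  rw [eq_top_iff]
  set V := volume (Metric.ball (0 : EuclideanSpace ℝ (Fin n)) r)
  have hV : V ≠ 0 := (Metric.measure_ball_pos volume _ hr).ne'
  set B : ℕ → Set (EuclideanSpace ℝ (Fin n)) := fun k => Metric.ball (x₀ + y (k + 1)) r with hB
  have hterm : ∀ k : ℕ, ENNReal.ofReal ((k + 1 : ℕ) : ℝ)⁻¹ * (ENNReal.ofReal c ^ p.toReal * V) ≤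
      ∫⁻ x in B k, ‖eLpNorm (fun j => piece φ s f j x) q Measure.count‖ₑ ^ p.toReal := by
    intro k
    have hVk : volume (B k) = V := by rw [hB]; exact Measure.addHaar_ball_center _ _ _
    rw [← hVk, ← mul_assoc, ← setLIntegral_const]
    refine setLIntegral_mono' Metric.isOpen_ball.measurableSet fun x hx => ?_
    have h1 := le_eLpNorm_count hq (fun j => ‖piece φ s f j x‖ₑ) (k + 1)
    rw [eLpNorm_enorm] at h1
    have hx' : x - y (k + 1) ∈ Metric.ball x₀ r := by
      rw [Metric.mem_ball, dist_eq_norm] at hx ⊢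
      rwa [sub_sub, add_comm (y (k + 1))]
    have h2 : ENNReal.ofReal (((k + 1 : ℕ) : ℝ) ^ (-(1 / p.toReal)) * c) ≤
        ‖piece φ s f (k + 1) x‖ₑ := by
      rw [← ofReal_norm, hf]
      refine ENNReal.ofReal_le_ofReal ?_
      gcongr
      exact hball _ hx'
    rw [enorm_eq_self]
    calc ENNReal.ofReal ((k + 1 : ℕ) : ℝ)⁻¹ * ENNReal.ofReal c ^ p.toReal =
        ENNReal.ofReal (((k + 1 : ℕ) : ℝ) ^ (-(1 / p.toReal)) * c) ^ p.toReal := by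
          rw [ENNReal.ofReal_mul (by positivity), ENNReal.mul_rpow_of_nonneg _ _ hp0.le,
            ENNReal.ofReal_rpow_of_nonneg (x := ((k + 1 : ℕ) : ℝ) ^ (-(1 / p.toReal)))
              (by positivity) hp0.le, ← Real.rpow_mul (by positivity), neg_mul,
            one_div_mul_cancel hp0.ne', Real.rpow_neg_one]
      _ ≤ _ := by gcongr; exact h2.trans h1
  have hdisj : Pairwise (Function.onFun Disjoint B) := by
    intro i j hij
    refine Metric.ball_disjoint_ball ?_
    rw [dist_eq_norm, add_sub_add_left_eq_sub]
    have := hy (i + 1) (j + 1) (by omega) (by omega) (by omega)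
    linarith
  have hsum : ∑' k : ℕ, ENNReal.ofReal ((k + 1 : ℕ) : ℝ)⁻¹ = ∞ := by
    have h := tsum_harmonic_eq_top
    rw [tsum_eq_zero_add' ENNReal.summable] at h
    simpa using h
  calc ∞ = ∑' k : ℕ, ENNReal.ofReal ((k + 1 : ℕ) : ℝ)⁻¹ * (ENNReal.ofReal c ^ p.toReal * V) := by
        rw [ENNReal.tsum_mul_right, hsum, ENNReal.top_mul]
        refine mul_ne_zero ?_ hV
        have : ENNReal.ofReal c ≠ 0 := by simpa using hc
        simp [ENNReal.rpow_eq_zero_iff, this]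
    _ ≤ ∑' k, ∫⁻ x in B k, ‖eLpNorm (fun j => piece φ s f j x) q Measure.count‖ₑ ^ p.toReal :=
        ENNReal.tsum_le_tsum hterm
    _ = ∫⁻ x in ⋃ k, B k, ‖eLpNorm (fun j => piece φ s f j x) q Measure.count‖ₑ ^ p.toReal :=
        (lintegral_iUnion (fun k => Metric.isOpen_ball.measurableSet) hdisj _).symm
    _ ≤ _ := setLIntegral_le_lintegral _ _

theorem triebelLizorkinNorm_eq_top_of_same_centre (hp : 0 < p) (hpt : p ≠ ∞)
    (hψ : ∃ x, ψ x ≠ 0) {f : 𝓢'(EuclideanSpace ℝ (Fin n), ℂ)} {b : ℕ → ℝ} (hb : ∀ k, 0 ≤ b k)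
    (hf : ∀ k x, ‖piece φ s f k x‖ = b k * ‖ψ x‖) (hbq : eLpNorm b q Measure.count = ∞) :
    triebelLizorkinNorm φ s p q f = ∞ := by
  obtain ⟨x₀, hx₀⟩ := hψ
  obtain ⟨r, c, hr, -, hc, hball⟩ := exists_ball_le_norm hx₀ one_pos
  rw [triebelLizorkinNorm, if_neg hpt]
  refine eLpNorm_eq_top_of_eq_top hp hpt (s := Metric.ball x₀ r) Metric.isOpen_ball.measurableSet
    (Metric.measure_ball_pos volume _ hr).ne' fun x hx => ?_
  rw [eLpNorm_count_of_norm_eq_mul hb (fun k => hf k x), hbq, ENNReal.mul_top]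
  have := hball x hx
  rw [Ne, enorm_eq_zero, ← norm_eq_zero]
  linarith

/-- The index starts at `k + 1` because nothing is assumed about `y 0`. -/
theorem exists_packing_bound_shifted {δ : ℝ} (hδ : 0 < δ)
    (hy : ∀ j k : ℕ, 1 ≤ j → 1 ≤ k → j ≠ k → δ ≤ ‖y j - y k‖) {q : ℝ} (hq : 0 < q)
    (ψ : 𝓢(EuclideanSpace ℝ (Fin n), ℂ)) :
    ∃ C : ℝ≥0, ∀ x, ∑' k : ℕ, ‖ψ (x + y (k + 1))‖ₑ ^ q ≤ C := by
  obtain ⟨C, hC⟩ := exists_packing_bound_schwartz (fun k : ℕ => -y (k + 1)) hδ (fun i j hij => by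
    rw [neg_sub_neg, norm_sub_rev]
    exact hy _ _ (by omega) (by omega) (by omega)) hq ψ
  exact ⟨C, fun x => by simpa using hC x⟩

/-- Put `t = p / q > 1`. Hölder with weights `|ψ(x + y k)| ^ q`, whose sum over `k` is bounded by
packing, moves the power `t` onto the coefficients `1 / k`; integration leaves the convergent `∑ k ^
(-t)`. -/
theorem triebelLizorkinNorm_lt_top_of_separated (hq : 0 < q) (hqp : q < p) (hpt : p ≠ ∞)
    {δ : ℝ} (hδ : 0 < δ) (hy : ∀ j k : ℕ, 1 ≤ j → 1 ≤ k → j ≠ k → δ ≤ ‖y j - y k‖)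
    {f : 𝓢'(EuclideanSpace ℝ (Fin n), ℂ)}
    (hf : ∀ k x, ‖piece φ s f k x‖ = (k : ℝ) ^ (-(1 / q.toReal)) * ‖ψ (x + y k)‖) :
    triebelLizorkinNorm φ s p q f < ∞ := by
  have hqt : q ≠ ∞ := hqp.ne_top
  have hq0 := ENNReal.toReal_pos hq.ne' hqt
  have hp : 0 < p := hq.trans hqp
  have hp0 := ENNReal.toReal_pos hp.ne' hpt
  have hqp' : q.toReal < p.toReal := (ENNReal.toReal_lt_toReal hqt hpt).2 hqp
  obtain ⟨C, hC⟩ := exists_packing_bound_shifted hδ hy hq0 ψ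
  rw [triebelLizorkinNorm, if_neg hpt, eLpNorm_eq_lintegral_rpow_enorm_toReal hp.ne' hpt]
  refine ENNReal.rpow_lt_top_of_nonneg (by positivity) (LT.lt.ne ?_)
  set t := p.toReal / q.toReal with ht
  have ht1 : 1 < t := (one_lt_div hq0).2 hqp'
  set w : ℕ → EuclideanSpace ℝ (Fin n) → ℝ≥0∞ := fun k x => ‖ψ (x + y (k + 1))‖ₑ ^ q.toReal with hw
  set g : ℕ → ℝ≥0∞ := fun k => ENNReal.ofReal (((k + 1 : ℕ) : ℝ)⁻¹) with hg
  have hpt : ∀ x, ‖eLpNorm (fun j => piece φ s f j x) q Measure.count‖ₑ ^ p.toReal ≤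
      (C : ℝ≥0∞) ^ (t - 1) * ∑' k, w k x * g k ^ t := by
    intro x
    have h1 : ∑' k, ‖piece φ s f k x‖ₑ ^ q.toReal = ∑' k, w k x * g k := by
      have h2 : ∀ k, ‖piece φ s f k x‖ₑ ^ q.toReal =
          ENNReal.ofReal ((k : ℝ) ^ (-(1 / q.toReal))) ^ q.toReal *
            ‖ψ (x + y k)‖ₑ ^ q.toReal := fun k => by
        rw [enorm_of_norm_eq_mul (by positivity) (hf k x), ENNReal.mul_rpow_of_nonneg _ _ hq0.le]
      simp_rw [h2]
      have hz : -(1 / q.toReal) ≠ 0 := by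
        have : 0 < 1 / q.toReal := by positivity
        linarith
      rw [tsum_eq_zero_add' ENNReal.summable, Nat.cast_zero, Real.zero_rpow hz, ENNReal.ofReal_zero,
        ENNReal.zero_rpow_of_pos hq0, zero_mul, zero_add]
      refine tsum_congr fun k => ?_
      rw [mul_comm]
      congr 1
      rw [ENNReal.ofReal_rpow_of_nonneg (by positivity) hq0.le, ← Real.rpow_mul (by positivity),
        neg_mul, one_div_mul_cancel hq0.ne', Real.rpow_neg_one]
    rw [enorm_eq_self, eLpNorm_count_eq_tsum hq hqt, h1, ← ENNReal.rpow_mul,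
      show 1 / q.toReal * p.toReal = t by rw [ht]; ring]
    refine (tsum_mul_rpow_le ht1.le _ _).trans ?_
    gcongr
    exact hC x
  have hψq : ∫⁻ x, ‖ψ x‖ₑ ^ q.toReal < ∞ := by
    have := (SchwartzMap.memLp ψ q volume).2
    rw [eLpNorm_eq_lintegral_rpow_enorm_toReal hq.ne' hqt] at this
    exact (ENNReal.rpow_lt_top_iff_of_pos (by positivity)).1 this
  have hmeas : ∀ k, Measurable (w k) := fun k =>
    ((ψ.continuous.comp (continuous_id.add continuous_const)).enorm.measurable).pow_const _
  have hint : ∀ k, ∫⁻ x, w k x * g k ^ t = g k ^ t * ∫⁻ x, ‖ψ x‖ₑ ^ q.toReal := fun k => by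
    rw [lintegral_mul_const _ (hmeas k), mul_comm]
    congr 1
    exact lintegral_add_right_eq_self (fun x => ‖ψ x‖ₑ ^ q.toReal) (y (k + 1))
  refine (lintegral_mono hpt).trans_lt ?_
  rw [lintegral_const_mul' _ _ (ENNReal.rpow_ne_top_of_nonneg (by linarith) ENNReal.coe_ne_top),
    lintegral_tsum fun k => ((hmeas k).mul_const _).aemeasurable]
  simp_rw [hint]
  rw [ENNReal.tsum_mul_right]
  refine ENNReal.mul_lt_top (ENNReal.rpow_lt_top_of_nonneg (by linarith) ENNReal.coe_ne_top)
    (ENNReal.mul_lt_top ?_ hψq)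
  refine lt_of_le_of_lt ?_ (tsum_rpow_lt_top ht1)
  refine le_trans (le_of_eq (tsum_congr fun k => ?_))
    (ENNReal.tsum_comp_le_tsum_of_injective (add_left_injective 1)
      fun k : ℕ => ENNReal.ofReal ((k : ℝ) ^ (-t)))
  rw [hg]
  simp only
  rw [ENNReal.ofReal_rpow_of_nonneg (by positivity) (by linarith), Real.inv_rpow (by positivity),
    Real.rpow_neg (by positivity)]

/-- Packing bounds the `ℓ^q` norm uniformly in the point, and the factor `2 ^ (J n / q)` exactly
cancels the `q`-th root of the volume of the ball, up to a constant. -/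
theorem triebelLizorkinNorm_top_lt_top_of_separated (hq : 0 < q) (hqt : q ≠ ∞)
    {δ : ℝ} (hδ : 0 < δ) (hy : ∀ j k : ℕ, 1 ≤ j → 1 ≤ k → j ≠ k → δ ≤ ‖y j - y k‖)
    {f : 𝓢'(EuclideanSpace ℝ (Fin n), ℂ)}
    (hf : ∀ k x, ‖piece φ s f k x‖ = (if k = 0 then 0 else 1) * ‖ψ (x + y k)‖) :
    triebelLizorkinNorm φ s ∞ q f < ∞ := by
  have hq0 := ENNReal.toReal_pos hq.ne' hqt
  obtain ⟨C, hC⟩ := exists_packing_bound_shifted hδ hy hq0 ψ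
  rw [triebelLizorkinNorm, if_pos rfl]
  set V := volume (Metric.ball (0 : EuclideanSpace ℝ (Fin n)) 1) with hV
  have hVt : V < ∞ := measure_ball_lt_top
  refine lt_of_le_of_lt (b := (C : ℝ≥0∞) ^ (1 / q.toReal) * V ^ q.toReal⁻¹)
    (iSup_le fun x => iSup_le fun J => ?_)
    (ENNReal.mul_lt_top (ENNReal.rpow_lt_top_of_nonneg (by positivity) ENNReal.coe_ne_top)
      (ENNReal.rpow_lt_top_of_nonneg (by positivity) hVt.ne))
  have hin : ∀ z, eLpNorm (fun j : ℕ => if J ≤ (j : ℤ) then piece φ s f j z else 0) q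
      Measure.count ≤ (C : ℝ≥0∞) ^ (1 / q.toReal) := by
    intro z
    rw [eLpNorm_count_eq_tsum hq hqt]
    gcongr
    refine le_trans ?_ (hC z)
    rw [tsum_eq_zero_add' ENNReal.summable]
    have h0 : ‖piece φ s f 0 z‖ₑ = 0 := by
      rw [enorm_eq_zero, ← norm_eq_zero, hf, if_pos rfl, zero_mul]
    have h1 : ∀ k, ‖piece φ s f (k + 1) z‖ₑ = ‖ψ (z + y (k + 1))‖ₑ := fun k => by
      rw [← ofReal_norm, hf, if_neg (by omega), one_mul, ofReal_norm]
    have h2 : ‖if J ≤ ((0 : ℕ) : ℤ) then piece φ s f 0 z else 0‖ₑ ^ q.toReal = 0 := by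
      split_ifs
      · rw [h0, ENNReal.zero_rpow_of_pos hq0]
      · rw [enorm_zero, ENNReal.zero_rpow_of_pos hq0]
    rw [h2, zero_add]
    refine ENNReal.tsum_le_tsum fun k => ?_
    rw [← h1]
    gcongr
    split_ifs
    · exact le_rfl
    · simp
  have h1 := eLpNorm_le_of_ae_enorm_bound (p := q)
    (μ := (volume : Measure (EuclideanSpace ℝ (Fin n))).restrict (Metric.ball x ((2 : ℝ) ^ (-J))))
    (f := fun z => eLpNorm (fun j : ℕ => if J ≤ (j : ℤ) then piece φ s f j z else 0) q
      Measure.count) (Eventually.of_forall fun z => by rw [enorm_eq_self]; exact hin z)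
  have hball : volume (Metric.ball x ((2 : ℝ) ^ (-J))) = (2 : ℝ≥0∞) ^ (-((J : ℝ) * n)) * V := by
    rw [Measure.addHaar_ball_of_pos _ _ (by positivity), finrank_euclideanSpace_fin, ← hV]
    congr 1
    rw [← Real.rpow_intCast, ← Real.rpow_natCast, ← Real.rpow_mul (by norm_num),
      ← ENNReal.ofReal_rpow_of_pos two_pos, ENNReal.ofReal_ofNat]
    congr 1
    push_cast
    ring
  rw [Measure.restrict_apply_univ, hball, smul_eq_mul] at h1
  refine (mul_le_mul_right h1 _).trans (le_of_eq ?_)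
  rw [ENNReal.mul_rpow_of_nonneg _ _ (by positivity), ← ENNReal.rpow_mul]
  rw [mul_left_comm, ← mul_assoc ((2 : ℝ≥0∞) ^ _), ← ENNReal.rpow_add _ _ two_ne_zero
    ENNReal.ofNat_ne_top]
  rw [show (J : ℝ) * (n / q.toReal) + -((J : ℝ) * n) * q.toReal⁻¹ = 0 by ring, ENNReal.rpow_zero,
    one_mul]

theorem triebelLizorkinNorm_top_eq_top_of_same_centre (hq : 0 < q) (hqt : q ≠ ∞)
    (hψ : ∃ x, ψ x ≠ 0) {f : 𝓢'(EuclideanSpace ℝ (Fin n), ℂ)} {b : ℕ → ℝ} (hb : ∀ k, 0 ≤ b k)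
    (hf : ∀ k x, ‖piece φ s f k x‖ = b k * ‖ψ x‖) (hbq : eLpNorm b q Measure.count = ∞) :
    triebelLizorkinNorm φ s ∞ q f = ∞ := by
  obtain ⟨x₀, hx₀⟩ := hψ
  obtain ⟨r, c, hr, hr1, hc, hball⟩ := exists_ball_le_norm hx₀ one_pos
  rw [triebelLizorkinNorm, if_pos rfl, eq_top_iff]
  -- The unit ball around a point where `ψ` is nonzero, that is `J = 0`, already gives infinity; no
  -- piece is discarded there.
  refine le_trans (le_of_eq ?_) (le_iSup₂ (f := fun (x : EuclideanSpace ℝ (Fin n)) (J : ℤ) =>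
    (2 : ℝ≥0∞) ^ ((J : ℝ) * ((n : ℝ) / q.toReal)) *
        eLpNorm
          (fun z => eLpNorm (fun j : ℕ => if J ≤ (j : ℤ) then piece φ s f j z else 0) q
            Measure.count)
          q (volume.restrict (Metric.ball x ((2 : ℝ) ^ (-J))))) x₀ 0)
  simp only [Int.cast_zero, zero_mul, ENNReal.rpow_zero, one_mul, neg_zero, zpow_zero,
    Nat.cast_nonneg, if_true]
  refine (eLpNorm_eq_top_of_eq_top hq hqt (s := Metric.ball x₀ r) Metric.isOpen_ball.measurableSet
    ?_ fun x hx => ?_).symm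
  · rw [Measure.restrict_apply Metric.isOpen_ball.measurableSet,
      inter_eq_left.2 (Metric.ball_subset_ball hr1)]
    exact (Metric.measure_ball_pos volume _ hr).ne'
  · rw [eLpNorm_count_of_norm_eq_mul hb (fun k => hf k x), hbq, ENNReal.mul_top]
    have := hball x hx
    rw [Ne, enorm_eq_zero, ← norm_eq_zero]
    linarith

/-- `T` does not preserve Triebel–Lizorkin spaces with `p ≠ q`. -/
theorem IsLittlewoodPaleyFamily.exists_shiftedSum_notMem_triebelLizorkinSpace
    (hφ : IsLittlewoodPaleyFamily φ) (hn : 1 ≤ n) {δ : ℝ} (hδ : 0 < δ)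
    (hy : ∀ j k : ℕ, 1 ≤ j → 1 ≤ k → j ≠ k → δ ≤ ‖y j - y k‖) (s : ℝ) {p q : ℝ≥0∞}
    (hp : 0 < p) (hq : 0 < q) (hpq : p ≠ q) :
    ∃ f ∈ triebelLizorkinSpace φ s p q, ∃ hf : f ∈ (shiftedSum φ y).domain,
      shiftedSum φ y ⟨f, hf⟩ ∉ triebelLizorkinSpace φ s p q := by
  obtain ⟨ψ, hψ, hlac⟩ := hφ.exists_lacunary (y := y) hn
  simp only [triebelLizorkinSpace, mem_ofPred_eq, not_lt, top_le_iff]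
  have hpos : ∀ r : ℝ≥0∞, 0 < r → r ≠ ∞ → 0 < 1 / r.toReal := fun r h h' =>
    one_div_pos.2 (ENNReal.toReal_pos h.ne' h')
  have hrpow : ∀ r : ℝ≥0∞, 0 < r → r ≠ ∞ → ∀ k : ℕ, ∀ t : ℝ, 0 < t →
      ‖(k : ℝ) ^ (-(1 / r.toReal))‖ₑ ^ t = ENNReal.ofReal ((k : ℝ) ^ (-(t / r.toReal))) :=
    fun r h h' k t ht => by
      rw [Real.enorm_of_nonneg (by positivity), ENNReal.ofReal_rpow_of_nonneg (by positivity) ht.le,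
        ← Real.rpow_mul (by positivity)]
      congr 2
      ring
  rcases lt_or_gt_of_ne hpq with h | h
  · have hpt : p ≠ ∞ := h.ne_top
    have hp0 := hpos p hp hpt
    -- These coefficients are in `ℓ^q` but not in `ℓᵖ`. At `k = 0` the power is `0` by convention,
    -- which is the vanishing required of the coefficient `b 0`.
    obtain ⟨f, hf, hfd, hTf⟩ := hlac s (fun k => (k : ℝ) ^ (-(1 / p.toReal))) (fun _ => 0)
      (fun k => by positivity) (fun k => natCast_rpow_neg_le_one hp0 k)
      (by rw [Nat.cast_zero, Real.zero_rpow (by linarith)])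
    simp only [sub_zero] at hf hTf
    refine ⟨f, triebelLizorkinNorm_lt_top_of_same_centre hpt (fun k => by positivity) hf ?_, hfd,
      triebelLizorkinNorm_eq_top_of_separated hp hpt hq hψ hδ hy hTf⟩
    rcases eq_or_ne q ∞ with rfl | hqt
    · refine ((eLpNorm_exponent_top (f := fun k : ℕ => (k : ℝ) ^ (-(1 / p.toReal)))).trans_le
        (essSup_le_of_ae_le 1 (Eventually.of_forall fun k => ?_))).trans_lt ENNReal.one_lt_top |>.ne
      simp only
      rw [Real.enorm_of_nonneg (by positivity)]
      simpa using natCast_rpow_neg_le_one hp0 k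
    · have hq0 := ENNReal.toReal_pos hq.ne' hqt
      rw [eLpNorm_count_eq_tsum hq hqt]
      simp_rw [hrpow p hp hpt _ _ hq0]
      refine (ENNReal.rpow_lt_top_of_nonneg (by positivity) (tsum_rpow_lt_top ?_).ne).ne
      rw [one_lt_div (ENNReal.toReal_pos hp.ne' hpt)]
      exact (ENNReal.toReal_lt_toReal hpt hqt).2 h
  · have hqt : q ≠ ∞ := h.ne_top
    have hq0 := hpos q hq hqt
    have hq0' := ENNReal.toReal_pos hq.ne' hqt
    rcases eq_or_ne p ∞ with rfl | hpt
    · have hb : ∀ k : ℕ, (0 : ℝ) ≤ if k = 0 then 0 else 1 := fun k => by split_ifs <;> norm_num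
      -- For `p = ∞` separated centres tolerate constant coefficients, whose `ℓ^q` norm is infinite
      -- once `T` has brought all centres to the origin.
      obtain ⟨f, hf, hfd, hTf⟩ := hlac s (fun k => if k = 0 then 0 else 1) (fun k => -y k) hb
        (fun k => by split_ifs <;> norm_num) (if_pos rfl)
      simp only [sub_neg_eq_add, add_sub_cancel_right] at hf hTf
      refine ⟨f, triebelLizorkinNorm_top_lt_top_of_separated hq hqt hδ hy hf, hfd,
        triebelLizorkinNorm_top_eq_top_of_same_centre hq hqt hψ hb hTf ?_⟩
      rw [eLpNorm_count_eq_tsum hq hqt, tsum_eq_zero_add' ENNReal.summable]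
      simp [hq0']
    -- These coefficients are in `ℓᵖ` but just fail to be in `ℓ^q`.
    · obtain ⟨f, hf, hfd, hTf⟩ := hlac s (fun k => (k : ℝ) ^ (-(1 / q.toReal))) (fun k => -y k)
        (fun k => by positivity) (fun k => natCast_rpow_neg_le_one hq0 k)
        (by rw [Nat.cast_zero, Real.zero_rpow (by linarith)])
      simp only [sub_neg_eq_add, add_sub_cancel_right] at hf hTf
      refine ⟨f, triebelLizorkinNorm_lt_top_of_separated hq h hpt hδ hy hf, hfd,
        triebelLizorkinNorm_eq_top_of_same_centre hp hpt hψ (fun k => by positivity) hTf ?_⟩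
      rw [eLpNorm_count_eq_tsum hq hqt]
      simp_rw [hrpow q hq hqt _ _ hq0', div_self hq0'.ne', Real.rpow_neg_one]
      rw [tsum_harmonic_eq_top, ENNReal.top_rpow_of_pos hq0]

end TriebelLizorkin

end LittlewoodPaley

end

theorem theorem1 {n : ℕ} (φ : ℕ → 𝓢(EuclideanSpace ℝ (Fin n), ℂ))
    (hφ : LittlewoodPaley.IsLittlewoodPaleyFamily φ)
    (y : ℕ → EuclideanSpace ℝ (Fin n))
    (hy : ∃ δ : ℝ, 0 < δ ∧ ∀ j k : ℕ, 1 ≤ j → 1 ≤ k → j ≠ k → δ ≤ ‖y j - y k‖) :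
    -- (i) `T` is everywhere defined and continuous on tempered distributions iff `y` grows
    -- at most exponentially
    (((LittlewoodPaley.shiftedSum φ y).domain = ⊤ ∧
        Continuous fun f : (LittlewoodPaley.shiftedSum φ y).domain =>
          LittlewoodPaley.shiftedSum φ y f) ↔
      ∃ N₀ : ℝ, 0 < N₀ ∧ ∀ j : ℕ, 1 ≤ j → ‖y j‖ ≤ (2 : ℝ) ^ (N₀ * (j : ℝ))) ∧
    -- (ii) `T` is defined and bounded on every Besov space
    (∀ (s : ℝ) (p q : ℝ≥0∞), 0 < p → 0 < q →
      ∃ C : ℝ≥0, ∀ f ∈ LittlewoodPaley.besovSpace φ s p q,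
        ∃ hf : f ∈ (LittlewoodPaley.shiftedSum φ y).domain,
          LittlewoodPaley.besovNorm φ s p q (LittlewoodPaley.shiftedSum φ y ⟨f, hf⟩) ≤
            C * LittlewoodPaley.besovNorm φ s p q f) ∧
    -- (iii) `T` does not map a Triebel–Lizorkin space with `p ≠ q` into itself
    (∀ (s : ℝ) (p q : ℝ≥0∞), 0 < p → 0 < q → p ≠ q →
      ∃ f ∈ LittlewoodPaley.triebelLizorkinSpace φ s p q,
        ∃ hf : f ∈ (LittlewoodPaley.shiftedSum φ y).domain,
          LittlewoodPaley.shiftedSum φ y ⟨f, hf⟩ ∉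
            LittlewoodPaley.triebelLizorkinSpace φ s p q) := by
  obtain ⟨δ, hδ, hsep⟩ := hy
  -- A one-point space has no two separated points, so the separation of `y` excludes dimension
  -- zero; a unit vector is needed for the lacunary series.
  have hn : 1 ≤ n := by
    rcases Nat.eq_zero_or_pos n with rfl | hn
    · have h := hsep 1 2 le_rfl one_le_two (by norm_num)
      rw [Subsingleton.elim (y 1) (y 2), sub_self, norm_zero] at h
      linarith
    · exact hn
  refine ⟨⟨fun h => LittlewoodPaley.exists_growth_of_domain_eq_top hφ h.1, ?_⟩,
    fun s p q hp hq => hφ.exists_besovNorm_shiftedSum_le s hp hq,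
    fun s p q hp hq hpq =>
      hφ.exists_shiftedSum_notMem_triebelLizorkinSpace hn hδ hsep s hp hq hpq⟩
  rintro ⟨N₀, -, h⟩
  exact LittlewoodPaley.domain_eq_top_and_continuous hφ h
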